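/- Let $M\ge 4$, $N=[M/2]$, and let $p\ge 0$ satisfy $4(p+1)\le M$. Let $\mathfrak g=so(M)$ be the complex orthogonal Lie algebra, realized by the matrices antisymmetric with respect to the antidiagonal. With matrix units $\mathcal E_{i,j}$ and $1\le i,j\le M$ put $$A_{i,j}=\mathcal E_{i,j}-\mathcal E_{M+1-j,M+1-i},\qquad H_i=\tfrac12(\mathcal E_{i,i}-\mathcal E_{M+1-i,M+1-i}),$$ $$E_{i-j}=-A_{i,j},\qquad E_{i+j}=-A_{i,M+1-j}\quad (i<j\le N),\qquad E_i=-A_{i,N+1}\ \text{ if } M=2N+1 .$$ For $0\le k\le p$ let $H^k_{1\pm2}=H_{2k+1}\pm H_{2k+2}$, $E^k_{1\pm 2}=E_{(2k+1)\pm(2k+2)}$, and, with $a=2k+1$, $b=2k+2$, $$I^{1\otimes2}_{M-4k}=\big[E_a\otimes E_b\big]+\sum_{l=2k+3}^N\big(E_{a+l}\otimes E_{b-l}+E_{a-l}\otimes E_{b+l}\big),\qquad I^{1}_{M-4k}=\big[\tfrac12E_a^2\big]+\sum_{l=2k+3}^N E_{a+l}E_{a-l},$$ and let $I^{1\wedge2}_{M-4k}$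 be the expression for $I^{1\otimes 2}_{M-4k}$ with $\otimes$ replaced by $\wedge$, where $x\wedge y=x\otimes y-y\otimes x$; the terms in square brackets are present only for odd $M$. Let $\eta_k,\xi_k\in\mathbb C$ ($0\le k\le p$) be arbitrary parameters, $h$ a formal parameter, and $U=U(\mathfrak g)$ with its standard coproduct $\Delta$ and counit $\epsilon$. In $U[[h]]$ put $$\sigma^k_{1+2}=\ln(1+h\eta_kE^k_{1+2}),\qquad G^k_{1-2}=E^k_{1-2}-h\eta_k I^1_{M-4k},\qquad \sigma^k_G=\ln(1+h\eta_k\xi_kG^k_{1-2}),$$ and in $(U\otimes U)[[h]]$ define $$\mathcal F=\prod_{k=p}^{0}\exp\!\big(H^k_{1-2}\otimes\sigma^k_G\big)\cdot\exp\!\big\{h\eta_kI^{1\otimes2}_{M-4k}\,(1\otimes e^{-\frac12\sigma^k_{1+2}})\big\}\cdot\exp\!\big(H^k_{1+2}\otimes\sigma^k_{1+2}\big),$$ the factors being ordered from left to right by $k=p,p-1,\dots,0$. Then: 1. $\mathcal F$ is invertible and satisfies the twist equations $$\mathcal F_{12}(\Delta\otimes\mathrm{id})\mathcal F=\mathcal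 F_{23}(\mathrm{id}\otimes\Delta)\mathcal F,\qquad(\epsilon\otimes\mathrm{id})\mathcal F=(\mathrm{id}\otimes\epsilon)\mathcal F=1 .$$ 2. $U[[h]]$ with the coproduct $\Delta_{\mathcal F}=\mathcal F\Delta\mathcal F^{-1}$ and the counit $\epsilon$ is a (topological) bialgebra, and $\mathcal R=\mathcal F_{21}\mathcal F^{-1}$ is a triangular universal $R$-matrix for it: $\mathcal R\,\Delta_{\mathcal F}=\Delta^{op}_{\mathcal F}\,\mathcal R$, $(\Delta_{\mathcal F}\otimes\mathrm{id})\mathcal R=\mathcal R_{13}\mathcal R_{23}$, $(\mathrm{id}\otimes\Delta_{\mathcal F})\mathcal R=\mathcal R_{13}\mathcal R_{12}$, $\mathcal R_{21}\mathcal R=1$. 3. The element $$r=\sum_{k=0}^p\eta_k\big(H^k_{1+2}\wedge E^k_{1+2}+\xi_kH^k_{1-2}\wedge E^k_{1-2}+I^{1\wedge2}_{M-4k}\big)\in\mathfrak g\otimes\mathfrak g$$ is antisymmetric and satisfies the classical Yang–Baxter equation $[r_{12},r_{13}]+[r_{12},r_{23}]+[r_{13},r_{23}]=0$, and $\mathcal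 F$ quantizes it: $\mathcal F\equiv1$ modulo $h$, and modulo $h^2$ one has $\mathcal R\equiv1-hr$ and $\Delta_{\mathcal F}(x)-\Delta_{\mathcal F}^{op}(x)\equiv h\,[r,\Delta(x)]$ for $x\in U$. 4. The image $\mathbf L\subset\mathfrak g$ of $\mathfrak g^*\to\mathfrak g$, $\varphi\mapsto(\varphi\otimes\mathrm{id})r$, is a Lie subalgebra, and $r$ corresponds on it to the coboundary Frobenius form $$\omega_p^{\pm}(x,y)=\sum_{k=0}^p\big(\gamma_k(E^k_{1+2})^*-\delta_k(E^k_{1-2})^*\big)([x,y]),\qquad \gamma_k=\frac1{\eta_k},\quad\delta_k=-\frac1{\eta_k\xi_k}$$ (with the convention $1/0=0$; $E^*$ denotes elements of the basis dual to the basis of $\mathfrak g$ formed by the $H_i$ and the root vectors). That is, $\omega_p^\pm$ is nondegenerate on $\mathbf L$ and is the inverse of $r$: $\omega_p^\pm(x,(\varphi\otimes\mathrm{id})r)=\varphi(x)$ for all $x\in\mathbf L$, $\varphi\in\mathfrak g^*$. If all $\eta_k,\xi_k$ are non-zero, $\mathbf L$ is the Lie subalgebra generated by $H_i$ and $A_{i,j}$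 with $1\le i\le2(p+1)$, $i<j\le M$. -/

import Mathlib

open scoped TensorProduct

attribute [local instance 100] LieRing.ofAssociativeRing

noncomputable section

/-! ### The universal enveloping algebra as a bialgebra -/

namespace UEA

variable (L : Type*) [LieRing L] [LieAlgebra ℂ L]

/-- The primitive coproduct `x ↦ x ⊗ 1 + 1 ⊗ x` on a Lie algebra. -/
def comulLie : L →ₗ⁅ℂ⁆
    (UniversalEnvelopingAlgebra ℂ L ⊗[ℂ] UniversalEnvelopingAlgebra ℂ L) where
  toFun x := UniversalEnvelopingAlgebra.ι ℂ x ⊗ₜ[ℂ] (1 : UniversalEnvelopingAlgebra ℂ L)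
    + (1 : UniversalEnvelopingAlgebra ℂ L) ⊗ₜ[ℂ] UniversalEnvelopingAlgebra.ι ℂ x
  map_add' x y := by
    simp only [map_add, TensorProduct.add_tmul, TensorProduct.tmul_add]; abel
  map_smul' c x := by
    simp only [map_smul, TensorProduct.smul_tmul', TensorProduct.tmul_smul, smul_add,
      RingHom.id_apply]
  map_lie' {x y} := by
    simp only [LieHom.map_lie, LieRing.of_associative_ring_bracket, mul_add, add_mul,
      Algebra.TensorProduct.tmul_mul_tmul, one_mul, mul_one, TensorProduct.sub_tmul,
      TensorProduct.tmul_sub]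
    abel

/-- The coproduct of `U(L)`. -/
def comul : UniversalEnvelopingAlgebra ℂ L →ₐ[ℂ]
    UniversalEnvelopingAlgebra ℂ L ⊗[ℂ] UniversalEnvelopingAlgebra ℂ L :=
  UniversalEnvelopingAlgebra.lift ℂ (comulLie L)

/-- The counit of `U(L)`. -/
def counit : UniversalEnvelopingAlgebra ℂ L →ₐ[ℂ] ℂ :=
  UniversalEnvelopingAlgebra.lift ℂ (0 : L →ₗ⁅ℂ⁆ ℂ)

theorem comul_ι (x : L) : comul L (UniversalEnvelopingAlgebra.ι ℂ x) =
    UniversalEnvelopingAlgebra.ι ℂ x ⊗ₜ[ℂ] (1 : UniversalEnvelopingAlgebra ℂ L)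
    + (1 : UniversalEnvelopingAlgebra ℂ L) ⊗ₜ[ℂ] UniversalEnvelopingAlgebra.ι ℂ x := by
  simp only [comul, UniversalEnvelopingAlgebra.lift_ι_apply]; rfl

theorem counit_ι (x : L) : counit L (UniversalEnvelopingAlgebra.ι ℂ x) = 0 := by
  simp only [counit, UniversalEnvelopingAlgebra.lift_ι_apply]; rfl

/-- `U(L)` with the primitive coproduct is a bialgebra. -/
instance instBialgebra : Bialgebra ℂ (UniversalEnvelopingAlgebra ℂ L) :=
  Bialgebra.ofAlgHom (comul L) (counit L)
    (by
      refine UniversalEnvelopingAlgebra.hom_ext ℂ (LieHom.ext fun x => ?_)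
      change Algebra.TensorProduct.assoc ℂ ℂ ℂ _ _ _ (Algebra.TensorProduct.map _ _
        (comul L (UniversalEnvelopingAlgebra.ι ℂ x))) = Algebra.TensorProduct.map _ _
        (comul L (UniversalEnvelopingAlgebra.ι ℂ x))
      simp [-UniversalEnvelopingAlgebra.ι_apply, comul_ι, TensorProduct.add_tmul,
        TensorProduct.tmul_add, Algebra.TensorProduct.one_def, add_assoc])
    (by
      refine UniversalEnvelopingAlgebra.hom_ext ℂ (@LieHom.ext _ _ _ _ _ (_) (_) (_) _ _ fun x => ?_)
      change Algebra.TensorProduct.map _ _ (comul L (UniversalEnvelopingAlgebra.ι ℂ x)) =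
        1 ⊗ₜ[ℂ] UniversalEnvelopingAlgebra.ι ℂ x
      simp [-UniversalEnvelopingAlgebra.ι_apply, comul_ι, counit_ι])
    (by
      refine UniversalEnvelopingAlgebra.hom_ext ℂ (LieHom.ext fun x => ?_)
      change Algebra.TensorProduct.map _ _ (comul L (UniversalEnvelopingAlgebra.ι ℂ x)) =
        UniversalEnvelopingAlgebra.ι ℂ x ⊗ₜ[ℂ] 1
      simp [-UniversalEnvelopingAlgebra.ι_apply, comul_ι, counit_ι])

end UEA

/-! ### Twists and triangular structures on `A[[h]]` for a bialgebra `A`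

The power series ring over `A ⊗ A` is the `h`-adically completed tensor square of `A[[h]]`;
the maps of `A` are extended to power series coefficientwise. -/

namespace Twist

section Bialg

variable {A : Type*} [Ring A] [Bialgebra ℂ A]

/-- `a ⊗ b ↦ a ⊗ b ⊗ 1`. -/
def leg12 : A ⊗[ℂ] A →ₐ[ℂ] A ⊗[ℂ] (A ⊗[ℂ] A) :=
  Algebra.TensorProduct.map (AlgHom.id ℂ A) Algebra.TensorProduct.includeLeft

/-- `a ⊗ b ↦ a ⊗ 1 ⊗ b`. -/
def leg13 : A ⊗[ℂ] A →ₐ[ℂ] A ⊗[ℂ] (A ⊗[ℂ] A) :=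
  Algebra.TensorProduct.map (AlgHom.id ℂ A) Algebra.TensorProduct.includeRight

/-- `a ⊗ b ↦ 1 ⊗ a ⊗ b`. -/
def leg23 : A ⊗[ℂ] A →ₐ[ℂ] A ⊗[ℂ] (A ⊗[ℂ] A) :=
  Algebra.TensorProduct.includeRight

/-- `Δ ⊗ id`. -/
def comulL : A ⊗[ℂ] A →ₐ[ℂ] A ⊗[ℂ] (A ⊗[ℂ] A) :=
  (Algebra.TensorProduct.assoc ℂ ℂ ℂ A A A).toAlgHom.comp
    (Algebra.TensorProduct.map (Bialgebra.comulAlgHom ℂ A) (AlgHom.id ℂ A))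

/-- `id ⊗ Δ`. -/
def comulR : A ⊗[ℂ] A →ₐ[ℂ] A ⊗[ℂ] (A ⊗[ℂ] A) :=
  Algebra.TensorProduct.map (AlgHom.id ℂ A) (Bialgebra.comulAlgHom ℂ A)

/-- `ε ⊗ id`. -/
def counitL : A ⊗[ℂ] A →ₐ[ℂ] A :=
  (Algebra.TensorProduct.lid ℂ A).toAlgHom.comp
    (Algebra.TensorProduct.map (Bialgebra.counitAlgHom ℂ A) (AlgHom.id ℂ A))

/-- `id ⊗ ε`. -/
def counitR : A ⊗[ℂ] A →ₐ[ℂ] A :=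
  (Algebra.TensorProduct.rid ℂ ℂ A).toAlgHom.comp
    (Algebra.TensorProduct.map (AlgHom.id ℂ A) (Bialgebra.counitAlgHom ℂ A))

/-- `a ⊗ b ↦ b ⊗ a`. -/
def flip : A ⊗[ℂ] A →ₐ[ℂ] A ⊗[ℂ] A :=
  (Algebra.TensorProduct.comm ℂ A A).toAlgHom

/-- Coefficientwise extension of an algebra homomorphism to formal power series in `h`. -/
def ext {B C : Type*} [Ring B] [Algebra ℂ B] [Ring C] [Algebra ℂ C] (f : B →ₐ[ℂ] C) :
    PowerSeries B →+* PowerSeries C :=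
  PowerSeries.map (f : B →+* C)

/-- An invertible `F ∈ (A ⊗ A)[[h]]` satisfying the twist equations. -/
structure IsTwist (F : PowerSeries (A ⊗[ℂ] A)) : Prop where
  isUnit : IsUnit F
  cocycle : ext leg12 F * ext comulL F = ext leg23 F * ext comulR F
  counit_left : ext counitL F = 1
  counit_right : ext counitR F = 1

/-- The twisted coproduct `Δ_F = F Δ(·) F⁻¹`. -/
def comulF (F : PowerSeries (A ⊗[ℂ] A)) (x : PowerSeries A) : PowerSeries (A ⊗[ℂ] A) :=
  F * ext (Bialgebra.comulAlgHom ℂ A) x * Ring.inverse F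

/-- `Δ_F ⊗ id`. -/
def comulFL (F G : PowerSeries (A ⊗[ℂ] A)) : PowerSeries (A ⊗[ℂ] (A ⊗[ℂ] A)) :=
  ext leg12 F * ext comulL G * ext leg12 (Ring.inverse F)

/-- `id ⊗ Δ_F`. -/
def comulFR (F G : PowerSeries (A ⊗[ℂ] A)) : PowerSeries (A ⊗[ℂ] (A ⊗[ℂ] A)) :=
  ext leg23 F * ext comulR G * ext leg23 (Ring.inverse F)

/-- The element `F₂₁ F⁻¹`. -/
def univR (F : PowerSeries (A ⊗[ℂ] A)) : PowerSeries (A ⊗[ℂ] A) :=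
  ext flip F * Ring.inverse F

/-- `(A[[h]], Δ_F, ε)` is a (topological) bialgebra and `R` is a triangular universal
`R`-matrix for it. -/
structure IsTriangular (F R : PowerSeries (A ⊗[ℂ] A)) : Prop where
  coassoc : ∀ x : PowerSeries A, comulFL F (comulF F x) = comulFR F (comulF F x)
  counit_left : ∀ x : PowerSeries A, ext counitL (comulF F x) = x
  counit_right : ∀ x : PowerSeries A, ext counitR (comulF F x) = x
  isUnit : IsUnit R
  intertwines : ∀ x : PowerSeries A, R * comulF F x = ext flip (comulF F x) * R
  hexagon_left : comulFL F R = ext leg13 R * ext leg23 R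
  hexagon_right : comulFR F R = ext leg13 R * ext leg12 R
  unitary : ext flip R * R = 1

end Bialg

section Series

variable {B : Type*} [Ring B] [Algebra ℂ B]

/-- `exp f = ∑ fⁿ / n!` for a power series `f` in `h` without constant term
(then `fⁿ` does not contribute to the coefficient of `hᵐ` for `n > m`). -/
def expS (f : PowerSeries B) : PowerSeries B :=
  PowerSeries.mk fun m => ∑ n ∈ Finset.range (m + 1),
    ((n.factorial : ℂ)⁻¹) • PowerSeries.coeff m (f ^ n)

/-- `ln (1 + f) = ∑_{n ≥ 1} (-1)ⁿ⁺¹ fⁿ / n` for a power series `f` in `h` without constant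
term. -/
def logS (f : PowerSeries B) : PowerSeries B :=
  PowerSeries.mk fun m => ∑ n ∈ Finset.Icc 1 m,
    ((-1 : ℂ) ^ (n + 1) / (n : ℂ)) • PowerSeries.coeff m (f ^ n)

/-- `a ⊗ b ∈ (B ⊗ B)[[h]]` for `a, b ∈ B[[h]]`. -/
def tens (a b : PowerSeries B) : PowerSeries (B ⊗[ℂ] B) :=
  ext (Algebra.TensorProduct.includeLeft : B →ₐ[ℂ] B ⊗[ℂ] B) a *
    ext (Algebra.TensorProduct.includeRight : B →ₐ[ℂ] B ⊗[ℂ] B) b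

end Series

end Twist

/-! ### Classical `r`-matrices and Frobenius forms -/

namespace Classical2

variable {L : Type*} [LieRing L] [LieAlgebra ℂ L]

/-- The inclusion `L ⊗ L → U(L) ⊗ U(L)`. -/
def toU : L ⊗[ℂ] L →ₗ[ℂ] UniversalEnvelopingAlgebra ℂ L ⊗[ℂ] UniversalEnvelopingAlgebra ℂ L :=
  TensorProduct.map (UniversalEnvelopingAlgebra.ι ℂ : L →ₗ⁅ℂ⁆ _).toLinearMap
    (UniversalEnvelopingAlgebra.ι ℂ : L →ₗ⁅ℂ⁆ _).toLinearMap

/-- `x ∧ y = x ⊗ y - y ⊗ x`. -/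
def wedge (x y : L) : L ⊗[ℂ] L := x ⊗ₜ[ℂ] y - y ⊗ₜ[ℂ] x

/-- The commutator in an associative ring. -/
def commutator {B : Type*} [Ring B] (a b : B) : B := a * b - b * a

/-- Antisymmetric solutions of the classical Yang-Baxter equation
`[r₁₂, r₁₃] + [r₁₂, r₂₃] + [r₁₃, r₂₃] = 0`. -/
structure IsRMatrix (r : L ⊗[ℂ] L) : Prop where
  skew : TensorProduct.comm ℂ L L r = -r
  cybe : commutator (Twist.leg12 (toU r)) (Twist.leg13 (toU r)) +
    commutator (Twist.leg12 (toU r)) (Twist.leg23 (toU r)) +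
    commutator (Twist.leg13 (toU r)) (Twist.leg23 (toU r)) = 0

open Twist in
/-- The twist `F` quantizes `r`: modulo `h²` one has `Δ_F - Δ_F^op = h [r, Δ]` (so that the
semiclassical limit of `Δ_F` is the cobracket of `r`), and `F₂₁ F⁻¹ = 1 - h r`. -/
structure Quantizes
    (F : PowerSeries (UniversalEnvelopingAlgebra ℂ L ⊗[ℂ] UniversalEnvelopingAlgebra ℂ L))
    (r : L ⊗[ℂ] L) : Prop where
  coeff_zero : PowerSeries.coeff 0 F = 1
  coeff_zero_R : PowerSeries.coeff 0 (univR F) = 1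
  coeff_one_R : PowerSeries.coeff 1 (univR F) = -toU r
  cobracket : ∀ x : UniversalEnvelopingAlgebra ℂ L,
    PowerSeries.coeff 1 (comulF F (PowerSeries.C x) - ext flip (comulF F (PowerSeries.C x))) =
      commutator (toU r) (Bialgebra.comulAlgHom ℂ (UniversalEnvelopingAlgebra ℂ L) x)

/-- The map `L* → L`, `φ ↦ (φ ⊗ id)(r)`. -/
def sharp (r : L ⊗[ℂ] L) : Module.Dual ℂ L →ₗ[ℂ] L where
  toFun φ := TensorProduct.lid ℂ L (LinearMap.rTensor L φ r)
  map_add' φ ψ := by simp [LinearMap.rTensor_add]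
  map_smul' c φ := by simp [LinearMap.rTensor_smul]

/-- `K` is the carrier of `r` (the image of `L* → L`), the coboundary form
`ω_f (x, y) = f [x, y]` is nondegenerate on `K` (so `K` is Frobenius), and `ω_f` on `K` is inverse
to `r`: `ω_f (x, (φ ⊗ id) r) = φ x`. -/
structure Corresponds (r : L ⊗[ℂ] L) (f : Module.Dual ℂ L) (K : LieSubalgebra ℂ L) : Prop where
  carrier : K.toSubmodule = LinearMap.range (sharp r)
  nondegenerate : ∀ x ∈ K, (∀ y ∈ K, f ⁅x, y⁆ = 0) → x = 0
  inverse : ∀ φ : Module.Dual ℂ L, ∀ x ∈ K, f ⁅x, sharp r φ⁆ = φ x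

end Classical2

/-! ### The orthogonal algebra and the full chain -/

namespace SOChain

open Twist Classical2

/-- The antidiagonal matrix. -/
def antidiag (M : ℕ) : Matrix (Fin M) (Fin M) ℂ :=
  Matrix.of fun a b => if a.1 + b.1 + 1 = M then 1 else 0

/-- The complex orthogonal Lie algebra `so(M)`, realized by the matrices that are skew-adjoint
for the symmetric bilinear form with the antidiagonal Gram matrix. -/
abbrev so (M : ℕ) : LieSubalgebra ℂ (Matrix (Fin M) (Fin M) ℂ) :=
  skewAdjointMatricesLieSubalgebra (antidiag M)

/-- The universal enveloping algebra `U(so(M))`. -/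
abbrev U (M : ℕ) : Type := UniversalEnvelopingAlgebra ℂ (so M)

/-- The matrix unit with indices `i, j ∈ {1, …, M}` (zero for indices out of this range). -/
def unit (M i j : ℕ) : Matrix (Fin M) (Fin M) ℂ :=
  Matrix.of fun a b => if a.1 + 1 = i ∧ b.1 + 1 = j then 1 else 0

theorem antidiag_mul (M : ℕ) (X : Matrix (Fin M) (Fin M) ℂ) (a b : Fin M) :
    (antidiag M * X) a b = X a.rev b := by
  rw [Matrix.mul_apply, Finset.sum_eq_single a.rev]
  · have : a.1 + a.rev.1 + 1 = M := by rw [Fin.val_rev]; omega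
    simp only [antidiag, Matrix.of_apply, if_pos this, one_mul]
  · intro c _ hc
    have : ¬ (a.1 + c.1 + 1 = M) := fun h => hc (by ext; rw [Fin.val_rev]; omega)
    simp [antidiag, this]
  · simp

theorem mul_antidiag (M : ℕ) (X : Matrix (Fin M) (Fin M) ℂ) (a b : Fin M) :
    (X * antidiag M) a b = X a b.rev := by
  rw [Matrix.mul_apply, Finset.sum_eq_single b.rev]
  · have : b.rev.1 + b.1 + 1 = M := by rw [Fin.val_rev]; omega
    simp only [antidiag, Matrix.of_apply, if_pos this, mul_one]
  · intro c _ hc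
    have : ¬ (c.1 + b.1 + 1 = M) := fun h => hc (by ext; rw [Fin.val_rev]; omega)
    simp [antidiag, this]
  · simp

/-- `A_{i,j} = ℰ_{i,j} - ℰ_{M+1-j,M+1-i}`, with indices from `1` to `M`. -/
def A (M i j : ℕ) : so M :=
  ⟨unit M i j - unit M (M + 1 - j) (M + 1 - i), by
    rw [mem_skewAdjointMatricesLieSubalgebra, mem_skewAdjointMatricesSubmodule]
    change _ * _ = _ * (- _)
    ext a b
    rw [mul_antidiag, antidiag_mul]
    have ha := a.2
    have hb := b.2
    simp only [Matrix.transpose_apply, Matrix.sub_apply, Matrix.neg_apply, unit, Matrix.of_apply,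
      Fin.val_rev]
    have h1 : (M - (b.1 + 1) + 1 = i ∧ a.1 + 1 = j) ↔
        (M - (a.1 + 1) + 1 = M + 1 - j ∧ b.1 + 1 = M + 1 - i) := by omega
    have h2 : (M - (b.1 + 1) + 1 = M + 1 - j ∧ a.1 + 1 = M + 1 - i) ↔
        (M - (a.1 + 1) + 1 = i ∧ b.1 + 1 = j) := by omega
    simp only [h1, h2]
    ring⟩

variable (M : ℕ)

/-- `H_i = (ℰ_{i,i} - ℰ_{M+1-i,M+1-i}) / 2`. -/
def H (i : ℕ) : so M := (1 / 2 : ℂ) • A M i i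

/-- The root vector `E_{i+j}` (root `e_i + e_j`, `i < j ≤ [M/2]`). -/
def Epl (i j : ℕ) : so M := -A M i (M + 1 - j)

/-- The root vector `E_{i-j}` (root `e_i - e_j`, `i < j ≤ [M/2]`). -/
def Emi (i j : ℕ) : so M := -A M i j

/-- The root vector `E_i` (root `e_i`) of `so(2N+1)`; here `[M/2] + 1 = N + 1`. -/
def Esh (i : ℕ) : so M := -A M i (M / 2 + 1)

/-! Generators of the `k`-th subalgebra `so(M-4k)`: its local indices `1, 2, 3, …` are the
indices `2k+1, 2k+2, 2k+3, …` of `so(M)`. -/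

/-- `H_{1+2}^k`. -/
def Hp (k : ℕ) : so M := H M (2 * k + 1) + H M (2 * k + 2)

/-- `H_{1-2}^k`. -/
def Hm (k : ℕ) : so M := H M (2 * k + 1) - H M (2 * k + 2)

/-- `E_{1+2}^k`. -/
def Ep (k : ℕ) : so M := Epl M (2 * k + 1) (2 * k + 2)

/-- `E_{1-2}^k`. -/
def Em (k : ℕ) : so M := Emi M (2 * k + 1) (2 * k + 2)

/-- The tensor invariant `I_{M-4k}^{1⊗2}`. -/
def tensorInv (k : ℕ) : so M ⊗[ℂ] so M :=
  (if Odd M then Esh M (2 * k + 1) ⊗ₜ[ℂ] Esh M (2 * k + 2) else 0) +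
    ∑ l ∈ Finset.Icc (2 * k + 3) (M / 2),
      (Epl M (2 * k + 1) l ⊗ₜ[ℂ] Emi M (2 * k + 2) l +
        Emi M (2 * k + 1) l ⊗ₜ[ℂ] Epl M (2 * k + 2) l)

/-- The invariant `I_{M-4k}^{1∧2}`. -/
def wedgeInv (k : ℕ) : so M ⊗[ℂ] so M :=
  (if Odd M then wedge (Esh M (2 * k + 1)) (Esh M (2 * k + 2)) else 0) +
    ∑ l ∈ Finset.Icc (2 * k + 3) (M / 2),
      (wedge (Epl M (2 * k + 1) l) (Emi M (2 * k + 2) l) +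
        wedge (Emi M (2 * k + 1) l) (Epl M (2 * k + 2) l))

/-- The inclusion `so(M) → U(so(M))`. -/
def inc (x : so M) : U M := UniversalEnvelopingAlgebra.ι ℂ x

/-- The scalar invariant `I_{M-4k}^1` in `U(so(M))`. -/
def scalarInv (k : ℕ) : U M :=
  (if Odd M then (1 / 2 : ℂ) • inc M (Esh M (2 * k + 1)) ^ 2 else 0) +
    ∑ l ∈ Finset.Icc (2 * k + 3) (M / 2),
      inc M (Epl M (2 * k + 1) l) * inc M (Emi M (2 * k + 1) l)

/-- `σ_{1+2}^k = ln (1 + h η E_{1+2}^k)`. -/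
def sigma (k : ℕ) (η : ℂ) : PowerSeries (U M) :=
  logS (PowerSeries.monomial 1 (η • inc M (Ep M k)))

/-- The deformed generator `G_{1-2}^k = E_{1-2}^k - h η I_{M-4k}^1`. -/
def G (k : ℕ) (η : ℂ) : PowerSeries (U M) :=
  PowerSeries.C (inc M (Em M k)) - PowerSeries.monomial 1 (η • scalarInv M k)

/-- `σ_G^k = ln (1 + h η ξ G_{1-2}^k)`. -/
def sigmaG (k : ℕ) (η ξ : ℂ) : PowerSeries (U M) :=
  logS (PowerSeries.monomial 1 (algebraMap ℂ (U M) (η * ξ)) * G M k η)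

/-- The `k`-th link
`exp (H_{1-2}^k ⊗ σ_G^k) · exp (h η I_{M-4k}^{1⊗2} (1 ⊗ e^{-σ_{1+2}^k / 2})) ·
exp (H_{1+2}^k ⊗ σ_{1+2}^k)` of the chain. -/
def link (k : ℕ) (η ξ : ℂ) : PowerSeries (U M ⊗[ℂ] U M) :=
  expS (tens (PowerSeries.C (inc M (Hm M k))) (sigmaG M k η ξ)) *
  expS (PowerSeries.monomial 1 (η • toU (tensorInv M k)) *
    tens 1 (expS ((-1 / 2 : ℂ) • sigma M k η))) *
  expS (tens (PowerSeries.C (inc M (Hp M k))) (sigma M k η))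

/-- The full chain: the product of the links `p, p-1, …, 0`, in this order from left to right. -/
def chain (η ξ : ℕ → ℂ) : ℕ → PowerSeries (U M ⊗[ℂ] U M)
  | 0 => link M 0 (η 0) (ξ 0)
  | p + 1 => link M (p + 1) (η (p + 1)) (ξ (p + 1)) * chain η ξ p

/-- The classical `r`-matrix
`∑_{k ≤ p} η_k (H_{1+2}^k ∧ E_{1+2}^k + ξ_k H_{1-2}^k ∧ E_{1-2}^k + I_{M-4k}^{1∧2})`. -/
def rMat (η ξ : ℕ → ℂ) (p : ℕ) : so M ⊗[ℂ] so M :=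
  ∑ k ∈ Finset.range (p + 1),
    η k • (wedge (Hp M k) (Ep M k) + ξ k • wedge (Hm M k) (Em M k) + wedgeInv M k)

/-- For a root vector `e = E_{i±j}` of `so(M)` this is the element `e*` of the dual of the basis
formed by the `H_i` and the root vectors: that basis is orthogonal for `tr (xᵀ y)`, and
`tr (eᵀ e) = 2`. -/
def dualElt (e : so M) : Module.Dual ℂ (so M) where
  toFun x := (1 / 2 : ℂ) * Matrix.trace ((e : Matrix (Fin M) (Fin M) ℂ).transpose *
    (x : Matrix (Fin M) (Fin M) ℂ))
  map_add' x y := by simp [mul_add]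
  map_smul' c x := by simp [mul_left_comm]

/-- The functional `∑_{k ≤ p} (γ_k (E_{1+2}^k)* - δ_k (E_{1-2}^k)*)`, whose coboundary is the
form `ω_p^±`. -/
def omegaFun (γ δ : ℕ → ℂ) (p : ℕ) : Module.Dual ℂ (so M) :=
  ∑ k ∈ Finset.range (p + 1), (γ k • dualElt M (Ep M k) - δ k • dualElt M (Em M k))

/-- The Lie subalgebra generated by `H_i` (`1 ≤ i ≤ 2K`) and `A_{i,j}`
(`1 ≤ i ≤ 2K`, `i < j ≤ M`). -/
def frobSub (K : ℕ) : LieSubalgebra ℂ (so M) :=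
  LieSubalgebra.lieSpan ℂ (so M)
    ({x | ∃ i, 1 ≤ i ∧ i ≤ 2 * K ∧ x = H M i} ∪
      {x | ∃ i j, 1 ≤ i ∧ i ≤ 2 * K ∧ i < j ∧ j ≤ M ∧ x = A M i j})

end SOChain

end

noncomputable section

/-! ### Functional calculus for power series without constant term -/

namespace Twist

section Calculus

open PowerSeries Finset

/-! A product `F' * F` is a twist once `F` is one and `F'` satisfies the twist equation for the
coproduct already deformed by `F` (`IsTwist.mul`). The chain grows this way from the right; the work
is to know, at each stage, the deformed coproducts of the generators that enter the next factor.

Inside a link, write x_j = A_{2k+1,j} and y_j = A_{2k+2,M+1-j}. The Jordanian factor exp(H_{1+2} ⊗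
σ) makes e^σ group-like and turns the coproducts of x_j and y_j, of weight 1/2, into z ⊗ e^{σ/2} + 1
⊗ z. Since x and y form a Heisenberg algebra with central element E_{1+2}, the extension factor then
satisfies `IsTwist.extension`. After these two factors E_{1-2} is no longer primitive, but its
defect is quadratic in the x_j and is exactly compensated by the scalar invariant: G is primitive
(`LinkRelations.extended_mul_linkG`), H_{1-2} has stayed primitive, and [H_{1-2}, G] = G. Hence a
second Jordanian factor can be applied (`IsTwist.jordanian`).

Between links, so(M-4k-4) commutes with H_{1±2}, E_{1±2} and acts on the x_j and y_j by dual
orthogonal matrices. So both invariants are fixed and the whole link commutes with the coproducts of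
that subalgebra (`commute_link_comulS`). The later links live in it, see an undeformed coproduct,
and compose freely.

The rest is formal. A twist of a cocommutative bialgebra gives a triangular structure
(`IsTwist.isTriangular`); r is read off from the first-order coefficient, and the classical
Yang–Baxter equation is the h² coefficient of the quantum one (`IsTwist.classicalYangBaxter`).
Contracting that equation with two functionals shows that the range of r is closed under the
bracket. Finally r = ∑ c_j p_j ∧ q_j, where the p_j, q_j are Darboux vectors for ω with pairings 1 /
c_j (`isDarboux`), so ω inverts r by linear algebra. When no c_j vanishes the range contains every
p_j and q_j, and these produce all the generators of the Lie subalgebra in the last claim. -/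

theorem coeff_pow_of_lt {B : Type*} [Ring B] {f : PowerSeries B} (hf : coeff 0 f = 0) {m n : ℕ} (h : m < n) :
    coeff m (f ^ n) = 0 := by
  have hX : (X : PowerSeries B) ∣ f := X_dvd_iff.mpr (by simpa using hf)
  obtain ⟨g, rfl⟩ := hX
  rw [(PowerSeries.commute_X g).symm.mul_pow, coeff_X_pow_mul', if_neg (by omega)]

theorem coeff_mul_congr {B : Type*} [Ring B] {a a' b b' : PowerSeries B} {m : ℕ} (ha : ∀ i ≤ m, coeff i a = coeff i a')
    (hb : ∀ i ≤ m, coeff i b = coeff i b') : coeff m (a * b) = coeff m (a' * b') := by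
  rw [coeff_mul, coeff_mul]
  refine sum_congr rfl fun p hp => ?_
  have := mem_antidiagonal.mp hp
  rw [ha _ (by omega), hb _ (by omega)]

variable {B C : Type*} [Ring B] [Algebra ℂ B] [Ring C] [Algebra ℂ C]

theorem coeff_complex_smul (c : ℂ) (f : PowerSeries B) (n : ℕ) : coeff n (c • f) = c • coeff n f := by
  rw [← one_smul B f, ← smul_assoc, coeff_smul, coeff_smul, smul_assoc]

/-- The series `∑ cₙ fⁿ` for a power series `f` without constant term. -/
def powSum (c : ℕ → ℂ) (f : PowerSeries B) : PowerSeries B :=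
  PowerSeries.mk fun m => ∑ n ∈ range (m + 1), c n • coeff m (f ^ n)

/-- Powers beyond the m-th have no coefficient at m, so any bound above m gives the same value. This
freedom in `N` lets identities between infinite sums be checked on finite ones of convenient length.
-/
theorem coeff_powSum {f : PowerSeries B} (hf : coeff 0 f = 0) (c : ℕ → ℂ) {m N : ℕ} (h : m < N) :
    coeff m (powSum c f) = coeff m (∑ n ∈ range N, c n • f ^ n) := by
  rw [powSum, coeff_mk, map_sum]
  simp only [coeff_complex_smul]
  refine sum_subset (by simpa using h) fun n _ hn => ?_
  rw [coeff_pow_of_lt hf (by simpa using hn), smul_zero]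

theorem expS_eq_powSum (f : PowerSeries B) : expS f = powSum (fun n => (n.factorial : ℂ)⁻¹) f := rfl

theorem logS_eq_powSum (f : PowerSeries B) :
    logS f = powSum (fun n => (-1 : ℂ) ^ (n + 1) / (n : ℂ)) f := by
  ext m
  rw [logS, powSum, coeff_mk, coeff_mk]
  refine sum_subset (fun n => by simp) fun n hn hn' => ?_
  have : n = 0 := by simp at hn hn'; omega
  simp [this]

/-- The relation passes to all powers, hence to every series. It is the main tool for the
exponentials below: conjugating an exponential reduces to an intertwining relation of the exponents.
-/
theorem powSum_intertwine {f g a : PowerSeries B} (hf : coeff 0 f = 0) (hg : coeff 0 g = 0)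
    (h : f * a = a * g) (c : ℕ → ℂ) : powSum c f * a = a * powSum c g := by
  have hn : ∀ n, f ^ n * a = a * g ^ n := fun n => by
    induction n with
    | zero => simp
    | succ n ih => rw [pow_succ, mul_assoc, h, ← mul_assoc, ih, mul_assoc, ← pow_succ]
  ext m
  rw [coeff_mul_congr (a' := ∑ n ∈ range (m + 1), c n • f ^ n) (b' := a)
      (fun i hi => coeff_powSum hf c (by omega)) fun _ _ => rfl,
    coeff_mul_congr (a := a) (a' := a) (b' := ∑ n ∈ range (m + 1), c n • g ^ n) (fun _ _ => rfl)
      (fun i hi => coeff_powSum hg c (by omega)), sum_mul, mul_sum]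
  simp only [smul_mul_assoc, mul_smul_comm, hn]

theorem expS_intertwine {f g a : PowerSeries B} (hf : coeff 0 f = 0) (hg : coeff 0 g = 0)
    (h : f * a = a * g) : expS f * a = a * expS g :=
  powSum_intertwine hf hg h _

theorem logS_intertwine {f g a : PowerSeries B} (hf : coeff 0 f = 0) (hg : coeff 0 g = 0)
    (h : f * a = a * g) : logS f * a = a * logS g := by
  rw [logS_eq_powSum, logS_eq_powSum]
  exact powSum_intertwine hf hg h _

theorem commute_expS {f a : PowerSeries B} (hf : coeff 0 f = 0) (h : Commute a f) :
    Commute a (expS f) :=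
  (expS_intertwine hf hf h.symm.eq).symm

theorem commute_logS {f a : PowerSeries B} (hf : coeff 0 f = 0) (h : Commute a f) :
    Commute a (logS f) :=
  (logS_intertwine hf hf h.symm.eq).symm

theorem ext_expS (φ : B →ₐ[ℂ] C) (f : PowerSeries B) : ext φ (expS f) = expS (ext φ f) := by
  ext m
  simp only [ext, expS, coeff_map, coeff_mk, map_sum, ← map_pow]
  exact sum_congr rfl fun n _ => map_smul φ _ _

theorem ext_logS (φ : B →ₐ[ℂ] C) (f : PowerSeries B) : ext φ (logS f) = logS (ext φ f) := by
  ext m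
  simp only [ext, logS, coeff_map, coeff_mk, map_sum, ← map_pow]
  exact sum_congr rfl fun n _ => map_smul φ _ _

theorem coeff_ext (φ : B →ₐ[ℂ] C) (f : PowerSeries B) (n : ℕ) :
    coeff n (ext φ f) = φ (coeff n f) := by
  rw [ext, coeff_map]; rfl

theorem coeff_zero_powSum (c : ℕ → ℂ) (f : PowerSeries B) : coeff 0 (powSum c f) = c 0 • 1 := by
  simp [powSum]

theorem coeff_zero_expS (f : PowerSeries B) : coeff 0 (expS f) = 1 := by
  simp [expS_eq_powSum, coeff_zero_powSum]

theorem coeff_zero_logS (f : PowerSeries B) : coeff 0 (logS f) = 0 := by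
  simp [logS_eq_powSum, coeff_zero_powSum]

theorem coeff_one_expS (f : PowerSeries B) : coeff 1 (expS f) = coeff 1 f := by
  simp [expS, sum_range_succ, coeff_one]

theorem coeff_one_logS (f : PowerSeries B) : coeff 1 (logS f) = coeff 1 f := by
  simp [logS]

theorem expS_zero : expS (0 : PowerSeries B) = 1 := by
  ext m
  rw [expS_eq_powSum, coeff_powSum (by simp) _ (Nat.lt_succ_self m), sum_eq_single 0]
  · simp
  · intro b _ hb; simp [hb]
  · simp

theorem logS_zero : logS (0 : PowerSeries B) = 0 := by
  ext m
  rw [logS_eq_powSum, coeff_powSum (by simp) _ (Nat.lt_succ_self m), sum_eq_single 0]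
  · simp
  · intro b _ hb; simp [hb]
  · simp

theorem expS_add {f g : PowerSeries B} (hf : coeff 0 f = 0) (hg : coeff 0 g = 0)
    (h : Commute f g) : expS (f + g) = expS f * expS g := by
  have hterm : ∀ n, ((n.factorial : ℂ)⁻¹) • (f + g) ^ n = ∑ p ∈ antidiagonal n,
      (((p.1.factorial : ℂ)⁻¹) • f ^ p.1) * (((p.2.factorial : ℂ)⁻¹) • g ^ p.2) := fun n => by
    rw [h.add_pow', smul_sum]
    refine sum_congr rfl fun p hp => ?_
    obtain rfl := mem_antidiagonal.mp hp
    rw [smul_mul_smul_comm, ← Nat.cast_smul_eq_nsmul ℂ, smul_smul, Nat.cast_add_choose]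
    congr 1
    have := Nat.factorial_ne_zero (p.1 + p.2)
    have := Nat.factorial_ne_zero p.1
    have := Nat.factorial_ne_zero p.2
    field_simp
  ext m
  rw [expS_eq_powSum f, expS_eq_powSum g, coeff_mul_congr (fun i hi => coeff_powSum hf _ (Nat.lt_succ_of_le hi))
    (fun i hi => coeff_powSum hg _ (Nat.lt_succ_of_le hi)), expS_eq_powSum,
    coeff_powSum (by rw [map_add, hf, hg, add_zero]) _ (Nat.lt_succ_self m), sum_congr rfl fun n _ => hterm n,
    sum_mul_sum, ← sum_product', map_sum, map_sum]
  simp only [map_sum]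
  rw [sum_sigma']
  -- The triangle i + j ≤ m of the square reproduces the binomial sums of the left side; outside it
  -- f^i g^j is divisible by X^(i+j) and contributes nothing at degree m.
  rw [← sum_filter_add_sum_filter_not (range m.succ ×ˢ range m.succ) fun p => p.1 + p.2 ≤ m]
  rw [sum_eq_zero (s := filter (fun p : ℕ × ℕ => ¬ p.1 + p.2 ≤ m) (range m.succ ×ˢ range m.succ)),
    add_zero]
  · refine sum_bij' (fun x _ => x.2) (fun p _ => ⟨p.1 + p.2, p⟩) ?_ ?_ ?_ ?_ ?_
    · rintro ⟨n, p⟩ hp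
      simp at hp ⊢; omega
    · rintro p hp
      simp at hp ⊢; omega
    · rintro ⟨n, p⟩ hp
      simp at hp ⊢; omega
    · intro p _; rfl
    · intro x _; rfl
  · rintro ⟨i, j⟩ hp
    simp only [mem_filter, not_le] at hp
    have hX : ∀ {u : PowerSeries B}, coeff 0 u = 0 → ∀ n, ∃ v, u ^ n = X ^ n * v := fun {u} hu n => by
      obtain ⟨v, rfl⟩ : X ∣ u := X_dvd_iff.mpr (by simpa using hu)
      exact ⟨v ^ n, (PowerSeries.commute_X v).symm.mul_pow n⟩
    obtain ⟨v, hv⟩ := hX hf i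
    obtain ⟨w, hw⟩ := hX hg j
    rw [smul_mul_smul_comm, coeff_complex_smul, hv, hw, mul_assoc, ← mul_assoc v, (PowerSeries.commute_X_pow v j).eq,
      mul_assoc, ← mul_assoc, ← pow_add, coeff_X_pow_mul', if_neg (by omega), smul_zero]

theorem expS_neg_mul {f : PowerSeries B} (hf : coeff 0 f = 0) : expS (-f) * expS f = 1 := by
  rw [← expS_add (by rw [map_neg, hf, neg_zero]) hf (Commute.neg_left (Commute.refl f)), neg_add_cancel, expS_zero]

theorem expS_mul_neg {f : PowerSeries B} (hf : coeff 0 f = 0) : expS f * expS (-f) = 1 := by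
  simpa using expS_neg_mul (f := -f) (by rw [map_neg, hf, neg_zero])

theorem isUnit_expS {f : PowerSeries B} (hf : coeff 0 f = 0) : IsUnit (expS f) :=
  ⟨⟨_, _, expS_mul_neg hf, expS_neg_mul hf⟩, rfl⟩

/-- If f starts at order m ≥ 1, then f² and higher powers start at order at least 2m, so the
degree-m coefficient of exp f is that of f itself; induct on m. -/
theorem expS_eq_one {f : PowerSeries B} (hf : coeff 0 f = 0) (h : expS f = 1) : f = 0 := by
  ext m
  induction m using Nat.strong_induction_on with
  | _ m ih =>
    rcases Nat.eq_zero_or_pos m with rfl | hm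
    · simpa using hf
    have hX : (X : PowerSeries B) ^ m ∣ f := X_pow_dvd_iff.mpr fun i hi => by simpa using ih i hi
    obtain ⟨g, rfl⟩ := hX
    have h1 := congrArg (coeff m) h
    rw [expS_eq_powSum, coeff_powSum hf _ (Nat.lt_succ_self m), map_sum, sum_eq_single 1] at h1
    · simpa [coeff_one, hm.ne'] using h1
    · intro n _ hn
      rcases Nat.eq_zero_or_pos n with rfl | hn'
      · simp [coeff_one, hm.ne']
      have : m < m * n := by nlinarith [show 2 ≤ n by omega]
      rw [coeff_complex_smul, (PowerSeries.commute_X_pow g m).symm.mul_pow, ← pow_mul, coeff_X_pow_mul',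
        if_neg (by omega), smul_zero]
    · intro h; simp at h; omega

theorem expS_injective_of_commute {f g : PowerSeries B} (hf : coeff 0 f = 0) (hg : coeff 0 g = 0)
    (h : Commute f g) (he : expS f = expS g) : f = g := by
  refine sub_eq_zero.mp (expS_eq_one (by rw [map_sub, hf, hg, sub_zero]) ?_)
  rw [sub_eq_add_neg, expS_add hf (by rw [map_neg, hg, neg_zero]) h.neg_right, he, expS_mul_neg hg]

/-! ### Mutual inversion of exp and ln -/

theorem powSum_eq_subst {f : PowerSeries ℂ} (hf : coeff 0 f = 0) (c : ℕ → ℂ) :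
    powSum c f = (PowerSeries.mk c).subst f := by
  ext m
  rw [PowerSeries.coeff_subst' (HasSubst.of_constantCoeff_zero' (by simpa using hf)),
    finsum_eq_sum_of_support_subset (s := range (m + 1))]
  · simp [powSum]
  · intro n hn
    by_contra h
    refine hn ?_
    simp only [coe_range, Set.mem_Iio, not_lt] at h
    simp [coeff_pow_of_lt hf (show m < n by omega)]

/-- Substitution of `f` for the variable of a power series with complex coefficients. -/
def evalAt (f : PowerSeries B) (P : PowerSeries ℂ) : PowerSeries B :=
  powSum (fun n => coeff n P) f

theorem coeff_evalAt_congr {f : PowerSeries B} (hf : coeff 0 f = 0) {P Q : PowerSeries ℂ} {m : ℕ}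
    (h : ∀ i ≤ m, coeff i P = coeff i Q) : ∀ i ≤ m, coeff i (evalAt f P) = coeff i (evalAt f Q) := by
  intro i hi
  rw [evalAt, evalAt, coeff_powSum hf _ (Nat.lt_succ_of_le hi),
    coeff_powSum hf _ (Nat.lt_succ_of_le hi)]
  congr 1
  refine sum_congr rfl fun n hn => ?_
  rw [h n (by simp at hn; omega)]

theorem evalAt_coe {f : PowerSeries B} (hf : coeff 0 f = 0) (P : Polynomial ℂ) :
    evalAt f (P : PowerSeries ℂ) = Polynomial.aeval f P := by
  ext m
  rw [evalAt, coeff_powSum hf _ (N := max (m + 1) (P.natDegree + 1)) (by simp),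
    Polynomial.aeval_eq_sum_range' (n := max (m + 1) (P.natDegree + 1)) (by simp)]
  simp

/-- Up to degree m both series may be replaced by their truncations, and for polynomials
multiplicativity is that of `Polynomial.aeval`. -/
theorem evalAt_mul {f : PowerSeries B} (hf : coeff 0 f = 0) (P Q : PowerSeries ℂ) :
    evalAt f (P * Q) = evalAt f P * evalAt f Q := by
  ext m
  have ht : ∀ R : PowerSeries ℂ, ∀ i ≤ m, coeff i R = coeff i ((trunc (m + 1) R : Polynomial ℂ) :
      PowerSeries ℂ) := fun R i hi => by
    rw [Polynomial.coeff_coe, coeff_trunc, if_pos (by omega)]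
  rw [coeff_mul_congr (coeff_evalAt_congr hf (ht P)) (coeff_evalAt_congr hf (ht Q)),
    coeff_evalAt_congr hf (Q := ((trunc (m + 1) P * trunc (m + 1) Q : Polynomial ℂ) :
      PowerSeries ℂ)) _ m le_rfl, evalAt_coe hf, map_mul, evalAt_coe hf, evalAt_coe hf]
  intro i hi
  rw [Polynomial.coe_mul]
  exact coeff_mul_congr (fun j hj => ht P j (by omega)) (fun j hj => ht Q j (by omega))

theorem evalAt_powSum {f : PowerSeries B} (hf : coeff 0 f = 0) (c : ℕ → ℂ) {P : PowerSeries ℂ}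
    (hP : coeff 0 P = 0) : evalAt f (powSum c P) = powSum c (evalAt f P) := by
  have h0 : coeff 0 (evalAt f P) = 0 := by rw [evalAt, coeff_zero_powSum, hP, zero_smul]
  have hpow : ∀ n, evalAt f (P ^ n) = evalAt f P ^ n := fun n => by
    induction n with
    | zero => rw [pow_zero, pow_zero, ← Polynomial.coe_one, evalAt_coe hf, map_one]
    | succ n ih => rw [pow_succ, pow_succ, evalAt_mul hf, ih]
  have hlin : ∀ (s : Finset ℕ), evalAt f (∑ n ∈ s, c n • P ^ n) = ∑ n ∈ s, c n • evalAt f P ^ n := by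
    intro s
    simp only [← hpow]
    ext m
    simp only [evalAt, powSum, coeff_mk, map_sum, coeff_complex_smul, smul_eq_mul, sum_smul,
      smul_sum, smul_smul]
    rw [sum_comm]
  ext m
  rw [coeff_evalAt_congr hf (Q := ∑ n ∈ range (m + 1), c n • P ^ n)
      (fun i hi => coeff_powSum hP c (by omega)) m le_rfl, hlin, coeff_powSum h0 c
      (Nat.lt_succ_self m)]

/-- The series y = exp(ln(1 + X)) solves (1 + X) y' = y with y(0) = 1, which determines its
coefficients. -/
theorem expS_logS_X : expS (logS (X : PowerSeries ℂ)) = 1 + X := by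
  have h0 : coeff 0 (logS (X : PowerSeries ℂ)) = 0 := coeff_zero_logS _
  have hexp : expS (logS (X : PowerSeries ℂ)) = (PowerSeries.exp ℂ).subst (logS X) := by
    rw [expS_eq_powSum, powSum_eq_subst h0]
    congr 1
    ext n
    simp [coeff_exp]
  have hd : (1 + X) * d⁄dX ℂ (expS (logS (X : PowerSeries ℂ))) = expS (logS X) := by
    have hl : (1 + X) * d⁄dX ℂ (logS (X : PowerSeries ℂ)) = 1 := by
      have : logS (X : PowerSeries ℂ) = PowerSeries.mk fun n => (-1 : ℂ) ^ (n + 1) / (n : ℂ) := by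
        rw [logS_eq_powSum]
        ext m
        rw [coeff_powSum (by simp) _ (Nat.lt_succ_self m)]
        simp [coeff_X_pow]
      rw [this]
      ext n
      rw [add_mul, one_mul, map_add]
      cases n with
      | zero => simp [coeff_derivative]
      | succ n =>
        rw [coeff_succ_X_mul, coeff_derivative, coeff_derivative, coeff_mk, coeff_mk, coeff_one]
        have h1 : ((n : ℂ) + 1) ≠ 0 := by exact_mod_cast Nat.succ_ne_zero n
        have h2 : ((n : ℂ) + 1 + 1) ≠ 0 := by exact_mod_cast Nat.succ_ne_zero (n + 1)
        push_cast
        rw [div_mul_cancel₀ _ h1, div_mul_cancel₀ _ h2]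
        simp [pow_succ]
    rw [hexp, derivative_subst (HasSubst.of_constantCoeff_zero' (by simpa using h0)),
      derivative_exp, mul_left_comm, hl, mul_one]
  -- The factor 1 - n vanishes at n = 1, which is what terminates the series after the linear term.
  have hrec : ∀ n : ℕ, coeff (n + 1) (expS (logS (X : PowerSeries ℂ))) * (n + 1) =
      coeff n (expS (logS X)) * (1 - n) := fun n => by
    have h1 := congrArg (coeff n) hd
    rw [add_mul, one_mul, map_add, coeff_derivative] at h1
    cases n with
    | zero => simpa using h1
    | succ n =>
      rw [coeff_succ_X_mul, coeff_derivative] at h1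
      push_cast at h1 ⊢
      linear_combination h1
  ext n
  induction n with
  | zero => simp only [coeff_zero_expS]; simp
  | succ n ih =>
    have h1 := hrec n
    have h2 : ((n : ℂ) + 1) ≠ 0 := by exact_mod_cast Nat.succ_ne_zero n
    rw [ih] at h1
    refine mul_right_cancel₀ h2 (h1.trans ?_)
    rcases n with _ | _ | n
    · simp [coeff_X, coeff_one]
    · simp [coeff_X, coeff_one]
    · simp [coeff_X, coeff_one]

theorem evalAt_X {f : PowerSeries B} (hf : coeff 0 f = 0) : evalAt f X = f := by
  rw [← Polynomial.coe_X, evalAt_coe hf, Polynomial.aeval_X]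

/-- Substitute f for X in the universal identity; only powers of the single element f occur, so
noncommutativity of `B` does no harm. -/
theorem expS_logS {f : PowerSeries B} (hf : coeff 0 f = 0) : expS (logS f) = 1 + f := by
  have h := congrArg (evalAt f) expS_logS_X
  rw [expS_eq_powSum, evalAt_powSum hf _ (coeff_zero_logS _), logS_eq_powSum,
    evalAt_powSum hf _ (by simp), evalAt_X hf, ← logS_eq_powSum, ← expS_eq_powSum] at h
  rw [h, ← Polynomial.coe_X, ← Polynomial.coe_one, ← Polynomial.coe_add, evalAt_coe hf, map_add,
    map_one, Polynomial.aeval_X]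

/-- This is ln((1 + f)(1 + g)) = ln(1 + f) + ln(1 + g): both sides have the same exponential, and
exp is injective on commuting series. -/
theorem logS_add_add_mul {f g : PowerSeries B} (hf : coeff 0 f = 0) (hg : coeff 0 g = 0)
    (h : Commute f g) : logS (f + g + f * g) = logS f + logS g := by
  have hfg : coeff 0 (f + g + f * g) = 0 := by
    simp only [coeff_zero_eq_constantCoeff] at *; simp [hf, hg]
  have hc1 : Commute (f + g + f * g) f :=
    ((Commute.refl f).add_left h.symm).add_left ((Commute.refl f).mul_left h.symm)
  have hc2 : Commute (f + g + f * g) g :=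
    (h.add_left (Commute.refl g)).add_left (h.mul_left (Commute.refl g))
  have hlog : ∀ {u v : PowerSeries B}, coeff 0 u = 0 → coeff 0 v = 0 → Commute u v →
      Commute (logS u) (logS v) := fun hu hv huv =>
    commute_logS hv (commute_logS hu huv.symm).symm
  refine expS_injective_of_commute (coeff_zero_logS _) (by
    rw [map_add, coeff_zero_logS, coeff_zero_logS, add_zero])
    ((hlog hfg hf hc1).add_right (hlog hfg hg hc2)) ?_
  rw [expS_logS hfg, expS_add (coeff_zero_logS _) (coeff_zero_logS _) (hlog hf hg h),
    expS_logS hf, expS_logS hg]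
  noncomm_ring

end Calculus

end Twist

/-! ### Twists of cocommutative bialgebras are triangular -/

namespace Twist

section Triangular

open PowerSeries

variable {A : Type*} [Ring A] [Bialgebra ℂ A]

theorem ext_comp {B C D : Type*} [Ring B] [Algebra ℂ B] [Ring C] [Algebra ℂ C] [Ring D]
    [Algebra ℂ D] (φ : C →ₐ[ℂ] D) (ψ : B →ₐ[ℂ] C) (f : PowerSeries B) :
    ext φ (ext ψ f) = ext (φ.comp ψ) f := by
  ext n
  simp only [coeff_ext]; rfl

theorem ext_id {B : Type*} [Ring B] [Algebra ℂ B] (f : PowerSeries B) :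
    ext (AlgHom.id ℂ B) f = f := by
  ext n
  simp only [coeff_ext]; rfl

/-- `a ⊗ b ⊗ c ↦ a ⊗ c ⊗ b`. -/
def swap23 : A ⊗[ℂ] (A ⊗[ℂ] A) →ₐ[ℂ] A ⊗[ℂ] (A ⊗[ℂ] A) :=
  Algebra.TensorProduct.map (AlgHom.id ℂ A) flip

/-- `a ⊗ b ⊗ c ↦ b ⊗ a ⊗ c`. -/
def swap12 : A ⊗[ℂ] (A ⊗[ℂ] A) →ₐ[ℂ] A ⊗[ℂ] (A ⊗[ℂ] A) :=
  (Algebra.TensorProduct.leftComm ℂ A A A).toAlgHom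

theorem flip_tmul (a b : A) : flip (a ⊗ₜ[ℂ] b) = b ⊗ₜ a := rfl

theorem leg12_tmul (a b : A) : leg12 (a ⊗ₜ[ℂ] b) = a ⊗ₜ (b ⊗ₜ 1) := rfl

theorem leg13_tmul (a b : A) : leg13 (a ⊗ₜ[ℂ] b) = a ⊗ₜ (1 ⊗ₜ b) := rfl

theorem leg23_apply (z : A ⊗[ℂ] A) : leg23 z = 1 ⊗ₜ z := rfl

theorem swap12_tmul (a b c : A) : swap12 (a ⊗ₜ[ℂ] (b ⊗ₜ[ℂ] c)) = b ⊗ₜ (a ⊗ₜ c) := rfl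

theorem swap23_tmul (a : A) (z : A ⊗[ℂ] A) : swap23 (a ⊗ₜ[ℂ] z) = a ⊗ₜ flip z := rfl

theorem comulR_tmul (a b : A) :
    comulR (a ⊗ₜ[ℂ] b) = a ⊗ₜ Bialgebra.comulAlgHom ℂ A b := rfl

theorem comulL_tmul (a b : A) : comulL (a ⊗ₜ[ℂ] b) =
    leg12 (Bialgebra.comulAlgHom ℂ A a) * 1 ⊗ₜ (1 ⊗ₜ b) := by
  change Algebra.TensorProduct.assoc ℂ ℂ ℂ A A A (Bialgebra.comulAlgHom ℂ A a ⊗ₜ b) = _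
  induction Bialgebra.comulAlgHom ℂ A a using TensorProduct.induction_on with
  | zero => simp
  | tmul x y => simp [leg12_tmul]
  | add x y hx hy => rw [TensorProduct.add_tmul, map_add, hx, hy, map_add, add_mul]

theorem flip_comp_flip : (flip : A ⊗[ℂ] A →ₐ[ℂ] _).comp flip = AlgHom.id ℂ _ :=
  Algebra.TensorProduct.ext' fun a b => by simp [flip_tmul]

theorem swap12_comp_leg12 : (swap12 (A := A)).comp leg12 = leg12.comp flip :=
  Algebra.TensorProduct.ext' fun a b => by simp [flip_tmul, leg12_tmul, swap12_tmul]

theorem swap12_comp_leg13 : (swap12 (A := A)).comp leg13 = leg23 :=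
  Algebra.TensorProduct.ext' fun a b => by simp [leg13_tmul, leg23_apply, swap12_tmul]

theorem swap12_comp_leg23 : (swap12 (A := A)).comp leg23 = leg13 :=
  Algebra.TensorProduct.ext' fun a b => by simp [leg13_tmul, leg23_apply, swap12_tmul]

theorem swap23_comp_leg12 : (swap23 (A := A)).comp leg12 = leg13 :=
  Algebra.TensorProduct.ext' fun a b => by simp [flip_tmul, leg12_tmul, leg13_tmul, swap23_tmul]

theorem swap23_comp_leg13 : (swap23 (A := A)).comp leg13 = leg12 :=
  Algebra.TensorProduct.ext' fun a b => by simp [flip_tmul, leg12_tmul, leg13_tmul, swap23_tmul]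

theorem swap23_comp_leg23 : (swap23 (A := A)).comp leg23 = leg23.comp flip :=
  Algebra.TensorProduct.ext' fun a b => by simp [flip_tmul, leg23_apply, swap23_tmul]

theorem swap12_comp_comulL (hA : ∀ a : A, flip (Bialgebra.comulAlgHom ℂ A a) =
    Bialgebra.comulAlgHom ℂ A a) : (swap12 (A := A)).comp comulL = comulL :=
  Algebra.TensorProduct.ext' fun a b => by
    rw [AlgHom.comp_apply, comulL_tmul, map_mul, swap12_tmul, ← AlgHom.comp_apply swap12 leg12,
      swap12_comp_leg12, AlgHom.comp_apply, hA]

theorem swap23_comp_comulR (hA : ∀ a : A, flip (Bialgebra.comulAlgHom ℂ A a) =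
    Bialgebra.comulAlgHom ℂ A a) : (swap23 (A := A)).comp comulR = comulR :=
  Algebra.TensorProduct.ext' fun a b => by
    rw [AlgHom.comp_apply, comulR_tmul, swap23_tmul, hA]

theorem comulL_comp_flip : (comulL (A := A)).comp flip = (swap23.comp swap12).comp comulR :=
  Algebra.TensorProduct.ext' fun a b => by
    rw [AlgHom.comp_apply, AlgHom.comp_apply, AlgHom.comp_apply, comulR_tmul, flip_tmul,
      comulL_tmul]
    induction Bialgebra.comulAlgHom ℂ A b using TensorProduct.induction_on with
    | zero => simp
    | tmul x y => simp [leg12_tmul, swap12_tmul, swap23_tmul, flip_tmul]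
    | add x y hx hy => rw [TensorProduct.tmul_add, map_add, map_add, map_add, ← hx, ← hy, add_mul]

theorem comulR_comp_flip : (comulR (A := A)).comp flip = (swap12.comp swap23).comp comulL :=
  Algebra.TensorProduct.ext' fun a b => by
    rw [AlgHom.comp_apply, AlgHom.comp_apply, AlgHom.comp_apply, comulL_tmul, flip_tmul,
      comulR_tmul]
    induction Bialgebra.comulAlgHom ℂ A a using TensorProduct.induction_on with
    | zero => simp
    | tmul x y => simp [leg12_tmul, swap12_tmul, swap23_tmul, flip_tmul]
    | add x y hx hy =>
      rw [TensorProduct.tmul_add, map_add, add_mul, map_add, map_add, ← hx, ← hy]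

theorem comulL_comp_comul : (comulL (A := A)).comp (Bialgebra.comulAlgHom ℂ A) =
    comulR.comp (Bialgebra.comulAlgHom ℂ A) := by
  ext a
  exact Coalgebra.coassoc_apply a

theorem counitL_comp_comul : (counitL (A := A)).comp (Bialgebra.comulAlgHom ℂ A) =
    AlgHom.id ℂ A := by
  ext a
  change TensorProduct.lid ℂ A (LinearMap.rTensor A Coalgebra.counit (Coalgebra.comul a)) = a
  simp

theorem counitR_comp_comul : (counitR (A := A)).comp (Bialgebra.comulAlgHom ℂ A) =
    AlgHom.id ℂ A := by
  ext a
  change TensorProduct.rid ℂ A (LinearMap.lTensor A Coalgebra.counit (Coalgebra.comul a)) = a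
  simp

variable {F : PowerSeries (A ⊗[ℂ] A)}

theorem ext_mul_ext_inverse {C : Type*} [Ring C] [Algebra ℂ C] (hF : IsUnit F)
    (φ : A ⊗[ℂ] A →ₐ[ℂ] C) : ext φ F * ext φ (Ring.inverse F) = 1 := by
  rw [← map_mul, Ring.mul_inverse_cancel _ hF, map_one]

theorem ext_inverse_mul_ext {C : Type*} [Ring C] [Algebra ℂ C] (hF : IsUnit F)
    (φ : A ⊗[ℂ] A →ₐ[ℂ] C) : ext φ (Ring.inverse F) * ext φ F = 1 := by
  rw [← map_mul, Ring.inverse_mul_cancel _ hF, map_one]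

theorem cancel_left {R : Type*} [Monoid R] {u v : R} (h : u * v = 1) (x : R) : u * (v * x) = x := by
  rw [← mul_assoc, h, one_mul]

namespace IsTwist

theorem cocycle_inverse (hF : IsTwist F) :
    ext comulL (Ring.inverse F) * ext leg12 (Ring.inverse F) =
      ext comulR (Ring.inverse F) * ext leg23 (Ring.inverse F) := by
  have h1 := ext_inverse_mul_ext hF.isUnit leg12
  have h2 := ext_inverse_mul_ext hF.isUnit comulL
  have h3 := ext_mul_ext_inverse hF.isUnit leg23
  have h4 := ext_mul_ext_inverse hF.isUnit comulR
  refine left_inv_eq_right_inv (a := ext leg12 F * ext comulL F) ?_ ?_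
  · rw [mul_assoc, cancel_left h1, h2]
  · rw [hF.cocycle, mul_assoc, cancel_left h4, h3]

/-- Cocommutativity makes (Δ ⊗ id)F invariant under exchange of the first two legs, so permuting the
cocycle equation relates F₂₁ on legs 1, 2 to the same element (Δ ⊗ id)F. -/
theorem swap12_cocycle (hA : ∀ a : A, flip (Bialgebra.comulAlgHom ℂ A a) =
    Bialgebra.comulAlgHom ℂ A a) (hF : IsTwist F) :
    ext leg12 (ext flip F) * ext comulL F = ext leg13 F * ext swap12 (ext comulR F) := by
  have h := congrArg (ext swap12) hF.cocycle
  rwa [map_mul, map_mul, ext_comp, ext_comp, swap12_comp_leg12, swap12_comp_comulL hA,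
    ext_comp swap12 leg23, swap12_comp_leg23, ← ext_comp leg12] at h

theorem swap23_cocycle (hA : ∀ a : A, flip (Bialgebra.comulAlgHom ℂ A a) =
    Bialgebra.comulAlgHom ℂ A a) (hF : IsTwist F) :
    ext leg13 F * ext swap23 (ext comulL F) = ext leg23 (ext flip F) * ext comulR F := by
  have h := congrArg (ext swap23) hF.cocycle
  rwa [map_mul, map_mul, ext_comp, swap23_comp_leg12, ext_comp swap23 leg23, swap23_comp_leg23,
    ext_comp swap23 comulR, swap23_comp_comulR hA, ← ext_comp leg23] at h

/-- Both permuted cocycle equations contain (Δ ⊗ id)F with legs 2 and 3 exchanged; eliminating it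
expresses the unnormalized left side of the first hexagon through F₃₁ F₁₃⁻¹ F₃₂. -/
theorem leg12_mul_comulL_flip (hA : ∀ a : A, flip (Bialgebra.comulAlgHom ℂ A a) =
    Bialgebra.comulAlgHom ℂ A a) (hF : IsTwist F) :
    ext leg12 F * ext comulL (ext flip F) = ext leg13 (ext flip F) *
      (ext leg13 (Ring.inverse F) * (ext leg23 (ext flip F) * ext comulR F)) := by
  have h := congrArg (ext swap23) (hF.swap12_cocycle hA)
  rw [map_mul, map_mul, ext_comp swap23 leg13, swap23_comp_leg13, ext_comp swap23 leg12,
    swap23_comp_leg12, ext_comp swap23 swap12, ext_comp (swap23.comp swap12), ← comulL_comp_flip,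
    ← ext_comp comulL] at h
  rw [← h, ← hF.swap23_cocycle hA, cancel_left (ext_inverse_mul_ext hF.isUnit leg13)]

theorem leg23_mul_comulR_flip (hA : ∀ a : A, flip (Bialgebra.comulAlgHom ℂ A a) =
    Bialgebra.comulAlgHom ℂ A a) (hF : IsTwist F) :
    ext leg23 F * ext comulR (ext flip F) = ext leg13 (ext flip F) *
      (ext leg13 (Ring.inverse F) * (ext leg12 (ext flip F) * ext comulL F)) := by
  have h := congrArg (ext swap12) (hF.swap23_cocycle hA)
  rw [map_mul, map_mul, ext_comp swap12 leg13, swap12_comp_leg13, ext_comp swap12 leg23,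
    swap12_comp_leg23, ext_comp swap12 swap23, ext_comp (swap12.comp swap23), ← comulR_comp_flip,
    ← ext_comp comulR] at h
  rw [h, hF.swap12_cocycle hA, cancel_left (ext_inverse_mul_ext hF.isUnit leg13)]

theorem isUnit_univR (hF : IsTwist F) : IsUnit (univR F) := by
  have := hF.isUnit.map (ext flip)
  exact this.mul ⟨⟨_, _, Ring.inverse_mul_cancel _ hF.isUnit, Ring.mul_inverse_cancel _ hF.isUnit⟩, rfl⟩

theorem isTriangular (hA : ∀ a : A, flip (Bialgebra.comulAlgHom ℂ A a) =
    Bialgebra.comulAlgHom ℂ A a) (hF : IsTwist F) : IsTriangular F (univR F) where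
  coassoc x := by
    rw [comulFL, comulFR, comulF]
    simp only [map_mul]
    rw [ext_comp comulL, ext_comp comulR, comulL_comp_comul]
    simp only [mul_assoc]
    rw [hF.cocycle_inverse, ← mul_assoc, hF.cocycle, mul_assoc]
  counit_left x := by
    have h := ext_mul_ext_inverse hF.isUnit counitL
    rw [hF.counit_left, one_mul] at h
    rw [comulF, map_mul, map_mul, h, hF.counit_left, ext_comp, counitL_comp_comul, ext_id, one_mul,
      mul_one]
  counit_right x := by
    have h := ext_mul_ext_inverse hF.isUnit counitR
    rw [hF.counit_right, one_mul] at h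
    rw [comulF, map_mul, map_mul, h, hF.counit_right, ext_comp, counitR_comp_comul, ext_id, one_mul,
      mul_one]
  isUnit := hF.isUnit_univR
  intertwines x := by
    have hx : ext flip (ext (Bialgebra.comulAlgHom ℂ A) x) = ext (Bialgebra.comulAlgHom ℂ A) x := by
      ext n
      rw [coeff_ext, coeff_ext, hA]
    rw [comulF, univR, map_mul, map_mul, hx]
    simp only [mul_assoc]
    rw [cancel_left (Ring.inverse_mul_cancel _ hF.isUnit),
      cancel_left (ext_inverse_mul_ext hF.isUnit flip)]
  hexagon_left := by
    rw [comulFL, univR]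
    simp only [map_mul]
    rw [← mul_assoc, hF.leg12_mul_comulL_flip hA]
    simp only [mul_assoc]
    rw [hF.cocycle_inverse, cancel_left (ext_mul_ext_inverse hF.isUnit comulR)]
  hexagon_right := by
    rw [comulFR, univR]
    simp only [map_mul]
    rw [← mul_assoc, hF.leg23_mul_comulR_flip hA]
    simp only [mul_assoc]
    rw [← hF.cocycle_inverse, cancel_left (ext_mul_ext_inverse hF.isUnit comulL)]
  unitary := by
    rw [univR, map_mul, ext_comp, flip_comp_flip, ext_id, mul_assoc,
      cancel_left (ext_inverse_mul_ext hF.isUnit flip), Ring.mul_inverse_cancel _ hF.isUnit]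

/-- R₁₂ carries (Δ_F ⊗ id)R to its image under exchange of the first two legs. By the hexagon these
two elements are R₁₃ R₂₃ and R₂₃ R₁₃. -/
theorem yangBaxter (hA : ∀ a : A, flip (Bialgebra.comulAlgHom ℂ A a) =
    Bialgebra.comulAlgHom ℂ A a) (hF : IsTwist F) :
    ext leg12 (univR F) * ext leg13 (univR F) * ext leg23 (univR F) =
      ext leg23 (univR F) * ext leg13 (univR F) * ext leg12 (univR F) := by
  have h := (hF.isTriangular hA).hexagon_left
  have h' := congrArg (ext swap12) h
  rw [comulFL, map_mul, map_mul, map_mul, ext_comp swap12 leg12, ext_comp swap12 leg12,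
    ext_comp swap12 comulL, ext_comp swap12 leg13, ext_comp swap12 leg23, swap12_comp_leg12,
    swap12_comp_comulL hA, swap12_comp_leg13, swap12_comp_leg23] at h'
  rw [mul_assoc, ← h, ← h', comulFL, ← ext_comp leg12, ← ext_comp leg12]
  have h1 : ext leg12 (univR F) = ext leg12 (ext flip F) * ext leg12 (Ring.inverse F) := by
    rw [univR, map_mul]
  have h2 : ext leg12 (ext flip (Ring.inverse F)) * ext leg12 (ext flip F) = 1 := by
    rw [← map_mul, ext_inverse_mul_ext hF.isUnit, map_one]
  simp only [h1, mul_assoc]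
  rw [cancel_left h2, cancel_left (ext_inverse_mul_ext hF.isUnit leg12)]

end IsTwist

/-! ### Low-order coefficients and the semiclassical limit -/

theorem coeff_one_mul_of_coeff_zero {B : Type*} [Ring B] {f g : PowerSeries B}
    (hf : coeff 0 f = 1) (hg : coeff 0 g = 1) : coeff 1 (f * g) = coeff 1 f + coeff 1 g := by
  rw [coeff_mul, Finset.Nat.antidiagonal_succ]
  simp only [coeff_zero_eq_constantCoeff] at hf hg
  simp [hf, hg, add_comm]

theorem coeff_two_mul_of_coeff_zero {B : Type*} [Ring B] {f g : PowerSeries B}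
    (hf : coeff 0 f = 1) (hg : coeff 0 g = 1) :
    coeff 2 (f * g) = coeff 2 f + coeff 1 f * coeff 1 g + coeff 2 g := by
  simp only [coeff_zero_eq_constantCoeff] at hf hg
  simp [coeff_mul, Finset.Nat.antidiagonal_succ, hf, hg]
  abel

theorem coeff_zero_mul {B : Type*} [Ring B] (f g : PowerSeries B) :
    coeff 0 (f * g) = coeff 0 f * coeff 0 g := by
  simp

theorem coeff_zero_inverse (hF : IsUnit F) (h0 : coeff 0 F = 1) : coeff 0 (Ring.inverse F) = 1 := by
  have h := congrArg (coeff 0) (Ring.mul_inverse_cancel _ hF)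
  rw [coeff_zero_mul, h0, one_mul] at h
  simpa using h

theorem coeff_one_inverse (hF : IsUnit F) (h0 : coeff 0 F = 1) :
    coeff 1 (Ring.inverse F) = -coeff 1 F := by
  have h := congrArg (coeff 1) (Ring.mul_inverse_cancel _ hF)
  rw [coeff_one_mul_of_coeff_zero h0 (coeff_zero_inverse hF h0)] at h
  rw [eq_neg_iff_add_eq_zero, add_comm, h]
  simp [coeff_one]

theorem coeff_zero_univR (hF : IsUnit F) (h0 : coeff 0 F = 1) : coeff 0 (univR F) = 1 := by
  rw [univR, coeff_zero_mul, coeff_ext, h0, coeff_zero_inverse hF h0, map_one, one_mul]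

theorem coeff_one_univR (hF : IsUnit F) (h0 : coeff 0 F = 1) :
    coeff 1 (univR F) = flip (coeff 1 F) - coeff 1 F := by
  rw [univR, coeff_one_mul_of_coeff_zero (by rw [coeff_ext, h0, map_one])
    (coeff_zero_inverse hF h0), coeff_ext, coeff_one_inverse hF h0, sub_eq_add_neg]

/-- Here -x, -y, -z play the first-order and x', y', z' the second-order coefficients of R₁₂, R₁₃,
R₂₃. The latter occur once on each side and cancel, leaving only commutators. -/
theorem commutator_sum_eq_zero {B : Type*} [Ring B] {x y z x' y' z' : B}
    (h : x' + -x * -y + y' + (-x + -y) * -z + z' = z' + -z * -y + y' + (-z + -y) * -x + x') :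
    Classical2.commutator x y + Classical2.commutator x z + Classical2.commutator y z = 0 := by
  simp only [Classical2.commutator]
  rw [← sub_eq_zero] at h
  rw [← h]
  noncomm_ring

-- Since R = 1 - h r + O(h²), the quantum Yang–Baxter equation is trivial up to order h, and its h²
-- coefficient is the classical equation for r.
open Classical2 in
theorem IsTwist.classicalYangBaxter (hA : ∀ a : A, flip (Bialgebra.comulAlgHom ℂ A a) =
    Bialgebra.comulAlgHom ℂ A a) (hF : IsTwist F) (h0 : coeff 0 F = 1) {r : A ⊗[ℂ] A}
    (hr : coeff 1 (univR F) = -r) :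
    commutator (leg12 r) (leg13 r) + commutator (leg12 r) (leg23 r) +
      commutator (leg13 r) (leg23 r) = 0 := by
  have h0R := coeff_zero_univR hF.isUnit h0
  have h0' : ∀ φ : A ⊗[ℂ] A →ₐ[ℂ] A ⊗[ℂ] (A ⊗[ℂ] A), coeff 0 (ext φ (univR F)) = 1 := fun φ => by
    rw [coeff_ext, h0R, map_one]
  have h0'' : ∀ φ ψ : A ⊗[ℂ] A →ₐ[ℂ] A ⊗[ℂ] (A ⊗[ℂ] A),
      coeff 0 (ext φ (univR F) * ext ψ (univR F)) = 1 := fun φ ψ => by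
    rw [coeff_zero_mul, h0', h0', one_mul]
  have h := congrArg (coeff 2) (hF.yangBaxter hA)
  rw [coeff_two_mul_of_coeff_zero (h0'' _ _) (h0' _), coeff_two_mul_of_coeff_zero (h0' _) (h0' _),
    coeff_one_mul_of_coeff_zero (h0' _) (h0' _), coeff_two_mul_of_coeff_zero (h0'' _ _) (h0' _),
    coeff_two_mul_of_coeff_zero (h0' _) (h0' _), coeff_one_mul_of_coeff_zero (h0' _) (h0' _)] at h
  simp only [coeff_ext, hr, map_neg] at h
  exact commutator_sum_eq_zero h

end Triangular

end Twist

namespace Classical2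

open Twist PowerSeries

variable {L : Type*} [LieRing L] [LieAlgebra ℂ L]

theorem comul_cocomm (a : UniversalEnvelopingAlgebra ℂ L) :
    Twist.flip (Bialgebra.comulAlgHom ℂ (UniversalEnvelopingAlgebra ℂ L) a) =
      Bialgebra.comulAlgHom ℂ (UniversalEnvelopingAlgebra ℂ L) a := by
  have : (Twist.flip).comp (UEA.comul L) = UEA.comul L := by
    refine UniversalEnvelopingAlgebra.hom_ext ℂ (LieHom.ext fun x => ?_)
    change Twist.flip (UEA.comul L (UniversalEnvelopingAlgebra.ι ℂ x)) =
      UEA.comul L (UniversalEnvelopingAlgebra.ι ℂ x)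
    rw [UEA.comul_ι, map_add, flip_tmul, flip_tmul, add_comm]
  exact AlgHom.congr_fun this a

theorem quantizes_of_coeff_one
    {F : PowerSeries (UniversalEnvelopingAlgebra ℂ L ⊗[ℂ] UniversalEnvelopingAlgebra ℂ L)}
    {r : L ⊗[ℂ] L} (hF : IsUnit F) (h0 : coeff 0 F = 1)
    (h1 : toU r = coeff 1 F - Twist.flip (coeff 1 F)) : Quantizes F r where
  coeff_zero := h0
  coeff_zero_R := coeff_zero_univR hF h0
  coeff_one_R := by rw [coeff_one_univR hF h0, h1, neg_sub]
  cobracket x := by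
    set D := Bialgebra.comulAlgHom ℂ (UniversalEnvelopingAlgebra ℂ L) x with hD
    have hC : ext (Bialgebra.comulAlgHom ℂ (UniversalEnvelopingAlgebra ℂ L)) (C x) = C D := by
      ext n
      rw [coeff_ext, coeff_C, coeff_C]
      split_ifs
      · rfl
      · rw [map_zero]
    -- With Δ(x) constant in h, only F₁ on the left and the first-order coefficient -F₁ of F⁻¹ on
    -- the right contribute.
    have hc : coeff 1 (comulF F (C x)) = commutator (coeff 1 F) D := by
      rw [comulF, hC, coeff_mul, Finset.Nat.antidiagonal_succ]
      simp [-coeff_zero_eq_constantCoeff, coeff_one_inverse hF h0, coeff_zero_inverse hF h0, commutator,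
        h0, -map_mul, sub_eq_add_neg, add_comm]
    rw [map_sub, coeff_ext, hc, h1]
    simp only [commutator, map_sub, map_mul]
    rw [hD, comul_cocomm]
    noncomm_ring

end Classical2

/-! ### Composition of twists -/

namespace Twist

open PowerSeries

section Exponential

variable {B : Type*} [Ring B] [Algebra ℂ B]

/-- The Leibniz expansion of c^n b in iterated commutators, when (ad c)³ b = 0. The exponent is
shifted by 2 so that no truncated subtraction occurs. -/
theorem pow_mul_of_commutators {R : Type*} [Ring R] [Algebra ℂ R] {c b u w : R}
    (hb : c * b = b * c + u) (hu : c * u = u * c + w) (hw : c * w = w * c) (n : ℕ) :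
    c ^ (n + 2) * b = b * c ^ (n + 2) + ((n : ℂ) + 2) • (u * c ^ (n + 1)) +
      (((n : ℂ) + 2) * (n + 1) / 2) • (w * c ^ n) := by
  induction n with
  | zero =>
    rw [pow_succ', pow_one, mul_assoc, hb, mul_add, hu, ← mul_assoc, hb]
    simp only [Nat.cast_zero, zero_add, pow_zero, mul_one, add_mul, two_smul, mul_assoc]
    norm_num
    abel
  | succ n ih =>
    rw [pow_succ' c (n + 2), mul_assoc, ih, mul_add, mul_add, mul_smul_comm, mul_smul_comm,
      ← mul_assoc c b, ← mul_assoc c u, ← mul_assoc c w, hb, hu, hw, add_mul, add_mul,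
      mul_assoc b, mul_assoc u c, mul_assoc w c, ← pow_succ', ← pow_succ', ← pow_succ']
    push_cast
    rw [show n + 1 + 2 = n + 2 + 1 by ring, show n + 1 + 1 = n + 2 by ring]
    module

/-- Ad(exp c) = exp(ad c), applied to an element killed by (ad c)³. The quadratic term is needed for
E_{1-2}, which the extension exponent hits twice. -/
theorem expS_mul_of_commutators {c b u w : PowerSeries B} (hc : coeff 0 c = 0)
    (hb : c * b = b * c + u) (hu : c * u = u * c + w) (hw : c * w = w * c) :
    expS c * b = (b + u + (1 / 2 : ℂ) • w) * expS c := by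
  ext m
  have h : ∀ N, m < N → ∀ i ≤ m, coeff i (expS c) =
      coeff i (∑ n ∈ Finset.range N, ((n.factorial : ℂ)⁻¹) • c ^ n) := fun N hN i hi =>
    coeff_powSum hc _ (by omega)
  -- The truncations m + 3, m + 2, m + 1 are staggered so that, after the lowest terms are split
  -- off, all sums run over the same range with c^(n+2), u c^(n+1) and w c^n.
  rw [add_mul, add_mul, map_add, map_add,
    coeff_mul_congr (b' := b) (h (m + 3) (by omega)) (fun _ _ => rfl),
    coeff_mul_congr (a := b) (a' := b) (fun _ _ => rfl) (h (m + 3) (by omega)),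
    coeff_mul_congr (a := u) (a' := u) (fun _ _ => rfl) (h (m + 2) (by omega)),
    coeff_mul_congr (a := (1 / 2 : ℂ) • w) (a' := (1 / 2 : ℂ) • w) (fun _ _ => rfl)
      (h (m + 1) (by omega)), ← map_add, ← map_add]
  congr 1
  rw [Finset.sum_range_succ', Finset.sum_range_succ', Finset.sum_range_succ' _ (m + 1), add_mul,
    add_mul, Finset.sum_mul]
  simp only [smul_mul_assoc, add_assoc, zero_add]
  simp only [show ∀ n : ℕ, n + (1 + 1) = n + 2 from fun n => rfl,
    pow_mul_of_commutators hb hu hw, smul_add, Finset.sum_add_distrib, mul_add, Finset.mul_sum,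
    mul_smul_comm, smul_smul, pow_zero, pow_one, mul_one, one_mul, hb, Nat.factorial_zero,
    Nat.factorial_one, Nat.cast_one, inv_one, one_smul]
  have h1 : ∀ n : ℕ, (((n + 2).factorial : ℂ)⁻¹) * ((n : ℂ) + 2) = ((n + 1).factorial : ℂ)⁻¹ := by
    intro n
    have h2 : ((n : ℂ) + 1 + 1) ≠ 0 := by exact_mod_cast Nat.succ_ne_zero (n + 1)
    have h3 : ((n + 1).factorial : ℂ) ≠ 0 := by exact_mod_cast Nat.factorial_ne_zero _
    rw [Nat.factorial_succ (n + 1)]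
    push_cast
    rw [show (n : ℂ) + 2 = n + 1 + 1 by ring]
    field_simp
  have h2 : ∀ n : ℕ, (((n + 2).factorial : ℂ)⁻¹) * (((n : ℂ) + 2) * (n + 1) / 2) =
      1 / 2 * (n.factorial : ℂ)⁻¹ := by
    intro n
    have h2 : ((n : ℂ) + 1) ≠ 0 := by exact_mod_cast Nat.succ_ne_zero n
    have h3 : (n.factorial : ℂ) ≠ 0 := by exact_mod_cast Nat.factorial_ne_zero _
    rw [mul_div_assoc, ← mul_assoc, h1, Nat.factorial_succ n]
    push_cast
    field_simp
  simp only [mul_add, mul_one] at h1 h2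
  simp only [h1, h2, Finset.smul_sum, smul_smul]
  abel

theorem expS_mul_of_commutator {c b z : PowerSeries B} (hc : coeff 0 c = 0)
    (hb : c * b = b * c + z) (hz : c * z = z * c) : expS c * b = (b + z) * expS c := by
  simpa using expS_mul_of_commutators (w := 0) hc hb (by simpa using hz) (by simp)

/-- The scalar `h c`. -/
def hScalar (B : Type*) [Ring B] [Algebra ℂ B] (c : ℂ) : PowerSeries B :=
  monomial 1 (algebraMap ℂ B c)

theorem ext_hScalar {C : Type*} [Ring C] [Algebra ℂ C] (φ : B →ₐ[ℂ] C) (c : ℂ) :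
    ext φ (hScalar B c) = hScalar C c := by
  ext n
  rw [coeff_ext, hScalar, hScalar, coeff_monomial, coeff_monomial]
  split_ifs
  · exact φ.commutes c
  · exact map_zero φ

theorem commute_hScalar (c : ℂ) (f : PowerSeries B) : Commute (hScalar B c) f := by
  have : hScalar B c = C (algebraMap ℂ B c) * X := by
    ext n
    rw [hScalar, coeff_monomial, coeff_C_mul, coeff_X]
    split_ifs <;> simp
  rw [this]
  refine Commute.mul_left ?_ (PowerSeries.commute_X f).symm
  ext n
  rw [coeff_C_mul, coeff_mul_C]
  exact Algebra.commutes c _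

theorem coeff_zero_hScalar_mul (c : ℂ) (f : PowerSeries B) : coeff 0 (hScalar B c * f) = 0 := by
  rw [coeff_zero_mul, hScalar, coeff_monomial, if_neg (by norm_num), zero_mul]

theorem coeff_one_hScalar_mul (c : ℂ) (f : PowerSeries B) :
    coeff 1 (hScalar B c * f) = c • coeff 0 f := by
  simp [coeff_mul, Finset.Nat.antidiagonal_succ, hScalar, coeff_monomial, Algebra.smul_def]

theorem ext_smul {C : Type*} [Ring C] [Algebra ℂ C] (φ : B →ₐ[ℂ] C) (c : ℂ) (f : PowerSeries B) :
    ext φ (c • f) = c • ext φ f := by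
  ext n
  rw [coeff_ext, coeff_complex_smul, coeff_complex_smul, coeff_ext, map_smul]

theorem commute_ext {C D : Type*} [Ring C] [Algebra ℂ C] [Ring D] [Algebra ℂ D]
    {φ : B →ₐ[ℂ] D} {ψ : C →ₐ[ℂ] D} (h : ∀ x y, Commute (φ x) (ψ y)) (f : PowerSeries B)
    (g : PowerSeries C) : Commute (ext φ f) (ext ψ g) := by
  ext n
  rw [coeff_mul, coeff_mul, ← Finset.Nat.sum_antidiagonal_swap]
  refine Finset.sum_congr rfl fun p _ => ?_
  rw [coeff_ext, coeff_ext]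
  exact h _ _

theorem tens_mul_tens (a b c d : PowerSeries B) : tens a b * tens c d = tens (a * c) (b * d) := by
  have h : Commute (ext (Algebra.TensorProduct.includeLeft : B →ₐ[ℂ] B ⊗[ℂ] B) c)
      (ext (Algebra.TensorProduct.includeRight : B →ₐ[ℂ] B ⊗[ℂ] B) b) :=
    commute_ext (fun x y => by simp [Commute, SemiconjBy]) _ _
  rw [tens, tens, tens, map_mul, map_mul, mul_assoc, mul_assoc, ← mul_assoc _ _ (ext _ d), ← h.eq,
    mul_assoc]

theorem tens_one_one : tens (1 : PowerSeries B) 1 = 1 := by simp [tens]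

theorem tens_add_left (a b c : PowerSeries B) : tens (a + b) c = tens a c + tens b c := by
  simp [tens, add_mul]

theorem tens_add_right (a b c : PowerSeries B) : tens a (b + c) = tens a b + tens a c := by
  simp [tens, mul_add]

theorem tens_zero_left (a : PowerSeries B) : tens 0 a = 0 := by simp [tens]

theorem tens_zero_right (a : PowerSeries B) : tens a 0 = 0 := by simp [tens]

theorem tens_neg_left (a b : PowerSeries B) : tens (-a) b = -tens a b := by
  simp [tens]

theorem tens_neg_right (a b : PowerSeries B) : tens a (-b) = -tens a b := by
  simp [tens]

theorem tens_smul_left (c : ℂ) (a b : PowerSeries B) : tens (c • a) b = c • tens a b := by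
  rw [tens, tens, ext_smul, smul_mul_assoc]

theorem tens_smul_right (c : ℂ) (a b : PowerSeries B) : tens a (c • b) = c • tens a b := by
  rw [tens, tens, ext_smul, mul_smul_comm]

theorem tens_hScalar_left (c : ℂ) (a b : PowerSeries B) :
    tens (hScalar B c * a) b = hScalar (B ⊗[ℂ] B) c * tens a b := by
  rw [tens, tens, map_mul, ext_hScalar, mul_assoc]

theorem tens_hScalar_right (c : ℂ) (a b : PowerSeries B) :
    tens a (hScalar B c * b) = hScalar (B ⊗[ℂ] B) c * tens a b := by
  rw [tens, tens, map_mul, ext_hScalar, ← mul_assoc, ← (commute_hScalar c _).eq, mul_assoc]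

theorem tens_sum_left {ι : Type*} (s : Finset ι) (a : ι → PowerSeries B) (b : PowerSeries B) :
    tens (∑ i ∈ s, a i) b = ∑ i ∈ s, tens (a i) b := by
  simp only [tens, map_sum, Finset.sum_mul]

theorem tens_sum_right {ι : Type*} (s : Finset ι) (b : ι → PowerSeries B) (a : PowerSeries B) :
    tens a (∑ i ∈ s, b i) = ∑ i ∈ s, tens a (b i) := by
  simp only [tens, map_sum, Finset.mul_sum]

theorem coeff_zero_tens (a b : PowerSeries B) : coeff 0 (tens a b) = coeff 0 a ⊗ₜ coeff 0 b := by
  rw [tens, coeff_zero_mul, coeff_ext, coeff_ext]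
  simp

theorem coeff_zero_tens_of_right {a b : PowerSeries B} (hb : coeff 0 b = 0) :
    coeff 0 (tens a b) = 0 := by
  rw [coeff_zero_tens, hb, TensorProduct.tmul_zero]

theorem expS_tens_one_left {s : PowerSeries B} : expS (tens 1 s) = tens 1 (expS s) := by
  rw [tens, tens, map_one, one_mul, one_mul, ext_expS]

theorem expS_tens_one_right {s : PowerSeries B} : expS (tens s 1) = tens (expS s) 1 := by
  rw [tens, tens, map_one, mul_one, mul_one, ext_expS]

theorem commute_tens {a b c d : PowerSeries B} (h : Commute a c) (h' : Commute b d) :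
    Commute (tens a b) (tens c d) := by
  rw [Commute, SemiconjBy, tens_mul_tens, tens_mul_tens, h.eq, h'.eq]

/-- `exp (H ⊗ s) (z ⊗ 1) = (z ⊗ e^{c s}) exp (H ⊗ s)` if `[H, z] = c z`. -/
theorem expS_tens_mul_of_eigen {H z s : PowerSeries B} {c : ℂ} (hs : coeff 0 s = 0)
    (h : H * z = z * H + c • z) :
    expS (tens H s) * tens z 1 = tens z (expS (c • s)) * expS (tens H s) := by
  have h0 : coeff 0 (tens H s) = 0 := coeff_zero_tens_of_right hs
  have h1 : coeff 0 (tens 1 (c • s)) = 0 :=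
    coeff_zero_tens_of_right (by rw [coeff_complex_smul, hs, smul_zero])
  have hc : Commute (tens 1 (c • s)) (tens H s) :=
    commute_tens (Commute.one_left _) ((Commute.refl s).smul_left c)
  -- The eigenvalue relation reads (H ⊗ s)(z ⊗ 1) = (z ⊗ 1)(1 ⊗ cs + H ⊗ s), and the exponential of
  -- the last sum splits because its terms commute.
  rw [expS_intertwine (g := tens 1 (c • s) + tens H s) h0 (by rw [map_add, h0, h1, add_zero]),
    expS_add h1 h0 hc, expS_tens_one_left, ← mul_assoc, tens_mul_tens, mul_one, one_mul]
  rw [mul_add, tens_mul_tens, tens_mul_tens, tens_mul_tens, h, tens_add_left, tens_smul_left,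
    mul_one, one_mul, one_mul, mul_one, tens_smul_right, add_comm]

end Exponential

section Composition

variable {A : Type*} [Ring A] [Bialgebra ℂ A]

/-- `P` and `Q` stand for (Δ_F ⊗ id)F' and (id ⊗ Δ_F)F', recorded as intertwining relations to avoid
inverses. The hypothesis `h` is then the twist equation of `F'` for the coproduct deformed by `F`.
-/
theorem IsTwist.mul {F F' P Q : PowerSeries _} (hF : IsTwist (A := A) F) (hu : IsUnit F')
    (hL : ext leg12 F * ext comulL F' = P * ext leg12 F)
    (hR : ext leg23 F * ext comulR F' = Q * ext leg23 F)
    (h : ext leg12 F' * P = ext leg23 F' * Q) (hl : ext counitL F' = 1) (hr : ext counitR F' = 1) :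
    IsTwist (F' * F) where
  isUnit := hu.mul hF.isUnit
  counit_left := by rw [map_mul, hl, hF.counit_left, one_mul]
  counit_right := by rw [map_mul, hr, hF.counit_right, one_mul]
  cocycle := by
    simp only [map_mul]
    rw [mul_assoc, ← mul_assoc (ext leg12 F), hL, mul_assoc P, hF.cocycle, ← mul_assoc, h, mul_assoc,
      ← mul_assoc Q, ← hR, mul_assoc, mul_assoc]

theorem isTwist_one : IsTwist (1 : PowerSeries (A ⊗[ℂ] A)) where
  isUnit := isUnit_one
  cocycle := by simp only [map_one]
  counit_left := map_one _
  counit_right := map_one _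

/-- `a ⊗ b ⊗ c`. -/
def tens3 (a b c : PowerSeries A) : PowerSeries (A ⊗[ℂ] (A ⊗[ℂ] A)) :=
  ext (Algebra.TensorProduct.includeLeft : A →ₐ[ℂ] A ⊗[ℂ] (A ⊗[ℂ] A)) a * ext leg23 (tens b c)

theorem commute_left_leg23 (a : PowerSeries A) (z : PowerSeries (A ⊗[ℂ] A)) :
    Commute (ext (Algebra.TensorProduct.includeLeft : A →ₐ[ℂ] A ⊗[ℂ] (A ⊗[ℂ] A)) a)
      (ext leg23 z) :=
  commute_ext (fun x y => by simp [Commute, SemiconjBy, leg23_apply]) _ _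

theorem tens3_mul_tens3 (a b c a' b' c' : PowerSeries A) :
    tens3 a b c * tens3 a' b' c' = tens3 (a * a') (b * b') (c * c') := by
  rw [tens3, tens3, tens3, map_mul, ← tens_mul_tens, map_mul, mul_assoc, mul_assoc,
    ← mul_assoc _ _ (ext leg23 (tens b' c')), ← (commute_left_leg23 _ _).eq, mul_assoc]

theorem leg23_tens (a b : PowerSeries A) : ext leg23 (tens a b) = tens3 1 a b := by
  rw [tens3, map_one, one_mul]

theorem leg12_tens (a b : PowerSeries A) : ext leg12 (tens a b) = tens3 a b 1 := by
  rw [tens3, tens, tens, map_mul, ext_comp, ext_comp, map_one, mul_one, ext_comp]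
  congr 2

theorem comulR_tens (a b : PowerSeries A) : ext comulR (tens a b) =
    tens3 a 1 1 * ext leg23 (ext (Bialgebra.comulAlgHom ℂ A) b) := by
  rw [tens3, tens_one_one, map_one, mul_one, tens, map_mul, ext_comp, ext_comp, ext_comp]
  congr 2
  · congr 1
    ext a
    simp [comulR]

theorem comulL_tens (a b : PowerSeries A) : ext comulL (tens a b) =
    ext leg12 (ext (Bialgebra.comulAlgHom ℂ A) a) * tens3 1 1 b := by
  rw [tens3, tens, tens, map_mul, map_one, map_one, one_mul, one_mul, ext_comp, ext_comp, ext_comp,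
    ext_comp]
  congr 2
  · congr 1
    ext a
    simp [comulL_tmul, ← Algebra.TensorProduct.one_def]
  · congr 1
    ext a
    simp [comulL_tmul, leg23_apply, Algebra.TensorProduct.one_def, leg12_tmul]

theorem commute_tens3_leg12 (z : PowerSeries (A ⊗[ℂ] A)) (c : PowerSeries A) :
    Commute (ext leg12 z) (tens3 1 1 c) := by
  rw [tens3, map_one, one_mul, tens, map_one, one_mul, ext_comp]
  refine commute_ext (fun x y => ?_) _ _
  induction x using TensorProduct.induction_on with
  | zero => simp
  | tmul x x' => simp [Commute, SemiconjBy, leg12_tmul, leg23_apply]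
  | add x x' h h' => rw [map_add]; exact h.add_left h'

theorem commute_tens3_leg23 (z : PowerSeries (A ⊗[ℂ] A)) (a : PowerSeries A) :
    Commute (tens3 a 1 1) (ext leg23 z) := by
  rw [tens3, tens_one_one, map_one, mul_one]
  exact commute_left_leg23 a z

theorem commute_tens3 {a b c a' b' c' : PowerSeries A} (ha : Commute a a') (hb : Commute b b')
    (hc : Commute c c') : Commute (tens3 a b c) (tens3 a' b' c') := by
  rw [Commute, SemiconjBy, tens3_mul_tens3, tens3_mul_tens3, ha.eq, hb.eq, hc.eq]

theorem tens3_add_middle (a b b' c : PowerSeries A) :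
    tens3 a (b + b') c = tens3 a b c + tens3 a b' c := by
  rw [tens3, tens3, tens3, tens_add_left, map_add, mul_add]

theorem tens3_zero_middle (a c : PowerSeries A) : tens3 a 0 c = 0 := by
  rw [tens3, tens_zero_left, map_zero, mul_zero]

theorem tens3_sub_middle (a b b' c : PowerSeries A) :
    tens3 a (b - b') c = tens3 a b c - tens3 a b' c := by
  rw [eq_sub_iff_add_eq, ← tens3_add_middle, sub_add_cancel]

theorem coeff_zero_tens3 (a b c : PowerSeries A) :
    coeff 0 (tens3 a b c) = coeff 0 a ⊗ₜ (coeff 0 b ⊗ₜ coeff 0 c) := by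
  rw [tens3, coeff_zero_mul, coeff_ext, coeff_ext, coeff_zero_tens]
  simp [leg23_apply]

theorem counitL_tens (a b : PowerSeries A) : ext counitL (tens a b) =
    ext ((Algebra.ofId ℂ A).comp (Bialgebra.counitAlgHom ℂ A)) a * b := by
  rw [tens, map_mul, ext_comp, ext_comp]
  have h1 : counitL.comp (Algebra.TensorProduct.includeLeft : A →ₐ[ℂ] A ⊗[ℂ] A) =
      (Algebra.ofId ℂ A).comp (Bialgebra.counitAlgHom ℂ A) := by
    ext a
    simp [counitL, Algebra.ofId_apply, Algebra.algebraMap_eq_smul_one]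
  have h2 : counitL.comp (Algebra.TensorProduct.includeRight : A →ₐ[ℂ] A ⊗[ℂ] A) =
      AlgHom.id ℂ A := by
    ext a
    simp [counitL]
  rw [h1, h2, ext_id]

theorem counitR_tens (a b : PowerSeries A) : ext counitR (tens a b) =
    a * ext ((Algebra.ofId ℂ A).comp (Bialgebra.counitAlgHom ℂ A)) b := by
  rw [tens, map_mul, ext_comp, ext_comp]
  have h1 : counitR.comp (Algebra.TensorProduct.includeRight : A →ₐ[ℂ] A ⊗[ℂ] A) =
      (Algebra.ofId ℂ A).comp (Bialgebra.counitAlgHom ℂ A) := by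
    ext a
    simp [counitR, Algebra.ofId_apply, Algebra.algebraMap_eq_smul_one]
  have h2 : counitR.comp (Algebra.TensorProduct.includeLeft : A →ₐ[ℂ] A ⊗[ℂ] A) =
      AlgHom.id ℂ A := by
    ext a
    simp [counitR]
  rw [h1, h2, ext_id]

end Composition

end Twist

/-! ### Jordanian and extended twists -/

namespace Twist

open PowerSeries

section Jordanian

variable {A : Type*} [Ring A] [Bialgebra ℂ A]

/-- The coproduct of `A[[h]]`. -/
abbrev comulS (x : PowerSeries A) : PowerSeries (A ⊗[ℂ] A) := ext (Bialgebra.comulAlgHom ℂ A) x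

/-- The counit of `A[[h]]`, with values in the scalars of `A[[h]]`. -/
abbrev counitS (x : PowerSeries A) : PowerSeries A :=
  ext ((Algebra.ofId ℂ A).comp (Bialgebra.counitAlgHom ℂ A)) x

/-- The hypothesis encodes Δ_F(x) = D. Deformed coproducts are kept in this form from here on. -/
theorem IsTwist.leg12_mul_comulL_tens {F : PowerSeries (A ⊗[ℂ] A)} {x v : PowerSeries A}
    {D : PowerSeries (A ⊗[ℂ] A)} (h : F * comulS x = D * F) :
    ext leg12 F * ext comulL (tens x v) = ext leg12 D * tens3 1 1 v * ext leg12 F := by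
  rw [comulL_tens, ← mul_assoc, ← map_mul, h, map_mul, mul_assoc, mul_assoc,
    (commute_tens3_leg12 F v).eq]

theorem IsTwist.leg23_mul_comulR_tens {F : PowerSeries (A ⊗[ℂ] A)} {x v : PowerSeries A}
    {D : PowerSeries (A ⊗[ℂ] A)} (h : F * comulS v = D * F) :
    ext leg23 F * ext comulR (tens x v) = tens3 x 1 1 * ext leg23 D * ext leg23 F := by
  rw [comulR_tens, ← mul_assoc, ← (commute_tens3_leg23 F x).eq, mul_assoc, ← map_mul, h, map_mul,
    mul_assoc]

/-- Conjugation by the exponential sends g ⊗ 1 to g ⊗ (1 + g), so the primitive coproduct of g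
becomes g ⊗ 1 + 1 ⊗ g + g ⊗ g. Thus 1 + g becomes group-like and ln(1 + g) primitive. -/
theorem expS_tens_logS_mul_logS {H g : PowerSeries A} (hg : coeff 0 g = 0)
    (hHg : H * g = g * H + g) :
    expS (tens H (logS g)) * logS (tens g 1 + tens 1 g) =
      (tens (logS g) 1 + tens 1 (logS g)) * expS (tens H (logS g)) := by
  have h1 : coeff 0 (tens g 1) = 0 := by rw [coeff_zero_tens, hg, TensorProduct.zero_tmul]
  have h2 : coeff 0 (tens 1 g) = 0 := coeff_zero_tens_of_right hg
  have hc : Commute (tens g 1) (tens 1 g) := commute_tens (Commute.one_right _) (Commute.one_left _)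
  have hl1 : logS (tens g 1) = tens (logS g) 1 := by
    rw [tens, tens, map_one, mul_one, mul_one, ext_logS]
  have hl2 : logS (tens 1 g) = tens 1 (logS g) := by
    rw [tens, tens, map_one, one_mul, one_mul, ext_logS]
  rw [← hl1, ← hl2, ← logS_add_add_mul h1 h2 hc]
  refine (logS_intertwine ?_ ?_ ?_).symm
  · rw [map_add, map_add, coeff_zero_mul, h1, h2, mul_zero, add_zero, add_zero]
  · rw [map_add, h1, h2, add_zero]
  · have he := expS_tens_mul_of_eigen (s := logS g) (z := g) (H := H) (c := 1) (coeff_zero_logS _)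
      (by rw [one_smul, hHg])
    rw [one_smul, expS_logS hg, tens_add_right] at he
    have hcomm : Commute (tens 1 g) (expS (tens H (logS g))) :=
      commute_expS (coeff_zero_tens_of_right (coeff_zero_logS _))
        (commute_tens (Commute.one_left _) (commute_logS hg (Commute.refl g)))
    rw [mul_add, he, ← hcomm.eq, tens_mul_tens, one_mul, mul_one, add_mul, add_mul, add_mul]
    abel

/-- Only primitivity of `H` and `g` with respect to the coproduct deformed by `F` is required. This
permits both the first factor of a link (with `F` = 1) and the last one, built on the deformed
generator G. -/
theorem IsTwist.jordanian {F : PowerSeries (A ⊗[ℂ] A)} (hF : IsTwist F) {H g : PowerSeries A}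
    (hg : coeff 0 g = 0) (hHF : F * comulS H = (tens H 1 + tens 1 H) * F)
    (hgF : F * comulS g = (tens g 1 + tens 1 g) * F) (hHg : H * g = g * H + g)
    (hH : counitS H = 0) (hgc : counitS g = 0) : IsTwist (expS (tens H (logS g)) * F) := by
  have hs : coeff 0 (logS g) = 0 := coeff_zero_logS g
  have hf : coeff 0 (tens H (logS g)) = 0 := coeff_zero_tens_of_right hs
  have h3 : ∀ a b : PowerSeries A, coeff 0 (tens3 a b (logS g)) = 0 := fun a b => by
    rw [coeff_zero_tens3, hs, TensorProduct.tmul_zero, TensorProduct.tmul_zero]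
  have h3' : ∀ a b : PowerSeries A, coeff 0 (tens3 a (logS g) b) = 0 := fun a b => by
    rw [coeff_zero_tens3, hs, TensorProduct.zero_tmul, TensorProduct.tmul_zero]
  have hgg : coeff 0 (tens g 1 + tens 1 g) = 0 := by
    rw [map_add, coeff_zero_tens, coeff_zero_tens, hg, TensorProduct.zero_tmul,
      TensorProduct.tmul_zero, add_zero]
  have hsF : F * comulS (logS g) = logS (tens g 1 + tens 1 g) * F := by
    rw [comulS, ext_logS]
    refine (logS_intertwine hgg ?_ hgF.symm).symm
    rw [coeff_ext, hg, map_zero]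
  have hQ0 : coeff 0 (tens3 H 1 1 * ext leg23 (logS (tens g 1 + tens 1 g))) = 0 := by
    rw [coeff_zero_mul, coeff_ext, coeff_zero_logS, map_zero, mul_zero]
  have hext : ∀ φ : A ⊗[ℂ] A →ₐ[ℂ] A ⊗[ℂ] (A ⊗[ℂ] A), coeff 0 (ext φ (tens H (logS g))) = 0 :=
    fun φ => by rw [coeff_ext, hf, map_zero]
  refine hF.mul (P := expS (tens3 H 1 (logS g) + tens3 1 H (logS g)))
    (Q := expS (tens3 H 1 1 * ext leg23 (logS (tens g 1 + tens 1 g)))) (isUnit_expS hf) ?_ ?_ ?_ ?_ ?_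
  · rw [ext_expS]
    refine (expS_intertwine (by rw [map_add, h3, h3, add_zero]) (hext _) ?_).symm
    rw [IsTwist.leg12_mul_comulL_tens hHF, map_add, leg12_tens, leg12_tens, add_mul _ _ (tens3 1 1 _),
      tens3_mul_tens3, tens3_mul_tens3]
    simp only [mul_one, one_mul]
  · rw [ext_expS]
    exact (expS_intertwine hQ0 (hext _) (IsTwist.leg23_mul_comulR_tens hsF).symm).symm
  -- With σ = ln(1 + g), conjugation by the second and third legs turns Δ_F(σ) into σ ⊗ 1 + 1 ⊗ σ.
  -- Both sides then equal e^{H⊗σ⊗1} e^{H⊗1⊗σ} e^{1⊗H⊗σ}.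
  · have hkey : ext leg23 (expS (tens H (logS g))) *
        expS (tens3 H 1 1 * ext leg23 (logS (tens g 1 + tens 1 g))) =
        expS (tens3 H (logS g) 1 + tens3 H 1 (logS g)) * ext leg23 (expS (tens H (logS g))) := by
      refine (expS_intertwine (by rw [map_add, h3, h3', add_zero]) hQ0 ?_).symm
      rw [← mul_assoc, ← (commute_tens3_leg23 _ H).eq, mul_assoc, ← map_mul,
        expS_tens_logS_mul_logS hg hHg, map_mul, ← mul_assoc, map_add, leg23_tens, leg23_tens,
        mul_add, tens3_mul_tens3, tens3_mul_tens3]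
      simp only [mul_one, one_mul]
    rw [hkey, ext_expS, ext_expS, leg12_tens, leg23_tens, expS_add (h3 _ _) (h3 _ _),
      expS_add (h3' _ _) (h3 _ _), mul_assoc]
    · exact commute_tens3 (Commute.refl _) (Commute.one_right _) (Commute.one_left _)
    · exact commute_tens3 (Commute.one_right _) (Commute.one_left _) (Commute.refl _)
  · rw [ext_expS, counitL_tens]
    rw [show ext _ H = 0 from hH, zero_mul, expS_zero]
  · rw [ext_expS, counitR_tens, ext_logS]
    rw [show ext _ g = 0 from hgc, logS_zero, mul_zero, expS_zero]

/-- Put a = ∑ x⊗p⊗v, b = ∑ 1⊗x⊗v, c = ∑ x⊗v⊗1, d = ∑ x⊗q⊗v. The twist equation becomes e^c e^{b+a} =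
e^b e^{c+d}. It holds because [c, b] = d - a, by the Heisenberg relation in the middle leg, while c
commutes with a and d, and b with d. -/
theorem IsTwist.extension {F : PowerSeries (A ⊗[ℂ] A)} (hF : IsTwist F) {ι : Type*} [Fintype ι]
    [DecidableEq ι] {x v : ι → PowerSeries A} {p q : PowerSeries A} (hv : ∀ i, coeff 0 (v i) = 0)
    (hxF : ∀ i, F * comulS (x i) = (tens (x i) p + tens 1 (x i)) * F)
    (hvF : ∀ i, F * comulS (v i) = (tens (v i) 1 + tens q (v i)) * F)
    (hxx : ∀ i j, Commute (x i) (x j)) (hvv : ∀ i j, Commute (v i) (v j))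
    (hxv : ∀ i j, x i * v j = v j * x i + if i = j then p - q else 0)
    (hxq : ∀ i, Commute (x i) q) (hvp : ∀ i, Commute (v i) p) (hvq : ∀ i, Commute (v i) q)
    (hx0 : ∀ i, counitS (x i) = 0) (hv0 : ∀ i, counitS (v i) = 0) :
    IsTwist (expS (∑ i, tens (x i) (v i)) * F) := by
  have hf : coeff 0 (∑ i, tens (x i) (v i)) = 0 := by
    rw [map_sum, Finset.sum_eq_zero fun i _ => coeff_zero_tens_of_right (hv i)]
  have h3 : ∀ i, ∀ a b : PowerSeries A, coeff 0 (tens3 a b (v i)) = 0 := fun i a b => by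
    rw [coeff_zero_tens3, hv, TensorProduct.tmul_zero, TensorProduct.tmul_zero]
  have h3' : ∀ i, ∀ a b : PowerSeries A, coeff 0 (tens3 a (v i) b) = 0 := fun i a b => by
    rw [coeff_zero_tens3, hv, TensorProduct.zero_tmul, TensorProduct.tmul_zero]
  have hsum : ∀ w : ι → PowerSeries (A ⊗[ℂ] (A ⊗[ℂ] A)), (∀ i, coeff 0 (w i) = 0) →
      coeff 0 (∑ i, w i) = 0 := fun w hw => by
    rw [map_sum, Finset.sum_eq_zero fun i _ => hw i]
  have hext : ∀ φ : A ⊗[ℂ] A →ₐ[ℂ] A ⊗[ℂ] (A ⊗[ℂ] A),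
      coeff 0 (ext φ (∑ i, tens (x i) (v i))) = 0 := fun φ => by rw [coeff_ext, hf, map_zero]
  have ha := hsum (fun i => tens3 (x i) p (v i)) fun i => h3 i _ _
  have hb := hsum (fun i => tens3 1 (x i) (v i)) fun i => h3 i _ _
  have hc := hsum (fun i => tens3 (x i) (v i) 1) fun i => h3' i _ _
  have hd := hsum (fun i => tens3 (x i) q (v i)) fun i => h3 i _ _
  have hbd : Commute (∑ i, tens3 1 (x i) (v i)) (∑ i, tens3 (x i) q (v i)) :=
    Commute.sum_left _ _ _ fun i _ => Commute.sum_right _ _ _ fun j _ =>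
      commute_tens3 (Commute.one_left _) (hxq i) (hvv i j)
  have hcd : Commute (∑ i, tens3 (x i) (v i) 1) (∑ i, tens3 (x i) q (v i)) :=
    Commute.sum_left _ _ _ fun i _ => Commute.sum_right _ _ _ fun j _ =>
      commute_tens3 (hxx i j) (hvq i) (Commute.one_left _)
  have hca : Commute (∑ i, tens3 (x i) (v i) 1) (∑ i, tens3 (x i) p (v i)) :=
    Commute.sum_left _ _ _ fun i _ => Commute.sum_right _ _ _ fun j _ =>
      commute_tens3 (hxx i j) (hvp i) (Commute.one_left _)
  have hcb : (∑ i, tens3 (x i) (v i) 1) * (∑ i, tens3 1 (x i) (v i)) =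
      (∑ i, tens3 1 (x i) (v i)) * (∑ i, tens3 (x i) (v i) 1) +
        ((∑ i, tens3 (x i) q (v i)) - ∑ i, tens3 (x i) p (v i)) := by
    rw [Finset.sum_mul_sum, Finset.sum_mul_sum, Finset.sum_comm' (t' := Finset.univ)
      (s' := fun _ => Finset.univ) (by simp)]
    rw [← Finset.sum_sub_distrib, ← Finset.sum_add_distrib]
    refine Finset.sum_congr rfl fun i _ => ?_
    simp only [tens3_mul_tens3, mul_one, one_mul, hxv, tens3_add_middle, Finset.sum_add_distrib]
    have : ∑ j, tens3 (x j) (if i = j then p - q else 0) (v i) = tens3 (x i) (p - q) (v i) := by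
      rw [Finset.sum_eq_single i]
      · rw [if_pos rfl]
      · intro j _ hj
        rw [if_neg (Ne.symm hj), tens3_zero_middle]
      · simp
    rw [this, tens3_sub_middle]
    abel
  refine hF.mul (P := expS ((∑ i, tens3 1 (x i) (v i)) + ∑ i, tens3 (x i) p (v i)))
    (Q := expS ((∑ i, tens3 (x i) (v i) 1) + ∑ i, tens3 (x i) q (v i))) (isUnit_expS hf) ?_ ?_ ?_ ?_ ?_
  · rw [ext_expS]
    refine (expS_intertwine (by rw [map_add, ha, hb, add_zero]) (hext _) ?_).symm
    rw [map_sum, Finset.mul_sum, ← Finset.sum_add_distrib, Finset.sum_mul]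
    refine Finset.sum_congr rfl fun i _ => ?_
    rw [IsTwist.leg12_mul_comulL_tens (hxF i), map_add, leg12_tens, leg12_tens,
      add_mul _ _ (tens3 1 1 _), tens3_mul_tens3, tens3_mul_tens3]
    simp only [mul_one, one_mul]
    rw [add_comm]
  · rw [ext_expS]
    refine (expS_intertwine (by rw [map_add, hc, hd, add_zero]) (hext _) ?_).symm
    rw [map_sum, Finset.mul_sum, ← Finset.sum_add_distrib, Finset.sum_mul]
    refine Finset.sum_congr rfl fun i _ => ?_
    rw [IsTwist.leg23_mul_comulR_tens (hvF i), map_add, leg23_tens, leg23_tens,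
      mul_add (tens3 _ _ _), tens3_mul_tens3, tens3_mul_tens3]
    simp only [mul_one, one_mul]
  · have h1 : ext leg12 (∑ i, tens (x i) (v i)) = ∑ i, tens3 (x i) (v i) 1 := by
      rw [map_sum]
      exact Finset.sum_congr rfl fun i _ => leg12_tens _ _
    have h2 : ext leg23 (∑ i, tens (x i) (v i)) = ∑ i, tens3 1 (x i) (v i) := by
      rw [map_sum]
      exact Finset.sum_congr rfl fun i _ => leg23_tens _ _
    rw [ext_expS, ext_expS, h1, h2, expS_add hc hd hcd, ← mul_assoc]
    have hk := expS_mul_of_commutator hc hcb (hcd.sub_right hca).eq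
    -- Moving e^c to the right replaces b by b + d - a, so the exponent b + a turns into b + d.
    have hk' := expS_intertwine (f := (∑ i, tens3 1 (x i) (v i)) + ∑ i, tens3 (x i) q (v i))
      (g := (∑ i, tens3 1 (x i) (v i)) + ∑ i, tens3 (x i) p (v i))
      (a := expS (∑ i, tens3 (x i) (v i) 1)) (by rw [map_add, hd, hb, add_zero])
      (by rw [map_add, ha, hb, add_zero]) (by
        rw [mul_add, hk, ← (commute_expS hc hca.symm).eq, ← add_mul]
        congr 1
        abel)
    rw [← hk', expS_add hb hd hbd, mul_assoc, mul_assoc, (commute_expS hd (commute_expS hc hcd.symm).symm).eq]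
  · rw [ext_expS, map_sum, Finset.sum_eq_zero, expS_zero]
    intro i _
    rw [counitL_tens]
    rw [show ext _ (x i) = 0 from hx0 i, zero_mul]
  · rw [ext_expS, map_sum, Finset.sum_eq_zero, expS_zero]
    intro i _
    rw [counitR_tens]
    rw [show ext _ (v i) = 0 from hv0 i, mul_zero]

end Jordanian

end Twist

/-! ### A link of the chain -/

namespace Twist

open PowerSeries

section Link

variable {A : Type*} [Ring A] [Bialgebra ℂ A]

/-- Primitive elements of `A[[h]]`. -/
structure IsPrim (z : PowerSeries A) : Prop where
  comul : comulS z = tens z 1 + tens 1 z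
  counit : counitS z = 0

/-- The relations between the generators of a link. -/
structure LinkRelations {ι : Type*} [Fintype ι] [DecidableEq ι] (Hp Hm E e : PowerSeries A)
    (x y : ι → PowerSeries A) (st : ι → ι) : Prop where
  prim_Hp : IsPrim Hp
  prim_Hm : IsPrim Hm
  prim_E : IsPrim E
  prim_e : IsPrim e
  prim_x : ∀ i, IsPrim (x i)
  prim_y : ∀ i, IsPrim (y i)
  Hp_E : Hp * E = E * Hp + E
  Hp_x : ∀ i, Hp * x i = x i * Hp + (1 / 2 : ℂ) • x i
  Hp_y : ∀ i, Hp * y i = y i * Hp + (1 / 2 : ℂ) • y i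
  Hp_e : Commute Hp e
  Hp_Hm : Commute Hp Hm
  Hm_E : Commute Hm E
  Hm_e : Hm * e = e * Hm + e
  Hm_x : ∀ i, Hm * x i = x i * Hm + (1 / 2 : ℂ) • x i
  Hm_y : ∀ i, Hm * y i = y i * Hm + (-1 / 2 : ℂ) • y i
  E_e : Commute E e
  E_x : ∀ i, Commute E (x i)
  E_y : ∀ i, Commute E (y i)
  e_x : ∀ i, Commute e (x i)
  x_x : ∀ i j, Commute (x i) (x j)
  y_y : ∀ i j, Commute (y i) (y j)
  x_y : ∀ i j, x i * y j = y j * x i + if i = j then E else 0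
  y_e : ∀ i, y i * e = e * y i + x (st i)
  st_st : ∀ i, st (st i) = i

variable {ι : Type*} [Fintype ι]

/-- `e^{c σ}` for `σ = ln (1 + h η E)`. -/
def sigmaExp (η c : ℂ) (E : PowerSeries A) : PowerSeries A :=
  expS (c • logS (hScalar A η * E))

/-- The exponent of the extension factor of a link. -/
def extExponent (η : ℂ) (E : PowerSeries A) (x y : ι → PowerSeries A) : PowerSeries (A ⊗[ℂ] A) :=
  ∑ i, tens (x i) (hScalar A η * (y i * sigmaExp η (-1 / 2) E))

/-- The deformed generator `G` of a link. -/
def linkG (η : ℂ) (e : PowerSeries A) (x : ι → PowerSeries A) (st : ι → ι) : PowerSeries A :=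
  e - hScalar A η * ((1 / 2 : ℂ) • ∑ i, x i * x (st i))

/-- A link of the chain. -/
def genLink (η ξ : ℂ) (Hp Hm E e : PowerSeries A) (x y : ι → PowerSeries A) (st : ι → ι) :
    PowerSeries (A ⊗[ℂ] A) :=
  expS (tens Hm (logS (hScalar A (η * ξ) * linkG η e x st))) *
    (expS (extExponent η E x y) * expS (tens Hp (logS (hScalar A η * E))))

section SigmaExp

variable (η : ℂ) (E : PowerSeries A)

theorem coeff_zero_smul_logS {B : Type*} [Ring B] [Algebra ℂ B] (c : ℂ) (f : PowerSeries B) :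
    coeff 0 (c • logS f) = 0 := by
  rw [coeff_complex_smul, coeff_zero_logS, smul_zero]

theorem commute_sigma {z : PowerSeries A} (h : Commute z E) :
    Commute z (logS (hScalar A η * E)) :=
  commute_logS (coeff_zero_hScalar_mul _ _) ((commute_hScalar _ _).symm.mul_right h)

theorem commute_sigmaExp {z : PowerSeries A} (h : Commute z E) (c : ℂ) :
    Commute z (sigmaExp η c E) :=
  commute_expS (coeff_zero_smul_logS _ _) ((commute_sigma η E h).smul_right c)

theorem sigmaExp_mul_sigmaExp (c d : ℂ) :
    sigmaExp η c E * sigmaExp η d E = sigmaExp η (c + d) E := by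
  rw [sigmaExp, sigmaExp, sigmaExp, add_smul, expS_add (coeff_zero_smul_logS _ _)
    (coeff_zero_smul_logS _ _) (((Commute.refl _).smul_left c).smul_right d)]

theorem sigmaExp_zero : sigmaExp η 0 E = 1 := by rw [sigmaExp, zero_smul, expS_zero]

theorem sigmaExp_one : sigmaExp η 1 E = 1 + hScalar A η * E := by
  rw [sigmaExp, one_smul, expS_logS (coeff_zero_hScalar_mul _ _)]

theorem sigmaExp_half_mul_neg : sigmaExp η (1 / 2) E * sigmaExp η (-1 / 2) E = 1 := by
  rw [sigmaExp_mul_sigmaExp, show (1 / 2 : ℂ) + -1 / 2 = 0 by ring, sigmaExp_zero]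

/-- From h η E = e^σ - 1. This identity makes the Heisenberg commutator of x and v equal to p - q,
as the extension lemma demands. -/
theorem hScalar_mul_sigmaExp : hScalar A η * (E * sigmaExp η (-1 / 2) E) =
    sigmaExp η (1 / 2) E - sigmaExp η (-1 / 2) E := by
  rw [eq_sub_iff_add_eq, ← mul_assoc]
  have : hScalar A η * E * sigmaExp η (-1 / 2) E + sigmaExp η (-1 / 2) E =
      (1 + hScalar A η * E) * sigmaExp η (-1 / 2) E := by rw [add_mul, one_mul, add_comm]
  rw [this, ← sigmaExp_one, sigmaExp_mul_sigmaExp]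
  norm_num

end SigmaExp

theorem comulS_hScalar_mul (c : ℂ) (z : PowerSeries A) :
    comulS (hScalar A c * z) = hScalar (A ⊗[ℂ] A) c * comulS z := by
  rw [comulS, map_mul, ext_hScalar]

theorem counitS_hScalar_mul (c : ℂ) {z : PowerSeries A} (hz : counitS z = 0) :
    counitS (hScalar A c * z) = 0 := by
  rw [counitS, map_mul, show ext _ z = 0 from hz, mul_zero]

theorem counitS_mul_of_left {z : PowerSeries A} (hz : counitS z = 0) (w : PowerSeries A) :
    counitS (z * w) = 0 := by
  rw [counitS, map_mul, show ext _ z = 0 from hz, zero_mul]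

theorem hScalar_mul_left_comm {B : Type*} [Ring B] [Algebra ℂ B] (c : ℂ) (a b : PowerSeries B) :
    a * (hScalar B c * b) = hScalar B c * (a * b) := by
  rw [← mul_assoc, ← (commute_hScalar c a).eq, mul_assoc]

theorem IsPrim.hScalar_mul {z : PowerSeries A} (hz : IsPrim z) (c : ℂ) :
    IsPrim (hScalar A c * z) where
  comul := by
    rw [comulS_hScalar_mul, hz.comul, tens_hScalar_left, tens_hScalar_right, mul_add]
  counit := counitS_hScalar_mul c hz.counit

theorem commute_v (η : ℂ) {E y z : PowerSeries A} (hy : Commute y z)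
    (hE : Commute z E) :
    Commute (hScalar A η * (y * sigmaExp η (-1 / 2) E)) z :=
  (commute_hScalar _ _).mul_left (hy.mul_left (commute_sigmaExp η E hE _).symm)

theorem jordanian_mul_eigen (η : ℂ) {Hp E z : PowerSeries A} {c : ℂ}
    (hz : IsPrim z) (hHz : Hp * z = z * Hp + c • z) (hEz : Commute z E) :
    expS (tens Hp (logS (hScalar A η * E))) * comulS z = (tens z (sigmaExp η c E) + tens 1 z) *
      expS (tens Hp (logS (hScalar A η * E))) := by
  rw [hz.comul, mul_add, expS_tens_mul_of_eigen (coeff_zero_logS _) hHz, add_mul]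
  congr 1
  exact (commute_expS (coeff_zero_tens_of_right (coeff_zero_logS _))
    (commute_tens (Commute.one_left _) (commute_sigma η E hEz))).eq.symm

theorem commute_sigmaExp_E (η c : ℂ) (E : PowerSeries A) : Commute (sigmaExp η c E) E :=
  (commute_sigmaExp η E (Commute.refl E) c).symm

theorem coeff_zero_extExponent (η : ℂ) (E : PowerSeries A) (x y : ι → PowerSeries A) :
    coeff 0 (extExponent η E x y) = 0 := by
  rw [extExponent, map_sum]
  exact Finset.sum_eq_zero fun i _ => coeff_zero_tens_of_right (coeff_zero_hScalar_mul _ _)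

theorem commute_extExponent_tens (η : ℂ) {E : PowerSeries A} {x y : ι → PowerSeries A} {a b : PowerSeries A}
    (ha : ∀ i, Commute (x i) a) (hb : ∀ i, Commute (y i) b) (hE : Commute b E) :
    Commute (extExponent η E x y) (tens a b) :=
  Commute.sum_left _ _ _ fun i _ => commute_tens (ha i) (commute_v η (hb i) hE)

variable [DecidableEq ι]

namespace LinkRelations

variable {Hp Hm E e : PowerSeries A} {x y : ι → PowerSeries A} {st : ι → ι}

theorem Hp_hE (h : LinkRelations Hp Hm E e x y st) (η : ℂ) :
    Hp * (hScalar A η * E) = hScalar A η * E * Hp + hScalar A η * E := by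
  rw [hScalar_mul_left_comm, h.Hp_E, mul_add, mul_assoc]

theorem isTwist_jordanian (h : LinkRelations Hp Hm E e x y st) (η : ℂ) :
    IsTwist (expS (tens Hp (logS (hScalar A η * E)))) := by
  have := isTwist_one.jordanian (H := Hp) (g := hScalar A η * E) (coeff_zero_hScalar_mul _ _)
    (by rw [one_mul, mul_one, h.prim_Hp.comul])
    (by rw [one_mul, mul_one, (h.prim_E.hScalar_mul η).comul]) (h.Hp_hE η) h.prim_Hp.counit
    (h.prim_E.hScalar_mul η).counit
  rwa [mul_one] at this

/-- After the Jordanian factor σ is primitive, so each e^{cσ} is group-like. -/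
theorem jordanian_mul_sigmaExp (h : LinkRelations Hp Hm E e x y st) (η c : ℂ) :
    expS (tens Hp (logS (hScalar A η * E))) * comulS (sigmaExp η c E) =
      tens (sigmaExp η c E) (sigmaExp η c E) * expS (tens Hp (logS (hScalar A η * E))) := by
  have h0 : coeff 0 (hScalar A η * E) = 0 := coeff_zero_hScalar_mul _ _
  set s := logS (hScalar A η * E) with hs
  have hs0 : coeff 0 s = 0 := coeff_zero_logS _
  have h1 : expS (tens Hp s) * comulS s = (tens s 1 + tens 1 s) * expS (tens Hp s) := by
    rw [hs, comulS, ext_logS, show ext _ (hScalar A η * E) = _ from (h.prim_E.hScalar_mul η).comul,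
      expS_tens_logS_mul_logS h0 (h.Hp_hE η)]
  have hc0 : coeff 0 (tens (c • s) 1) = 0 := by
    rw [coeff_zero_tens, hs, coeff_zero_smul_logS, TensorProduct.zero_tmul]
  have hc1 : coeff 0 (tens 1 (c • s)) = 0 := coeff_zero_tens_of_right (coeff_zero_smul_logS _ _)
  have h2 : tens (sigmaExp η c E) (sigmaExp η c E) = expS (tens (c • s) 1 + tens 1 (c • s)) := by
    rw [expS_add hc0 hc1 (commute_tens (Commute.one_right _) (Commute.one_left _)),
      expS_tens_one_left, expS_tens_one_right, tens_mul_tens, mul_one, one_mul]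
    rfl
  rw [h2, sigmaExp, ← hs, comulS, ext_expS]
  refine (expS_intertwine (by rw [map_add, hc0, hc1, add_zero]) ?_ ?_).symm
  · rw [coeff_ext, hs, coeff_zero_smul_logS, map_zero]
  · rw [ext_smul, mul_smul_comm, h1, tens_smul_left, tens_smul_right, ← smul_add, smul_mul_assoc]

theorem x_v (h : LinkRelations Hp Hm E e x y st) (η : ℂ) (i j : ι) :
    x i * (hScalar A η * (y j * sigmaExp η (-1 / 2) E)) =
      hScalar A η * (y j * sigmaExp η (-1 / 2) E) * x i +
        if i = j then sigmaExp η (1 / 2) E - sigmaExp η (-1 / 2) E else 0 := by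
  rw [hScalar_mul_left_comm, ← mul_assoc (x i), h.x_y, mul_assoc, mul_assoc (y j),
    ← (commute_sigmaExp η E (h.E_x i).symm _).eq, add_mul, mul_add, mul_assoc]
  congr 1
  split_ifs
  · exact hScalar_mul_sigmaExp η E
  · rw [zero_mul, mul_zero]

theorem commute_y_sigmaExp (h : LinkRelations Hp Hm E e x y st) (η c : ℂ) (i : ι) :
    Commute (y i) (sigmaExp η c E) :=
  commute_sigmaExp η E (h.E_y i).symm c

theorem isTwist_extended (h : LinkRelations Hp Hm E e x y st) (η : ℂ) :
    IsTwist (expS (extExponent η E x y) * expS (tens Hp (logS (hScalar A η * E)))) := by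
  refine (h.isTwist_jordanian η).extension (p := sigmaExp η (1 / 2) E)
    (q := sigmaExp η (-1 / 2) E) (fun i => coeff_zero_hScalar_mul _ _)
    (fun i => jordanian_mul_eigen η (h.prim_x i) (h.Hp_x i) (h.E_x i).symm) (fun i => ?_)
    h.x_x (fun i j => ?_) (h.x_v η) (fun i => commute_sigmaExp η E (h.E_x i).symm _)
    (fun i => commute_v η (h.commute_y_sigmaExp η _ i) (commute_sigmaExp_E η _ E))
    (fun i => commute_v η (h.commute_y_sigmaExp η _ i) (commute_sigmaExp_E η _ E))
    (fun i => (h.prim_x i).counit)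
    (fun i => counitS_hScalar_mul _ (counitS_mul_of_left (h.prim_y i).counit _))
  -- The factor e^{-σ/2} in the exponent is chosen for this: with p = e^{σ/2}, q = e^{-σ/2} one has
  -- (y⊗p + 1⊗y)(q⊗q) = yq⊗1 + q⊗yq.
  · rw [comulS_hScalar_mul, hScalar_mul_left_comm, comulS, map_mul, ← mul_assoc (expS _)]
    rw [jordanian_mul_eigen η (h.prim_y i) (h.Hp_y i) (h.E_y i).symm, mul_assoc,
      h.jordanian_mul_sigmaExp, ← mul_assoc, ← mul_assoc]
    congr 1
    rw [mul_assoc, add_mul, tens_mul_tens, tens_mul_tens, sigmaExp_half_mul_neg, one_mul, mul_add,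
      ← tens_hScalar_left, ← tens_hScalar_right]
  · refine commute_v η (Commute.symm (commute_v η (h.y_y j i) (h.E_y i).symm)) ?_
    exact (commute_hScalar _ _).mul_left ((h.E_y j).symm.mul_left (commute_sigmaExp_E η _ E))

theorem extExponent_mul_x (h : LinkRelations Hp Hm E e x y st) (η : ℂ) (k : ι) :
    extExponent η E x y * tens 1 (x k) = tens 1 (x k) * extExponent η E x y +
      tens (x k) (sigmaExp η (-1 / 2) E - sigmaExp η (1 / 2) E) := by
  have hk : ∀ i, hScalar A η * (y i * sigmaExp η (-1 / 2) E) * x k =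
      x k * (hScalar A η * (y i * sigmaExp η (-1 / 2) E)) +
        if k = i then sigmaExp η (-1 / 2) E - sigmaExp η (1 / 2) E else 0 := fun i => by
    rw [h.x_v]
    split_ifs <;> abel
  rw [extExponent, Finset.sum_mul, Finset.mul_sum]
  simp only [tens_mul_tens, hk, tens_add_right, Finset.sum_add_distrib, mul_one, one_mul]
  congr 1
  rw [Finset.sum_eq_single k]
  · rw [if_pos rfl]
  · intro j _ hj
    rw [if_neg (Ne.symm hj), tens_zero_right]
  · simp

/-- The Jordanian factor gives x ⊗ e^{σ/2} + 1 ⊗ x, and the extension adds x ⊗ (e^{-σ/2} - e^{σ/2}).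
The net effect is to reverse the sign in the exponential. -/
theorem extended_mul_x (h : LinkRelations Hp Hm E e x y st) (η : ℂ) (k : ι) :
    expS (extExponent η E x y) * expS (tens Hp (logS (hScalar A η * E))) * comulS (x k) =
      (tens (x k) (sigmaExp η (-1 / 2) E) + tens 1 (x k)) *
        (expS (extExponent η E x y) * expS (tens Hp (logS (hScalar A η * E)))) := by
  have h0 := coeff_zero_extExponent η E x y
  have hc : ∀ c, Commute (extExponent η E x y) (tens (x k) (sigmaExp η c E)) := fun c =>
    commute_extExponent_tens η (fun i => h.x_x i k) (h.commute_y_sigmaExp η c)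
      (commute_sigmaExp_E η c E)
  have hc' : Commute (extExponent η E x y)
      (tens (x k) (sigmaExp η (-1 / 2) E - sigmaExp η (1 / 2) E)) :=
    commute_extExponent_tens η (fun i => h.x_x i k)
      (fun i => (h.commute_y_sigmaExp η _ i).sub_right (h.commute_y_sigmaExp η _ i))
      ((commute_sigmaExp_E η _ E).sub_left (commute_sigmaExp_E η _ E))
  rw [mul_assoc, jordanian_mul_eigen η (h.prim_x k) (h.Hp_x k) (h.E_x k).symm, ← mul_assoc,
    ← mul_assoc, mul_add, expS_mul_of_commutator h0 (h.extExponent_mul_x η k) hc'.eq,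
    ← (commute_expS h0 (hc _).symm).eq, ← add_mul]
  congr 2
  rw [sub_eq_add_neg, tens_add_right, tens_neg_right]
  abel

/-- The weights 1/2 of x_i and -1/2 of y_i cancel in the extension exponent, and `Hm` commutes with
`Hp` and `E`; hence `Hm` remains primitive. -/
theorem extended_mul_Hm (h : LinkRelations Hp Hm E e x y st) (η : ℂ) :
    expS (extExponent η E x y) * expS (tens Hp (logS (hScalar A η * E))) * comulS Hm =
      (tens Hm 1 + tens 1 Hm) *
        (expS (extExponent η E x y) * expS (tens Hp (logS (hScalar A η * E)))) := by
  rw [h.prim_Hm.comul]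
  refine Commute.symm (Commute.mul_right ?_ ?_)
  · refine commute_expS (coeff_zero_extExponent η E x y) ?_
    refine Commute.sum_right _ _ _ fun i _ => ?_
    have hv : Hm * (hScalar A η * (y i * sigmaExp η (-1 / 2) E)) =
        hScalar A η * (y i * sigmaExp η (-1 / 2) E) * Hm +
          (-1 / 2 : ℂ) • (hScalar A η * (y i * sigmaExp η (-1 / 2) E)) := by
      rw [hScalar_mul_left_comm, ← mul_assoc Hm, h.Hm_y, add_mul, mul_assoc (y i),
        (commute_sigmaExp η E h.Hm_E _).eq, mul_add]
      simp only [mul_assoc, smul_mul_assoc, mul_smul_comm]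
    rw [Commute, SemiconjBy, add_mul, mul_add]
    simp only [tens_mul_tens, mul_one, one_mul, h.Hm_x, hv, tens_add_left, tens_add_right,
      tens_smul_left, tens_smul_right]
    module
  · exact commute_expS (coeff_zero_tens_of_right (coeff_zero_logS _))
      ((commute_tens h.Hp_Hm.symm (Commute.one_left _)).add_left
        (commute_tens (Commute.one_left _) (commute_sigma η E h.Hm_E)))

/-- The Jordanian factor does not affect `e`. The extension exponent J does: [J, 1 ⊗ e] is linear in
the x of the right leg, a second commutator with J removes that x, and a third vanishes. -/
theorem extended_mul_e (h : LinkRelations Hp Hm E e x y st) (η : ℂ) :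
    expS (extExponent η E x y) * expS (tens Hp (logS (hScalar A η * E))) * comulS e =
      (tens e 1 + tens 1 e +
          hScalar (A ⊗[ℂ] A) η * ∑ i, tens (x i) (x (st i) * sigmaExp η (-1 / 2) E) +
          (1 / 2 : ℂ) • (hScalar (A ⊗[ℂ] A) η * tens (∑ i, x i * x (st i))
            ((sigmaExp η (-1 / 2) E - sigmaExp η (1 / 2) E) * sigmaExp η (-1 / 2) E))) *
        (expS (extExponent η E x y) * expS (tens Hp (logS (hScalar A η * E)))) := by
  have h0 := coeff_zero_extExponent η E x y
  set q := sigmaExp η (-1 / 2) E with hq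
  set p := sigmaExp η (1 / 2) E with hp
  set J := extExponent η E x y with hJ
  have hJe : Commute (expS (tens Hp (logS (hScalar A η * E)))) (comulS e) := by
    rw [h.prim_e.comul]
    refine (commute_expS (coeff_zero_tens_of_right (coeff_zero_logS _)) ?_).symm
    exact (commute_tens h.Hp_e.symm (Commute.one_left _)).add_left
      (commute_tens (Commute.one_left _) (commute_sigma η E h.E_e.symm))
  have h1 : J * tens 1 e = tens 1 e * J +
      hScalar (A ⊗[ℂ] A) η * ∑ i, tens (x i) (x (st i) * q) := by
    rw [hJ, extExponent, Finset.sum_mul, Finset.mul_sum, Finset.mul_sum, ← Finset.sum_add_distrib]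
    refine Finset.sum_congr rfl fun i _ => ?_
    rw [tens_mul_tens, tens_mul_tens, mul_one, one_mul, ← tens_hScalar_right, ← tens_add_right,
      hScalar_mul_left_comm, mul_assoc, mul_assoc, ← (commute_sigmaExp η E h.E_e.symm _).eq,
      ← mul_assoc (y i), h.y_e, add_mul, mul_add, mul_assoc, hq]
  have hx : ∀ k, J * tens 1 (x k) = tens 1 (x k) * J + tens (x k) (q - p) :=
    h.extExponent_mul_x η
  have hcq : ∀ i, Commute J (tens (x i) q) := fun i =>
    commute_extExponent_tens η (fun j => h.x_x j i) (h.commute_y_sigmaExp η _)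
      (commute_sigmaExp_E η _ E)
  have h2 : J * (hScalar (A ⊗[ℂ] A) η * ∑ i, tens (x i) (x (st i) * q)) =
      hScalar (A ⊗[ℂ] A) η * (∑ i, tens (x i) (x (st i) * q)) * J +
        hScalar (A ⊗[ℂ] A) η * tens (∑ i, x i * x (st i)) ((q - p) * q) := by
    rw [hScalar_mul_left_comm, mul_assoc, ← mul_add]
    congr 1
    rw [Finset.mul_sum, Finset.sum_mul, tens_sum_left, ← Finset.sum_add_distrib]
    refine Finset.sum_congr rfl fun i _ => ?_
    have hs : tens (x i) (x (st i) * q) = tens 1 (x (st i)) * tens (x i) q := by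
      rw [tens_mul_tens, one_mul]
    rw [hs, ← mul_assoc, hx, add_mul, mul_assoc, (hcq i).eq, mul_assoc, tens_mul_tens,
      (h.x_x (st i) i).eq]
  have h3 : Commute J (hScalar (A ⊗[ℂ] A) η * tens (∑ i, x i * x (st i)) ((q - p) * q)) := by
    refine (commute_hScalar _ _).symm.mul_right (commute_extExponent_tens η (fun j => ?_)
      (fun j => ?_) ?_)
    · exact Commute.sum_right _ _ _ fun i _ => (h.x_x _ _).mul_right (h.x_x _ _)
    · exact ((h.commute_y_sigmaExp η _ j).sub_right (h.commute_y_sigmaExp η _ j)).mul_right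
        (h.commute_y_sigmaExp η _ j)
    · exact ((commute_sigmaExp_E η _ E).sub_left (commute_sigmaExp_E η _ E)).mul_left
        (commute_sigmaExp_E η _ E)
  have h4 : Commute (tens e 1) (expS J) := commute_expS h0
    (commute_extExponent_tens η (fun i => (h.e_x i).symm) (fun i => Commute.one_right _)
      (Commute.one_left _)).symm
  rw [mul_assoc, hJe.eq, ← mul_assoc, ← mul_assoc]
  congr 1
  rw [h.prim_e.comul, mul_add, expS_mul_of_commutators h0 h1 h2 h3.eq, ← h4.eq, ← add_mul]
  congr 1
  abel

theorem extended_mul_quadratic (h : LinkRelations Hp Hm E e x y st) (η : ℂ) :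
    expS (extExponent η E x y) * expS (tens Hp (logS (hScalar A η * E))) *
        comulS (∑ i, x i * x (st i)) =
      (tens (∑ i, x i * x (st i)) (sigmaExp η (-1 / 2) E * sigmaExp η (-1 / 2) E) +
          tens 1 (∑ i, x i * x (st i)) +
          (2 : ℂ) • ∑ i, tens (x i) (x (st i) * sigmaExp η (-1 / 2) E)) *
        (expS (extExponent η E x y) * expS (tens Hp (logS (hScalar A η * E)))) := by
  -- Reindexing by the involution identifies the two cross terms of the product, whence the
  -- coefficient 2.
  have hsum : ∑ i, tens (x (st i)) (x i * sigmaExp η (-1 / 2) E) =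
      ∑ i, tens (x i) (x (st i) * sigmaExp η (-1 / 2) E) := by
    rw [← Equiv.sum_comp (Function.Involutive.toPerm st h.st_st)
      fun i => tens (x (st i)) (x i * sigmaExp η (-1 / 2) E)]
    refine Finset.sum_congr rfl fun i _ => ?_
    change tens (x (st (st i))) (x (st i) * _) = _
    rw [h.st_st]
  rw [comulS, map_sum, Finset.mul_sum, two_smul]
  nth_rewrite 1 [← hsum]
  rw [tens_sum_left, tens_sum_right, ← Finset.sum_add_distrib, ← Finset.sum_add_distrib,
    ← Finset.sum_add_distrib, Finset.sum_mul]
  refine Finset.sum_congr rfl fun i _ => ?_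
  rw [map_mul, ← mul_assoc, h.extended_mul_x η i, mul_assoc, h.extended_mul_x η (st i), ← mul_assoc]
  congr 1
  simp only [add_mul, mul_add, tens_mul_tens, one_mul, mul_one]
  rw [(commute_sigmaExp η E (h.E_x (st i)).symm (-1 / 2)).eq]
  abel

/-- The factor 1/2 in G cancels the doubled cross term against the one in the coproduct of `e`. In
the remaining quadratic terms the squares of e^{-σ/2} cancel too, and e^{σ/2} e^{-σ/2} = 1 leaves
exactly the primitive contribution. -/
theorem extended_mul_linkG (h : LinkRelations Hp Hm E e x y st) (η : ℂ) :
    expS (extExponent η E x y) * expS (tens Hp (logS (hScalar A η * E))) *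
        comulS (linkG η e x st) =
      (tens (linkG η e x st) 1 + tens 1 (linkG η e x st)) *
        (expS (extExponent η E x y) * expS (tens Hp (logS (hScalar A η * E)))) := by
  rw [linkG, comulS, map_sub, map_mul, ext_hScalar, ext_smul, mul_sub, hScalar_mul_left_comm,
    mul_smul_comm]
  rw [h.extended_mul_e, h.extended_mul_quadratic, ← smul_mul_assoc (1 / 2 : ℂ) (_ + _ + _) (expS _ * expS _),
    ← mul_assoc (hScalar _ _) ((1 / 2 : ℂ) • _), ← sub_mul]
  congr 1
  simp only [sub_eq_add_neg, tens_add_left, tens_add_right, tens_neg_left, tens_neg_right,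
    tens_hScalar_left, tens_hScalar_right, tens_smul_left, tens_smul_right, add_mul, neg_mul,
    sigmaExp_half_mul_neg, smul_add, mul_add, mul_smul_comm, mul_neg, smul_neg, smul_smul]
  norm_num
  abel

theorem isTwist_genLink (h : LinkRelations Hp Hm E e x y st) (η ξ : ℂ) :
    IsTwist (genLink η ξ Hp Hm E e x y st) := by
  refine (h.isTwist_extended η).jordanian (coeff_zero_hScalar_mul _ _) (h.extended_mul_Hm η) ?_ ?_
    h.prim_Hm.counit (counitS_hScalar_mul _ ?_)
  · rw [comulS_hScalar_mul, hScalar_mul_left_comm, h.extended_mul_linkG, tens_hScalar_left,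
      tens_hScalar_right, ← mul_add, mul_assoc]
  -- Two factors of weight 1/2 give weight 1, the weight of `e`; so G is homogeneous and [Hm, G] =
  -- G.
  · have hq : ∀ i, Hm * (x i * x (st i)) = x i * x (st i) * Hm + x i * x (st i) := fun i => by
      rw [← mul_assoc, h.Hm_x, add_mul, mul_assoc, h.Hm_x, mul_add, ← mul_assoc, smul_mul_assoc,
        mul_smul_comm]
      module
    have hG : Hm * linkG η e x st = linkG η e x st * Hm + linkG η e x st := by
      have hs : Hm * ∑ i, x i * x (st i) = (∑ i, x i * x (st i)) * Hm + ∑ i, x i * x (st i) := by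
        rw [Finset.mul_sum, Finset.sum_mul, ← Finset.sum_add_distrib]
        exact Finset.sum_congr rfl fun i _ => hq i
      rw [linkG, mul_sub, h.Hm_e, hScalar_mul_left_comm, mul_smul_comm, hs, sub_mul, smul_add,
        mul_add, mul_assoc (hScalar _ _), smul_mul_assoc]
      abel
    rw [hScalar_mul_left_comm, hG, mul_add, mul_assoc]
  · have hq : ext ((Algebra.ofId ℂ A).comp (Bialgebra.counitAlgHom ℂ A)) (∑ i, x i * x (st i)) = 0 := by
      rw [map_sum]
      refine Finset.sum_eq_zero fun i _ => ?_
      exact counitS_mul_of_left (h.prim_x i).counit _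
    rw [linkG, counitS, map_sub, show ext _ e = 0 from h.prim_e.counit, map_mul, ext_smul, hq, smul_zero, mul_zero,
      sub_zero]

end LinkRelations

end Link

end Twist

/-! ### Composition of links -/

namespace Twist

open PowerSeries

section LinkComposition

variable {A : Type*} [Ring A] [Bialgebra ℂ A]

/-- Commutation means that `F` does not deform the coproducts occurring in the twist equation of
`F'`, so the undeformed equation suffices. -/
theorem IsTwist.mul_of_commute {F F' : PowerSeries (A ⊗[ℂ] A)} (hF : IsTwist F) (hF' : IsTwist F')
    (hL : Commute (ext leg12 F) (ext comulL F')) (hR : Commute (ext leg23 F) (ext comulR F')) :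
    IsTwist (F' * F) :=
  hF.mul hF'.isUnit hL.eq hR.eq hF'.cocycle hF'.counit_left hF'.counit_right

theorem commute_leg12_comulL {F : PowerSeries (A ⊗[ℂ] A)} {a : PowerSeries A}
    (h : Commute F (comulS a)) (b : PowerSeries A) :
    Commute (ext leg12 F) (ext comulL (tens a b)) := by
  rw [comulL_tens]
  exact (h.map (ext leg12)).mul_right (commute_tens3_leg12 F b)

theorem commute_leg23_comulR {F : PowerSeries (A ⊗[ℂ] A)} {b : PowerSeries A} (a : PowerSeries A)
    (h : Commute F (comulS b)) : Commute (ext leg23 F) (ext comulR (tens a b)) := by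
  rw [comulR_tens]
  exact (commute_tens3_leg23 F a).symm.mul_right (h.map (ext leg23))

theorem commute_ext_expS {B C : Type*} [Ring B] [Algebra ℂ B] [Ring C] [Algebra ℂ C] {φ : B →ₐ[ℂ] C}
    {G : PowerSeries C} {f : PowerSeries B} (hf : coeff 0 f = 0) (h : Commute G (ext φ f)) :
    Commute G (ext φ (expS f)) := by
  rw [ext_expS]
  exact commute_expS (by rw [coeff_ext, hf, map_zero]) h

theorem commute_ext_logS {B C : Type*} [Ring B] [Algebra ℂ B] [Ring C] [Algebra ℂ C] {φ : B →ₐ[ℂ] C}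
    {G : PowerSeries C} {f : PowerSeries B} (hf : coeff 0 f = 0) (h : Commute G (ext φ f)) :
    Commute G (ext φ (logS f)) := by
  rw [ext_logS]
  exact commute_logS (by rw [coeff_ext, hf, map_zero]) h

theorem commute_comulS_hScalar_mul {F : PowerSeries (A ⊗[ℂ] A)} {b : PowerSeries A} (c : ℂ)
    (h : Commute F (comulS b)) : Commute F (comulS (hScalar A c * b)) := by
  rw [comulS_hScalar_mul]
  exact (commute_hScalar _ _).symm.mul_right h

theorem commute_comulS_mul {F : PowerSeries (A ⊗[ℂ] A)} {a b : PowerSeries A}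
    (ha : Commute F (comulS a)) (hb : Commute F (comulS b)) : Commute F (comulS (a * b)) := by
  rw [comulS, map_mul]
  exact ha.mul_right hb

theorem commute_comulS_sigma {F : PowerSeries (A ⊗[ℂ] A)} {E : PowerSeries A} (η : ℂ)
    (h : Commute F (comulS E)) : Commute F (comulS (logS (hScalar A η * E))) :=
  commute_ext_logS (coeff_zero_hScalar_mul _ _) (commute_comulS_hScalar_mul η h)

variable {ι : Type*} [Fintype ι] {Hp Hm E e : PowerSeries A} {x y : ι → PowerSeries A} {st : ι → ι}

theorem commute_comulS_linkG {F : PowerSeries (A ⊗[ℂ] A)} (η : ℂ) (he : Commute F (comulS e))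
    (hx : ∀ i, Commute F (comulS (x i))) : Commute F (comulS (linkG η e x st)) := by
  rw [linkG, comulS, map_sub]
  refine he.sub_right (commute_comulS_hScalar_mul η ?_)
  rw [comulS, ext_smul, map_sum]
  exact (Commute.sum_right _ _ _ fun i _ => commute_comulS_mul (hx i) (hx (st i))).smul_right _

/-- If a twist commutes with the coproducts of the generators of a link, its product with the link
is a twist. -/
theorem IsTwist.genLink_mul {F : PowerSeries (A ⊗[ℂ] A)} (hF : IsTwist F) (η ξ : ℂ)
    (hT : IsTwist (genLink η ξ Hp Hm E e x y st)) (hHp : Commute F (comulS Hp))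
    (hHm : Commute F (comulS Hm)) (hE : Commute F (comulS E)) (he : Commute F (comulS e))
    (hx : ∀ i, Commute F (comulS (x i))) (hy : ∀ i, Commute F (comulS (y i))) :
    IsTwist (genLink η ξ Hp Hm E e x y st * F) := by
  have h1 : coeff 0 (tens Hm (logS (hScalar A (η * ξ) * linkG η e x st))) = 0 :=
    coeff_zero_tens_of_right (coeff_zero_logS _)
  have h2 := coeff_zero_extExponent η E x y
  have h3 : coeff 0 (tens Hp (logS (hScalar A η * E))) = 0 :=
    coeff_zero_tens_of_right (coeff_zero_logS _)
  refine hF.mul_of_commute hT ?_ ?_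
  · rw [genLink, map_mul, map_mul]
    refine (commute_ext_expS h1 (commute_leg12_comulL hHm _)).mul_right
      ((commute_ext_expS h2 ?_).mul_right (commute_ext_expS h3 (commute_leg12_comulL hHp _)))
    rw [extExponent, map_sum]
    exact Commute.sum_right _ _ _ fun i _ => commute_leg12_comulL (hx i) _
  · rw [genLink, map_mul, map_mul]
    refine (commute_ext_expS h1 (commute_leg23_comulR _ ?_)).mul_right
      ((commute_ext_expS h2 ?_).mul_right (commute_ext_expS h3 (commute_leg23_comulR _ ?_)))
    · exact commute_comulS_sigma _ (commute_comulS_linkG η he hx)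
    · rw [extExponent, map_sum]
      refine Commute.sum_right _ _ _ fun i _ => commute_leg23_comulR _
        (commute_comulS_hScalar_mul _ (commute_comulS_mul (hy i) ?_))
      refine commute_ext_expS (coeff_zero_smul_logS _ _) ?_
      rw [ext_smul]
      exact (commute_comulS_sigma η hE).smul_right _
    · exact commute_comulS_sigma η hE

/-- A link commutes with the coproducts of the primitive elements that act on the generators `xᵢ`
and `yᵢ` by dual matrices preserving the invariant form, and commute with the others. -/
theorem commute_genLink_comulS (η ξ : ℂ) {u : PowerSeries A} (hu : IsPrim u) (hHp : Commute u Hp)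
    (hHm : Commute u Hm) (hE : Commute u E) (he : Commute u e) (c : ι → ι → ℂ)
    (hx : ∀ l, u * x l = x l * u - ∑ m, c l m • x m)
    (hy : ∀ l, u * y l = y l * u + ∑ m, c m l • y m) (hst : ∀ i, st (st i) = i)
    (hc : ∀ l m, c (st l) (st m) = -c m l) :
    Commute (genLink η ξ Hp Hm E e x y st) (comulS u) := by
  have hperm : ∀ f : ι → PowerSeries A, ∑ i, f (st i) = ∑ i, f i := fun f =>
    Equiv.sum_comp (Function.Involutive.toPerm st hst) f
  -- Antisymmetry of `c` with respect to the form defined by `st` rewrites the action on the second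
  -- factor as the negative of the action on the first.
  have hquad : Commute u (∑ i, x i * x (st i)) := by
    have h1 : ∀ i, u * (x i * x (st i)) = x i * x (st i) * u - ∑ m, c i m • (x m * x (st i)) +
        ∑ m, c m i • (x i * x (st m)) := fun i => by
      have h2 : ∑ m, c (st i) m • x m = -∑ m, c m i • x (st m) := by
        rw [← hperm, ← Finset.sum_neg_distrib]
        simp only [hc, neg_smul]
      rw [← mul_assoc, hx, sub_mul, mul_assoc, hx, h2, mul_sub, Finset.sum_mul, mul_neg,
        Finset.mul_sum, ← mul_assoc]
      simp only [smul_mul_assoc, mul_smul_comm]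
      abel
    rw [Commute, SemiconjBy, Finset.mul_sum, Finset.sum_mul]
    simp only [h1]
    rw [Finset.sum_add_distrib, Finset.sum_sub_distrib, Finset.sum_comm (f := fun i m => c m i • (x i * x (st m))),
      sub_add_cancel]
  have hG : Commute u (linkG η e x st) :=
    he.sub_right ((commute_hScalar _ _).symm.mul_right (hquad.smul_right _))
  have hv : ∀ l, u * (hScalar A η * (y l * sigmaExp η (-1 / 2) E)) =
      hScalar A η * (y l * sigmaExp η (-1 / 2) E) * u +
        ∑ m, c m l • (hScalar A η * (y m * sigmaExp η (-1 / 2) E)) := fun l => by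
    rw [hScalar_mul_left_comm, ← mul_assoc u, hy, add_mul, mul_assoc,
      (commute_sigmaExp η E hE _).eq, Finset.sum_mul, mul_add, Finset.mul_sum]
    simp only [mul_assoc, smul_mul_assoc, mul_smul_comm]
  rw [hu.comul]
  refine Commute.symm (Commute.mul_right ?_ (Commute.mul_right ?_ ?_))
  · exact commute_expS (coeff_zero_tens_of_right (coeff_zero_logS _))
      ((commute_tens hHm (Commute.one_left _)).add_left (commute_tens (Commute.one_left _)
        (commute_sigma _ _ hG)))
  · refine commute_expS (coeff_zero_extExponent η E x y) ?_
    rw [extExponent, Commute, SemiconjBy, Finset.mul_sum, Finset.sum_mul]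
    simp only [add_mul, mul_add, tens_mul_tens, one_mul, mul_one, hx, hv, sub_eq_add_neg,
      tens_add_left, tens_add_right, tens_neg_left, tens_sum_left, tens_sum_right, tens_smul_left,
      tens_smul_right, Finset.sum_add_distrib, Finset.sum_neg_distrib]
    -- The contributions of u ⊗ 1 and 1 ⊗ u are the same double sum with opposite signs once the
    -- summation is exchanged: ∑ x ⊗ v pairs dual representations.
    rw [Finset.sum_comm (f := fun i m => c m i • tens (x i) _)]
    abel
  · exact commute_expS (coeff_zero_tens_of_right (coeff_zero_logS _))
      ((commute_tens hHp (Commute.one_left _)).add_left (commute_tens (Commute.one_left _)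
        (commute_sigma _ _ hE)))

theorem coeff_zero_genLink (η ξ : ℂ) : coeff 0 (genLink η ξ Hp Hm E e x y st) = 1 := by
  rw [genLink, coeff_zero_mul, coeff_zero_mul, coeff_zero_expS, coeff_zero_expS, coeff_zero_expS,
    one_mul, one_mul]

theorem coeff_one_tens_of_right {B : Type*} [Ring B] [Algebra ℂ B] {a b : PowerSeries B}
    (hb : coeff 0 b = 0) : coeff 1 (tens a b) = coeff 0 a ⊗ₜ coeff 1 b := by
  rw [tens, coeff_mul, Finset.Nat.antidiagonal_succ]
  simp [-coeff_zero_eq_constantCoeff, coeff_ext, hb]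

theorem coeff_one_genLink (η ξ : ℂ) : coeff 1 (genLink η ξ Hp Hm E e x y st) =
    η • (ξ • (coeff 0 Hm ⊗ₜ[ℂ] coeff 0 e) + ∑ i, coeff 0 (x i) ⊗ₜ[ℂ] coeff 0 (y i) +
      coeff 0 Hp ⊗ₜ[ℂ] coeff 0 E) := by
  rw [genLink, coeff_one_mul_of_coeff_zero (coeff_zero_expS _) (by
      rw [coeff_zero_mul, coeff_zero_expS, coeff_zero_expS, one_mul]),
    coeff_one_mul_of_coeff_zero (coeff_zero_expS _) (coeff_zero_expS _), coeff_one_expS,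
    coeff_one_expS, coeff_one_expS, coeff_one_tens_of_right (coeff_zero_logS _),
    coeff_one_tens_of_right (coeff_zero_logS _), coeff_one_logS, coeff_one_logS,
    coeff_one_hScalar_mul, coeff_one_hScalar_mul, linkG, map_sub, coeff_zero_hScalar_mul, sub_zero,
    extExponent, map_sum]
  have : ∀ i, coeff 1 (tens (x i) (hScalar A η * (y i * sigmaExp η (-1 / 2) E))) =
      η • (coeff 0 (x i) ⊗ₜ[ℂ] coeff 0 (y i)) := fun i => by
    rw [coeff_one_tens_of_right (coeff_zero_hScalar_mul _ _), coeff_one_hScalar_mul, coeff_zero_mul,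
      sigmaExp, coeff_zero_expS, mul_one, TensorProduct.tmul_smul]
  simp only [this, TensorProduct.tmul_smul, smul_add, Finset.smul_sum, smul_smul]
  abel

end LinkComposition

end Twist

/-! ### Commutation relations of the orthogonal algebra -/

namespace SOChain

open Twist Classical2

variable (M : ℕ)

theorem unit_mul_unit {i j k l : ℕ} (hj : 1 ≤ j) (hjM : j ≤ M) :
    unit M i j * unit M k l = if j = k then unit M i l else 0 := by
  ext a b
  rw [Matrix.mul_apply, Finset.sum_eq_single ⟨j - 1, by omega⟩]
  · simp only [unit, Matrix.of_apply]
    have : j - 1 + 1 = j := by omega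
    simp only [this, and_true]
    split_ifs <;> simp_all
  · intro c _ hc
    have : ¬ c.1 + 1 = j := fun h => hc (by ext; simp; omega)
    simp [unit, this]
  · simp

theorem coe_A (i j : ℕ) : (A M i j : Matrix (Fin M) (Fin M) ℂ) =
    unit M i j - unit M (M + 1 - j) (M + 1 - i) := rfl

theorem A_bar {i j : ℕ} (hi : i ≤ M) (hj : j ≤ M) :
    A M (M + 1 - j) (M + 1 - i) = -A M i j := by
  refine Subtype.ext ?_
  rw [NegMemClass.coe_neg, coe_A, coe_A, neg_sub]
  congr 2 <;> omega

theorem A_self_bar {i : ℕ} (hi : i ≤ M) : A M i (M + 1 - i) = 0 := by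
  refine Subtype.ext ?_
  rw [coe_A, show M + 1 - (M + 1 - i) = i by omega, sub_self]
  rfl

/-- The commutator of two differences of units has eight products. The reflection i ↦ M + 1 - i
matches their index conditions in pairs, and each pair assembles into one A. -/
theorem lie_A_A {i j k l : ℕ} (hi : 1 ≤ i) (hiM : i ≤ M) (hj : 1 ≤ j) (hjM : j ≤ M) (hk : 1 ≤ k)
    (hkM : k ≤ M) (hl : 1 ≤ l) (hlM : l ≤ M) :
    ⁅A M i j, A M k l⁆ = (if j = k then A M i l else 0) - (if l = i then A M k j else 0) -
      (if j + l = M + 1 then A M i (M + 1 - k) else 0) -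
      (if i + k = M + 1 then A M (M + 1 - j) l else 0) := by
  refine Subtype.ext ?_
  rw [LieSubalgebra.coe_bracket, LieRing.of_associative_ring_bracket, coe_A, coe_A]
  simp only [AddSubgroupClass.coe_sub, apply_ite (Subtype.val : so M → _), coe_A,
    ZeroMemClass.coe_zero]
  simp only [sub_mul, mul_sub, unit_mul_unit M hj hjM, unit_mul_unit M hl hlM,
    unit_mul_unit M (show 1 ≤ M + 1 - i by omega) (show M + 1 - i ≤ M by omega),
    unit_mul_unit M (show 1 ≤ M + 1 - k by omega) (show M + 1 - k ≤ M by omega)]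
  simp only [show (j = M + 1 - l) = (j + l = M + 1) from propext (by omega),
    show (l = M + 1 - j) = (j + l = M + 1) from propext (by omega),
    show (M + 1 - i = k) = (i + k = M + 1) from propext (by omega),
    show (M + 1 - k = i) = (i + k = M + 1) from propext (by omega),
    show (M + 1 - i = M + 1 - l) = (l = i) from propext (by omega),
    show (M + 1 - k = M + 1 - j) = (j = k) from propext (by omega),
    show M + 1 - (M + 1 - j) = j by omega, show M + 1 - (M + 1 - k) = k by omega]
  split_ifs <;> abel

/-- The indices of the vector representation of `so(M-4k-4)`. -/
abbrev Idx (k : ℕ) : Type := Finset.Icc (2 * k + 3) (M - (2 * k + 2))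

variable {M}

theorem Idx.lower {k : ℕ} (i : Idx M k) : 2 * k + 3 ≤ i.1 := (Finset.mem_Icc.mp i.2).1

theorem Idx.upper {k : ℕ} (i : Idx M k) : i.1 ≤ M - (2 * k + 2) := (Finset.mem_Icc.mp i.2).2

/-- The involution `j ↦ M + 1 - j`. -/
def Idx.bar {k : ℕ} (i : Idx M k) : Idx M k :=
  ⟨M + 1 - i.1, Finset.mem_Icc.mpr (by have := i.lower; have := i.upper; omega)⟩

theorem Idx.bar_bar {k : ℕ} (i : Idx M k) : i.bar.bar = i := by
  have := i.upper
  exact Subtype.ext (by simp only [Idx.bar]; omega)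

variable (M)

/-- The generators `A_{2k+1,j}`. -/
def xv (k : ℕ) (j : Idx M k) : so M := A M (2 * k + 1) j

/-- The generators `A_{2k+2,M+1-j}`. -/
def yv (k : ℕ) (j : Idx M k) : so M := A M (2 * k + 2) (M + 1 - j)

theorem lie_A_A_of_ne {i j k l : ℕ} (hi : 1 ≤ i) (hiM : i ≤ M) (hj : 1 ≤ j) (hjM : j ≤ M)
    (hk : 1 ≤ k) (hkM : k ≤ M) (hl : 1 ≤ l) (hlM : l ≤ M) (h1 : j ≠ k) (h2 : l ≠ i)
    (h3 : j + l ≠ M + 1) (h4 : i + k ≠ M + 1) : ⁅A M i j, A M k l⁆ = 0 := by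
  rw [lie_A_A M hi hiM hj hjM hk hkM hl hlM, if_neg h1, if_neg h2, if_neg h3, if_neg h4]
  simp

theorem lie_H_A_left {i l : ℕ} (hi : 1 ≤ i) (hiM : 2 * i ≤ M) (hl : 1 ≤ l) (hlM : l ≤ M)
    (h1 : l ≠ i) (h2 : i + l ≠ M + 1) : ⁅H M i, A M i l⁆ = (1 / 2 : ℂ) • A M i l := by
  rw [H, smul_lie, lie_A_A M hi (by omega) hi (by omega) hi (by omega) hl hlM, if_pos rfl,
    if_neg h1, if_neg h2, if_neg (by omega)]
  simp

theorem lie_H_A_right {i k : ℕ} (hi : 1 ≤ i) (hiM : 2 * i ≤ M) (hk : 1 ≤ k) (hkM : k ≤ M)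
    (h1 : k ≠ i) (h2 : i + k ≠ M + 1) : ⁅H M i, A M k i⁆ = (-1 / 2 : ℂ) • A M k i := by
  rw [H, smul_lie, lie_A_A M hi (by omega) hi (by omega) hk hkM hi (by omega), if_neg h1.symm,
    if_pos rfl, if_neg (by omega), if_neg h2]
  module

theorem lie_H_A_bar {i k : ℕ} (hi : 1 ≤ i) (hiM : 2 * i ≤ M) (hk : 1 ≤ k) (hkM : k ≤ M)
    (h1 : k ≠ i) (h2 : i + k ≠ M + 1) :
    ⁅H M i, A M k (M + 1 - i)⁆ = (1 / 2 : ℂ) • A M k (M + 1 - i) := by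
  have h := A_bar M hkM (show M + 1 - i ≤ M by omega)
  rw [show M + 1 - (M + 1 - i) = i by omega] at h
  rw [H, smul_lie, lie_A_A M hi (by omega) hi (by omega) hk hkM (by omega) (by omega),
    if_neg h1.symm, if_neg (by omega), if_pos (by omega), if_neg h2, h]
  module

theorem lie_H_A_of_ne {i k l : ℕ} (hi : 1 ≤ i) (hiM : 2 * i ≤ M) (hk : 1 ≤ k)
    (hkM : k ≤ M) (hl : 1 ≤ l) (hlM : l ≤ M) (h1 : i ≠ k) (h2 : l ≠ i) (h3 : i + l ≠ M + 1)
    (h4 : i + k ≠ M + 1) : ⁅H M i, A M k l⁆ = 0 := by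
  rw [H, smul_lie, lie_A_A_of_ne M hi (by omega) hi (by omega) hk hkM hl hlM h1 h2 h3 h4, smul_zero]

theorem lie_H_H {i j : ℕ} (hi : 1 ≤ i) (hiM : 2 * i ≤ M) (hj : 1 ≤ j) (hjM : 2 * j ≤ M) :
    ⁅H M i, H M j⁆ = 0 := by
  by_cases h : i = j
  · rw [h, lie_self]
  · rw [H, H, smul_lie, lie_smul, lie_A_A_of_ne M] <;> first | omega | simp

/-! ### Relations inside one link and with the next subalgebra -/

section Link

variable {M} {k : ℕ} (hk : 4 * (k + 1) ≤ M)
include hk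

theorem lie_Hp_Ep : ⁅Hp M k, Ep M k⁆ = Ep M k := by
  rw [Hp, Ep, Epl, lie_neg, add_lie, lie_H_A_left, lie_H_A_bar] <;> first | omega | module

theorem lie_Hp_Em : ⁅Hp M k, Em M k⁆ = 0 := by
  rw [Hp, Em, Emi, lie_neg, add_lie, lie_H_A_left, lie_H_A_right] <;> first | omega | module

theorem lie_Hm_Ep : ⁅Hm M k, Ep M k⁆ = 0 := by
  rw [Hm, Ep, Epl, lie_neg, sub_lie, lie_H_A_left, lie_H_A_bar] <;> first | omega | module

theorem lie_Hm_Em : ⁅Hm M k, Em M k⁆ = Em M k := by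
  rw [Hm, Em, Emi, lie_neg, sub_lie, lie_H_A_left, lie_H_A_right] <;> first | omega | module

theorem lie_Hp_Hm : ⁅Hp M k, Hm M k⁆ = 0 := by
  rw [Hp, Hm, add_lie, lie_sub, lie_sub, lie_H_H, lie_H_H, lie_H_H, lie_H_H] <;> first | omega | simp

theorem lie_Hp_xv (j : Idx M k) : ⁅Hp M k, xv M k j⁆ = (1 / 2 : ℂ) • xv M k j := by
  have := j.lower
  have := j.upper
  rw [Hp, xv, add_lie, lie_H_A_left, lie_H_A_of_ne] <;> first | omega | module

theorem lie_Hm_xv (j : Idx M k) : ⁅Hm M k, xv M k j⁆ = (1 / 2 : ℂ) • xv M k j := by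
  have := j.lower
  have := j.upper
  rw [Hm, xv, sub_lie, lie_H_A_left, lie_H_A_of_ne] <;> first | omega | module

theorem lie_Hp_yv (j : Idx M k) : ⁅Hp M k, yv M k j⁆ = (1 / 2 : ℂ) • yv M k j := by
  have := j.lower
  have := j.upper
  rw [Hp, yv, add_lie, lie_H_A_left, lie_H_A_of_ne] <;> first | omega | module

theorem lie_Hm_yv (j : Idx M k) : ⁅Hm M k, yv M k j⁆ = (-1 / 2 : ℂ) • yv M k j := by
  have := j.lower
  have := j.upper
  rw [Hm, yv, sub_lie, lie_H_A_left, lie_H_A_of_ne] <;> first | omega | module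

theorem lie_Ep_Em : ⁅Ep M k, Em M k⁆ = 0 := by
  rw [Ep, Em, Epl, Emi, lie_neg, neg_lie, lie_A_A, if_neg, if_neg, if_pos, if_neg, A_self_bar] <;>
    first | omega | simp

theorem lie_Ep_xv (j : Idx M k) : ⁅Ep M k, xv M k j⁆ = 0 := by
  have := j.lower
  have := j.upper
  rw [Ep, xv, Epl, neg_lie, lie_A_A_of_ne] <;> first | omega | simp

theorem lie_Ep_yv (j : Idx M k) : ⁅Ep M k, yv M k j⁆ = 0 := by
  have := j.lower
  have := j.upper
  rw [Ep, yv, Epl, neg_lie, lie_A_A_of_ne] <;> first | omega | simp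

theorem lie_Em_xv (j : Idx M k) : ⁅Em M k, xv M k j⁆ = 0 := by
  have := j.lower
  have := j.upper
  rw [Em, xv, Emi, neg_lie, lie_A_A_of_ne] <;> first | omega | simp

theorem lie_xv_xv (i j : Idx M k) : ⁅xv M k i, xv M k j⁆ = 0 := by
  have := i.lower
  have := i.upper
  have := j.lower
  have := j.upper
  rw [xv, xv, lie_A_A M, if_neg, if_neg, if_neg (c := 2 * k + 1 + (2 * k + 1) = M + 1),
    A_self_bar] <;> first | omega | simp

theorem lie_yv_yv (i j : Idx M k) : ⁅yv M k i, yv M k j⁆ = 0 := by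
  have := i.lower
  have := i.upper
  have := j.lower
  have := j.upper
  rw [yv, yv, lie_A_A M, if_neg, if_neg, if_neg (c := 2 * k + 2 + (2 * k + 2) = M + 1),
    A_self_bar] <;> first | omega | simp

theorem lie_xv_yv (i j : Idx M k) : ⁅xv M k i, yv M k j⁆ = if i = j then Ep M k else 0 := by
  have := i.lower
  have := i.upper
  have := j.lower
  have := j.upper
  rw [xv, yv, lie_A_A M, if_neg, if_neg, if_neg (c := 2 * k + 1 + (2 * k + 2) = M + 1)]
  · rw [Ep, Epl, sub_zero, sub_zero, zero_sub]
    by_cases h : i = j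
    · rw [if_pos h, if_pos (by rw [h]; omega)]
    · have : i.1 ≠ j.1 := fun h' => h (Subtype.ext h')
      rw [if_neg h, if_neg (by omega), neg_zero]
  all_goals omega

theorem lie_yv_Em (i : Idx M k) : ⁅yv M k i, Em M k⁆ = xv M k i.bar := by
  have := i.lower
  have := i.upper
  rw [xv, yv, Em, Emi, lie_neg, lie_A_A M, if_neg, if_pos, if_neg, if_neg]
  · simp [Idx.bar]
  all_goals omega

variable {i j : ℕ} (hi : 2 * k + 3 ≤ i) (hiM : i ≤ M - (2 * k + 2)) (hj : 2 * k + 3 ≤ j)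
  (hjM : j ≤ M - (2 * k + 2))
include hi hiM hj hjM

theorem lie_A_Hp : ⁅A M i j, Hp M k⁆ = 0 := by
  rw [Hp, H, H, lie_add, lie_smul, lie_smul, lie_A_A_of_ne, lie_A_A_of_ne] <;> first | omega | simp

theorem lie_A_Hm : ⁅A M i j, Hm M k⁆ = 0 := by
  rw [Hm, H, H, lie_sub, lie_smul, lie_smul, lie_A_A_of_ne, lie_A_A_of_ne] <;> first | omega | simp

theorem lie_A_Ep : ⁅A M i j, Ep M k⁆ = 0 := by
  rw [Ep, Epl, lie_neg, lie_A_A_of_ne] <;> first | omega | simp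

theorem lie_A_Em : ⁅A M i j, Em M k⁆ = 0 := by
  rw [Em, Emi, lie_neg, lie_A_A_of_ne] <;> first | omega | simp

end Link

/-- The matrix of `A_{i,j}` acting on the vector representation. -/
def vecMat {k : ℕ} (i j l m : Idx M k) : ℂ :=
  (if l = i then if m = j then 1 else 0 else 0) -
    if l = j.bar then if m = i.bar then 1 else 0 else 0

theorem Idx.bar_eq_iff {k : ℕ} {i j : Idx M k} : i.bar = j ↔ i = j.bar :=
  ⟨fun h => by rw [← h, i.bar_bar], fun h => by rw [h, j.bar_bar]⟩

/-- The matrix is skew for the form pairing each index with its mirror image; this is the invariance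
that fixes the scalar invariant. -/
theorem vecMat_bar_bar {k : ℕ} (i j l m : Idx M k) :
    vecMat M i j l.bar m.bar = -vecMat M i j m l := by
  simp only [vecMat, Idx.bar_eq_iff, Idx.bar_bar, neg_sub, ← ite_and]
  congr 2 <;> rw [and_comm]

theorem lie_A_xv {k : ℕ} (hk : 4 * (k + 1) ≤ M) (i j l : Idx M k) :
    ⁅A M i j, xv M k l⁆ = -∑ m, vecMat M i j l m • xv M k m := by
  have := i.lower
  have := i.upper
  have := j.lower
  have := j.upper
  have := l.lower
  have := l.upper
  have h1 : (l.1 = i.1) = (l = i) := propext Subtype.ext_iff.symm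
  have h2 : (j.1 + l.1 = M + 1) = (l = j.bar) :=
    propext ⟨fun h => Subtype.ext (by simp only [Idx.bar]; omega), fun h => by
      rw [h]; simp only [Idx.bar]; omega⟩
  have h3 : A M i.1 (M + 1 - (2 * k + 1)) = -xv M k i.bar := by
    rw [xv, ← A_bar M (by omega) (by have := i.bar.upper; omega)]
    simp only [Idx.bar]
    congr 1; omega
  rw [xv, lie_A_A M, if_neg, if_neg (c := i.1 + (2 * k + 1) = M + 1), h3]
  · simp only [h1, h2, vecMat, sub_smul, Finset.sum_sub_distrib, ite_smul, one_smul, zero_smul]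
    by_cases hl : l = i <;> by_cases hl' : l = j.bar <;> simp [hl, hl', xv] <;>
      split_ifs <;> abel
  all_goals omega

/-- Relative to the action on the x's the matrix is transposed and the sign reversed, so the two
families span dual representations and ∑ x ⊗ y is invariant. -/
theorem lie_A_yv {k : ℕ} (hk : 4 * (k + 1) ≤ M) (i j l : Idx M k) :
    ⁅A M i j, yv M k l⁆ = ∑ m, vecMat M i j m l • yv M k m := by
  have := i.lower
  have := i.upper
  have := j.lower
  have := j.upper
  have := l.lower
  have := l.upper
  have h1 : (M + 1 - l.1 = i.1) = (l = i.bar) :=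
    propext ⟨fun h => Subtype.ext (by simp only [Idx.bar]; omega), fun h => by
      rw [h]; simp only [Idx.bar]; omega⟩
  have h2 : (j.1 + (M + 1 - l.1) = M + 1) = (l = j) :=
    propext ⟨fun h => Subtype.ext (by omega), fun h => by rw [h]; omega⟩
  have h3 : A M i.1 (M + 1 - (2 * k + 2)) = -yv M k i := by
    rw [yv, ← A_bar M] <;> first | omega | skip
    congr 1; omega
  have h4 : A M (2 * k + 2) j.1 = yv M k j.bar := by
    rw [yv]
    simp only [Idx.bar]
    congr 1; omega
  rw [yv, lie_A_A M, if_neg, if_neg (c := i.1 + (2 * k + 2) = M + 1), h3, h4]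
  · simp only [h1, h2, vecMat, sub_smul, Finset.sum_sub_distrib, ite_smul, one_smul, zero_smul]
    by_cases hl : l = j <;> by_cases hl' : l = i.bar <;> simp [hl, hl'] <;>
      split_ifs <;> abel
  all_goals omega

end SOChain

/-! ### The full chain is a twist -/

namespace SOChain

open Twist Classical2 PowerSeries

variable (M : ℕ)

/-- The range is symmetric under j ↦ M + 1 - j: a lower half, its mirror image and, for odd M, one
fixed index. The fixed index accounts for the bracketed terms of the invariants. -/
theorem sum_Idx {V : Type*} [AddCommMonoid V] {k : ℕ} (hk : 4 * (k + 1) ≤ M) (f : ℕ → V) :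
    ∑ j : Idx M k, f j = (if Odd M then f (M / 2 + 1) else 0) +
      ∑ l ∈ Finset.Icc (2 * k + 3) (M / 2), (f (M + 1 - l) + f l) := by
  rw [Finset.sum_coe_sort (Finset.Icc (2 * k + 3) (M - (2 * k + 2))) f, Finset.sum_add_distrib]
  have h1 : ∑ l ∈ Finset.Icc (2 * k + 3) (M / 2), f (M + 1 - l) =
      ∑ l ∈ Finset.Icc (M + 1 - M / 2) (M - (2 * k + 2)), f l := by
    refine Finset.sum_bij' (fun l _ => M + 1 - l) (fun l _ => M + 1 - l) ?_ ?_ ?_ ?_ ?_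
    · intro l hl; simp at hl ⊢; omega
    · intro l hl; simp at hl ⊢; omega
    · intro l hl; simp at hl ⊢; omega
    · intro l hl; simp at hl ⊢; omega
    · intro l hl; rfl
  -- This interval is the single middle index for odd M and empty for even M, so both parities are
  -- treated at once.
  have h2 : (if Odd M then f (M / 2 + 1) else 0) =
      ∑ l ∈ Finset.Icc (M / 2 + 1) (M - M / 2), f l := by
    split_ifs with h
    · obtain ⟨n, rfl⟩ := h
      rw [show 2 * n + 1 - (2 * n + 1) / 2 = (2 * n + 1) / 2 + 1 by omega, Finset.Icc_self,
        Finset.sum_singleton]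
    · have := Nat.not_odd_iff_even.mp h
      obtain ⟨n, rfl⟩ := this
      rw [Finset.Icc_eq_empty (by omega), Finset.sum_empty]
  have h3 : ∀ n m l : ℕ, n ≤ m → m ≤ l → ∑ j ∈ Finset.Ico n l, f j =
      ∑ j ∈ Finset.Ico n m, f j + ∑ j ∈ Finset.Ico m l, f j := fun n m l h h' =>
    (Finset.sum_Ico_consecutive f h h').symm
  have h4 : ∀ n m : ℕ, Finset.Icc n m = Finset.Ico n (m + 1) := fun n m => by
    ext; simp
  rw [h1, h2]
  simp only [h4]
  rw [h3 (2 * k + 3) (M / 2 + 1) _ (by omega) (by omega),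
    h3 (M / 2 + 1) (M - M / 2 + 1) _ (by omega) (by omega),
    show M + 1 - M / 2 = M - M / 2 + 1 by omega]
  abel

theorem tensorInv_eq {k : ℕ} (hk : 4 * (k + 1) ≤ M) :
    tensorInv M k = ∑ j : Idx M k, xv M k j ⊗ₜ[ℂ] yv M k j := by
  refine Eq.trans ?_ (sum_Idx M hk fun j =>
    A M (2 * k + 1) j ⊗ₜ[ℂ] A M (2 * k + 2) (M + 1 - j)).symm
  rw [tensorInv]
  congr 1
  · split_ifs with h
    · obtain ⟨n, hn⟩ := h
      rw [Esh, Esh, TensorProduct.neg_tmul, TensorProduct.tmul_neg, neg_neg,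
        show M + 1 - (M / 2 + 1) = M / 2 + 1 by omega]
    · rfl
  · refine Finset.sum_congr rfl fun l hl => ?_
    have := Finset.mem_Icc.mp hl
    simp only [Epl, Emi, TensorProduct.neg_tmul, TensorProduct.tmul_neg, neg_neg]
    rw [show M + 1 - (M + 1 - l) = l by omega]

theorem wedge_neg_neg {L : Type*} [LieRing L] [LieAlgebra ℂ L] (x y : L) :
    wedge (-x) (-y) = wedge x y := by
  simp only [wedge, TensorProduct.neg_tmul, TensorProduct.tmul_neg, neg_neg]

theorem wedgeInv_eq {k : ℕ} (hk : 4 * (k + 1) ≤ M) :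
    wedgeInv M k = ∑ j : Idx M k, wedge (xv M k j) (yv M k j) := by
  refine Eq.trans ?_ (sum_Idx M hk fun j =>
    wedge (A M (2 * k + 1) j) (A M (2 * k + 2) (M + 1 - j))).symm
  rw [wedgeInv]
  congr 1
  · split_ifs with h
    · obtain ⟨n, hn⟩ := h
      rw [Esh, Esh, wedge_neg_neg, show M + 1 - (M / 2 + 1) = M / 2 + 1 by omega]
    · rfl
  · refine Finset.sum_congr rfl fun l hl => ?_
    have := Finset.mem_Icc.mp hl
    simp only [Epl, Emi, wedge_neg_neg]
    rw [show M + 1 - (M + 1 - l) = l by omega]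

theorem inc_neg (x : so M) : inc M (-x) = -inc M x :=
  map_neg (UniversalEnvelopingAlgebra.ι ℂ : so M →ₗ⁅ℂ⁆ _) x

theorem inc_add (x y : so M) : inc M (x + y) = inc M x + inc M y :=
  map_add (UniversalEnvelopingAlgebra.ι ℂ : so M →ₗ⁅ℂ⁆ _) x y

theorem inc_smul (c : ℂ) (x : so M) : inc M (c • x) = c • inc M x :=
  map_smul (UniversalEnvelopingAlgebra.ι ℂ : so M →ₗ⁅ℂ⁆ _) c x

theorem inc_zero : inc M 0 = 0 :=
  map_zero (UniversalEnvelopingAlgebra.ι ℂ : so M →ₗ⁅ℂ⁆ _)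

theorem inc_lie (x y : so M) : inc M ⁅x, y⁆ = inc M x * inc M y - inc M y * inc M x := by
  rw [inc, LieHom.map_lie, LieRing.of_associative_ring_bracket]
  rfl

/-- The inclusion `so(M) → U(so(M))[[h]]`. -/
def incS (x : so M) : PowerSeries (U M) := C (inc M x)

variable {M}

theorem incS_mul (x y : so M) : incS M x * incS M y = incS M y * incS M x + incS M ⁅x, y⁆ := by
  rw [incS, incS, incS, ← map_mul, ← map_mul, ← map_add, inc_lie, add_sub_cancel]

theorem incS_add (x y : so M) : incS M (x + y) = incS M x + incS M y := by
  rw [incS, inc_add, map_add]; rfl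

theorem incS_neg (x : so M) : incS M (-x) = -incS M x := by
  rw [incS, inc_neg, map_neg]; rfl

theorem incS_zero : incS M 0 = 0 := by
  rw [incS, inc_zero, map_zero]

theorem incS_smul (c : ℂ) (x : so M) : incS M (c • x) = c • incS M x := by
  ext n
  rw [incS, incS, inc_smul, coeff_complex_smul, coeff_C, coeff_C]
  split_ifs
  · rfl
  · rw [smul_zero]

theorem incS_sum {ι : Type*} (s : Finset ι) (f : ι → so M) :
    incS M (∑ i ∈ s, f i) = ∑ i ∈ s, incS M (f i) := by
  classical
  induction s using Finset.induction_on with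
  | empty => simp [incS_zero]
  | insert a s ha ih => rw [Finset.sum_insert ha, Finset.sum_insert ha, incS_add, ih]

theorem commute_incS {x y : so M} (h : ⁅x, y⁆ = 0) : Commute (incS M x) (incS M y) := by
  rw [Commute, SemiconjBy, incS_mul, h, incS_zero, add_zero]

theorem ext_C {B D : Type*} [Ring B] [Algebra ℂ B] [Ring D] [Algebra ℂ D] (φ : B →ₐ[ℂ] D) (b : B) :
    ext φ (C b) = C (φ b) := by
  ext n
  rw [coeff_ext, coeff_C, coeff_C]
  split_ifs
  · rfl
  · exact map_zero φ

theorem isPrim_incS (x : so M) : IsPrim (incS M x) where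
  comul := by
    rw [tens, tens, map_one, map_one, one_mul, mul_one, incS, comulS, ext_C, ext_C, ext_C, ← map_add]
    exact congrArg _ (UEA.comul_ι (so M) x)
  counit := by
    rw [incS, counitS, ext_C]
    have : Bialgebra.counitAlgHom ℂ (U M) (inc M x) = 0 := UEA.counit_ι (so M) x
    rw [AlgHom.comp_apply, this, map_zero, map_zero]

variable {k : ℕ}

theorem linkRelations (hk : 4 * (k + 1) ≤ M) : LinkRelations (incS M (Hp M k)) (incS M (Hm M k))
    (incS M (Ep M k)) (incS M (Em M k)) (fun j => incS M (xv M k j)) (fun j => incS M (yv M k j))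
    Idx.bar where
  prim_Hp := isPrim_incS _
  prim_Hm := isPrim_incS _
  prim_E := isPrim_incS _
  prim_e := isPrim_incS _
  prim_x _ := isPrim_incS _
  prim_y _ := isPrim_incS _
  Hp_E := by rw [incS_mul, lie_Hp_Ep hk]
  Hp_x i := by rw [incS_mul, lie_Hp_xv hk, incS_smul]
  Hp_y i := by rw [incS_mul, lie_Hp_yv hk, incS_smul]
  Hp_e := commute_incS (lie_Hp_Em hk)
  Hp_Hm := commute_incS (lie_Hp_Hm hk)
  Hm_E := commute_incS (lie_Hm_Ep hk)
  Hm_e := by rw [incS_mul, lie_Hm_Em hk]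
  Hm_x i := by rw [incS_mul, lie_Hm_xv hk, incS_smul]
  Hm_y i := by rw [incS_mul, lie_Hm_yv hk, incS_smul]
  E_e := commute_incS (lie_Ep_Em hk)
  E_x i := commute_incS (lie_Ep_xv hk i)
  E_y i := commute_incS (lie_Ep_yv hk i)
  e_x i := commute_incS (lie_Em_xv hk i)
  x_x i j := commute_incS (lie_xv_xv hk i j)
  y_y i j := commute_incS (lie_yv_yv hk i j)
  x_y i j := by
    rw [incS_mul, lie_xv_yv hk]
    split_ifs
    · rfl
    · rw [incS_zero]
  y_e i := by rw [incS_mul, lie_yv_Em hk]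
  st_st := Idx.bar_bar

theorem monomial_smul_eq {B : Type*} [Ring B] [Algebra ℂ B] (c : ℂ) (b : B) :
    monomial 1 (c • b) = hScalar B c * C b := by
  ext n
  rw [hScalar, coeff_mul_C, coeff_monomial, coeff_monomial, Algebra.smul_def]
  split_ifs
  · rfl
  · rw [zero_mul]

/-- Each pair of distinct mirror indices occurs twice in the sum, with commuting factors, so the
overall 1/2 is absorbed. The self-mirror index occurs once and keeps it, hence E_a²/2. -/
theorem scalarInv_eq (hk : 4 * (k + 1) ≤ M) : C (scalarInv M k) =
    (1 / 2 : ℂ) • ∑ j : Idx M k, incS M (xv M k j) * incS M (xv M k j.bar) := by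
  have hc : ∀ (c : ℂ) (b : U M), C (c • b) = c • C b := fun c b => by
    ext n
    rw [coeff_complex_smul, coeff_C, coeff_C]
    split_ifs
    · rfl
    · rw [smul_zero]
  have h : ∑ j : Idx M k, incS M (xv M k j) * incS M (xv M k j.bar) = C (∑ j : Idx M k,
      (fun j : ℕ => inc M (A M (2 * k + 1) j) * inc M (A M (2 * k + 1) (M + 1 - j))) j) := by
    rw [map_sum]
    refine Finset.sum_congr rfl fun j _ => ?_
    rw [map_mul]
    rfl
  rw [h, ← hc, sum_Idx M hk fun j => inc M (A M (2 * k + 1) j) * inc M (A M (2 * k + 1) (M + 1 - j)),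
    scalarInv, smul_add, Finset.smul_sum]
  congr 2
  · split_ifs with h
    · obtain ⟨n, hn⟩ := h
      rw [Esh, inc_neg, neg_sq, sq, show M + 1 - (M / 2 + 1) = M / 2 + 1 by omega]
    · rw [smul_zero]
  · refine Finset.sum_congr rfl fun l hl => ?_
    have := Finset.mem_Icc.mp hl
    have hcomm : inc M (A M (2 * k + 1) l) * inc M (A M (2 * k + 1) (M + 1 - l)) =
        inc M (A M (2 * k + 1) (M + 1 - l)) * inc M (A M (2 * k + 1) l) := by
      rw [← sub_eq_zero, ← inc_lie]
      have := lie_xv_xv hk ⟨l, Finset.mem_Icc.mpr (by omega)⟩ ⟨M + 1 - l, Finset.mem_Icc.mpr (by omega)⟩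
      rw [show ⁅A M (2 * k + 1) l, A M (2 * k + 1) (M + 1 - l)⁆ = 0 from this, inc_zero]
    rw [show M + 1 - (M + 1 - l) = l by omega, hcomm, ← two_smul ℂ, smul_smul, Epl, Emi, inc_neg,
      inc_neg, neg_mul_neg]
    norm_num

theorem G_eq_linkG (hk : 4 * (k + 1) ≤ M) (η : ℂ) : G M k η =
    linkG η (incS M (Em M k)) (fun j => incS M (xv M k j)) Idx.bar := by
  rw [G, monomial_smul_eq, scalarInv_eq hk]
  rfl

theorem sigma_eq (η : ℂ) : sigma M k η = logS (hScalar (U M) η * incS M (Ep M k)) := by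
  rw [sigma, monomial_smul_eq]; rfl

theorem link_eq_genLink (hk : 4 * (k + 1) ≤ M) (η ξ : ℂ) : link M k η ξ =
    genLink η ξ (incS M (Hp M k)) (incS M (Hm M k)) (incS M (Ep M k)) (incS M (Em M k))
      (fun j => incS M (xv M k j)) (fun j => incS M (yv M k j)) Idx.bar := by
  rw [link, genLink, mul_assoc, sigmaG, G_eq_linkG hk, sigma_eq]
  congr 2
  rw [extExponent, monomial_smul_eq, tensorInv_eq M hk, map_sum, map_sum, Finset.mul_sum,
    Finset.sum_mul]
  congr 1
  refine Finset.sum_congr rfl fun j _ => ?_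
  have : C (toU (xv M k j ⊗ₜ[ℂ] yv M k j)) = tens (incS M (xv M k j)) (incS M (yv M k j)) := by
    rw [tens, incS, incS, ext_C, ext_C, ← map_mul]
    congr 1
    simp [toU, inc]
  rw [this, mul_assoc, tens_mul_tens, mul_one, tens_hScalar_right]
  rfl

/-- A link commutes with the coproducts of the elements of the next subalgebra `so(M-4k-4)`. -/
theorem commute_link_comulS (hk : 4 * (k + 1) ≤ M) (η ξ : ℂ) (i j : Idx M k) :
    Commute (link M k η ξ) (comulS (incS M (A M i j))) := by
  rw [link_eq_genLink hk]
  refine commute_genLink_comulS η ξ (isPrim_incS _)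
    (commute_incS (lie_A_Hp hk i.lower i.upper j.lower j.upper))
    (commute_incS (lie_A_Hm hk i.lower i.upper j.lower j.upper))
    (commute_incS (lie_A_Ep hk i.lower i.upper j.lower j.upper))
    (commute_incS (lie_A_Em hk i.lower i.upper j.lower j.upper)) (vecMat M i j) (fun l => ?_)
    (fun l => ?_) Idx.bar_bar (vecMat_bar_bar M i j)
  · rw [incS_mul, lie_A_xv M hk, incS_neg, incS_sum, sub_eq_add_neg]
    simp only [incS_smul]
  · rw [incS_mul, lie_A_yv M hk, incS_sum]
    simp only [incS_smul]

/-- The index ranges are nested, so elements of the innermost subalgebra commute with every earlier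
link as well. -/
theorem commute_chain_comulS (η ξ : ℕ → ℂ) (p : ℕ) (hp : 4 * (p + 1) ≤ M) (i j : Idx M p) :
    Commute (chain M η ξ p) (comulS (incS M (A M i j))) := by
  induction p with
  | zero => exact commute_link_comulS hp _ _ i j
  | succ p ih =>
    have h := fun i : Idx M (p + 1) => i.lower
    have h' := fun i : Idx M (p + 1) => i.upper
    rw [chain]
    exact (commute_link_comulS hp _ _ i j).mul_left (ih (by omega)
      ⟨i, Finset.mem_Icc.mpr (by have := h i; have := h' i; omega)⟩
      ⟨j, Finset.mem_Icc.mpr (by have := h j; have := h' j; omega)⟩)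

theorem isTwist_link (hk : 4 * (k + 1) ≤ M) (η ξ : ℂ) : IsTwist (link M k η ξ) := by
  rw [link_eq_genLink hk]
  exact (linkRelations hk).isTwist_genLink η ξ

theorem isTwist_chain (η ξ : ℕ → ℂ) (p : ℕ) (hp : 4 * (p + 1) ≤ M) : IsTwist (chain M η ξ p) := by
  induction p with
  | zero => exact isTwist_link hp _ _
  | succ p ih =>
    -- All generators of link p + 1 are linear combinations of A_{i,j} with indices in this range,
    -- so the chain up to p commutes with their coproducts.
    have hA : ∀ i j, 2 * p + 3 ≤ i → i ≤ M - (2 * p + 2) → 2 * p + 3 ≤ j → j ≤ M - (2 * p + 2) →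
        Commute (chain M η ξ p) (comulS (incS M (A M i j))) := fun i j hi hi' hj hj' =>
      commute_chain_comulS η ξ p (by omega) ⟨i, Finset.mem_Icc.mpr ⟨hi, hi'⟩⟩
        ⟨j, Finset.mem_Icc.mpr ⟨hj, hj'⟩⟩
    have hneg : ∀ {x : so M}, Commute (chain M η ξ p) (comulS (incS M x)) →
        Commute (chain M η ξ p) (comulS (incS M (-x))) := fun {x} h => by
      rw [incS_neg, comulS, map_neg]
      exact h.neg_right
    have hsmul : ∀ {x : so M} (c : ℂ), Commute (chain M η ξ p) (comulS (incS M x)) →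
        Commute (chain M η ξ p) (comulS (incS M (c • x))) := fun {x} c h => by
      rw [incS_smul, comulS, ext_smul]
      exact h.smul_right c
    have hadd : ∀ {x y : so M}, Commute (chain M η ξ p) (comulS (incS M x)) →
        Commute (chain M η ξ p) (comulS (incS M y)) →
        Commute (chain M η ξ p) (comulS (incS M (x + y))) := fun {x y} h h' => by
      rw [incS_add, comulS, map_add]
      exact h.add_right h'
    have hH : ∀ i, 2 * p + 3 ≤ i → i ≤ M - (2 * p + 2) →
        Commute (chain M η ξ p) (comulS (incS M (H M i))) := fun i hi hi' =>
      hsmul _ (hA i i hi hi' hi hi')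
    rw [chain, link_eq_genLink hp]
    refine (ih (by omega)).genLink_mul _ _ ((linkRelations hp).isTwist_genLink _ _) ?_ ?_ ?_ ?_ ?_ ?_
    · exact hadd (hH _ (by omega) (by omega)) (hH _ (by omega) (by omega))
    · rw [Hm, sub_eq_add_neg]
      exact hadd (hH _ (by omega) (by omega)) (hneg (hH _ (by omega) (by omega)))
    · exact hneg (hA _ _ (by omega) (by omega) (by omega) (by omega))
    · exact hneg (hA _ _ (by omega) (by omega) (by omega) (by omega))
    · intro j
      have := j.lower
      have := j.upper
      exact hA _ _ (by omega) (by omega) (by omega) (by omega)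
    · intro j
      have := j.lower
      have := j.upper
      exact hA _ _ (by omega) (by omega) (by omega) (by omega)

theorem coeff_zero_link (hk : 4 * (k + 1) ≤ M) (η ξ : ℂ) : coeff 0 (link M k η ξ) = 1 := by
  rw [link_eq_genLink hk, coeff_zero_genLink]

theorem coeff_zero_chain (η ξ : ℕ → ℂ) (p : ℕ) (hp : 4 * (p + 1) ≤ M) :
    coeff 0 (chain M η ξ p) = 1 := by
  induction p with
  | zero => exact coeff_zero_link hp _ _
  | succ p ih => rw [chain, coeff_zero_mul, coeff_zero_link hp, ih (by omega), one_mul]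

theorem coeff_one_link_sub_flip (hk : 4 * (k + 1) ≤ M) (η ξ : ℂ) :
    coeff 1 (link M k η ξ) - Twist.flip (coeff 1 (link M k η ξ)) =
      toU (η • (wedge (Hp M k) (Ep M k) + ξ • wedge (Hm M k) (Em M k) + wedgeInv M k)) := by
  have h0 : ∀ x : so M, coeff 0 (incS M x) = inc M x := fun x => by rw [incS, coeff_zero_C]
  have hw : ∀ x y : so M, toU (wedge x y) = inc M x ⊗ₜ[ℂ] inc M y - inc M y ⊗ₜ[ℂ] inc M x :=
    fun x y => by
      rw [wedge, map_sub]
      rfl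
  rw [link_eq_genLink hk, coeff_one_genLink, wedgeInv_eq M hk]
  simp only [h0, map_smul, map_add, map_sum, hw, flip_tmul, Finset.sum_sub_distrib, smul_sub,
    smul_add]
  abel

theorem coeff_one_chain_sub_flip (η ξ : ℕ → ℂ) (p : ℕ) (hp : 4 * (p + 1) ≤ M) :
    coeff 1 (chain M η ξ p) - Twist.flip (coeff 1 (chain M η ξ p)) = toU (rMat M η ξ p) := by
  induction p with
  | zero =>
    rw [rMat, Finset.sum_range_one, ← coeff_one_link_sub_flip hp]
    rfl
  | succ p ih =>
    rw [rMat, Finset.sum_range_succ, map_add, ← coeff_one_link_sub_flip hp, chain,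
      coeff_one_mul_of_coeff_zero (coeff_zero_link hp _ _) (coeff_zero_chain η ξ p (by omega)),
      map_add, show ∑ k ∈ Finset.range (p + 1), _ = rMat M η ξ p from rfl, ← ih (by omega)]
    abel

theorem comm_rMat (η ξ : ℕ → ℂ) (p : ℕ) (hp : 4 * (p + 1) ≤ M) :
    TensorProduct.comm ℂ (so M) (so M) (rMat M η ξ p) = -rMat M η ξ p := by
  have hw : ∀ x y : so M, TensorProduct.comm ℂ (so M) (so M) (wedge x y) = -wedge x y := fun x y => by
    rw [wedge, map_sub, TensorProduct.comm_tmul, TensorProduct.comm_tmul, neg_sub]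
  rw [rMat, map_sum, ← Finset.sum_neg_distrib]
  refine Finset.sum_congr rfl fun k hk => ?_
  have := Finset.mem_range.mp hk
  rw [wedgeInv_eq M (by omega), map_smul, map_add, map_add, map_smul, map_sum, hw, hw]
  simp only [hw, Finset.sum_neg_distrib]
  module

/-- No direct computation of the Yang–Baxter expression is needed: the equation is inherited from
the twist, whose universal R-matrix has first-order coefficient -r. -/
theorem isRMatrix_rMat (η ξ : ℕ → ℂ) (p : ℕ) (hp : 4 * (p + 1) ≤ M) :
    IsRMatrix (rMat M η ξ p) where
  skew := comm_rMat η ξ p hp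
  cybe := (isTwist_chain η ξ p hp).classicalYangBaxter comul_cocomm (coeff_zero_chain η ξ p hp) (by
    rw [coeff_one_univR (isTwist_chain η ξ p hp).isUnit (coeff_zero_chain η ξ p hp),
      ← coeff_one_chain_sub_flip η ξ p hp, neg_sub])

theorem quantizes_chain (η ξ : ℕ → ℂ) (p : ℕ) (hp : 4 * (p + 1) ≤ M) :
    Quantizes (chain M η ξ p) (rMat M η ξ p) :=
  quantizes_of_coeff_one (isTwist_chain η ξ p hp).isUnit (coeff_zero_chain η ξ p hp)
    (coeff_one_chain_sub_flip η ξ p hp).symm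

end SOChain

/-! ### The carrier of the classical `r`-matrix -/

namespace Classical2

section Carrier

variable {L : Type*} [LieRing L] [LieAlgebra ℂ L]

theorem sharp_tmul (a b : L) (φ : Module.Dual ℂ L) : sharp (a ⊗ₜ[ℂ] b) φ = φ a • b := by
  simp [sharp]

theorem sharp_add (r s : L ⊗[ℂ] L) (φ : Module.Dual ℂ L) :
    sharp (r + s) φ = sharp r φ + sharp s φ := by
  simp [sharp]

theorem sharp_smul (c : ℂ) (r : L ⊗[ℂ] L) (φ : Module.Dual ℂ L) :
    sharp (c • r) φ = c • sharp r φ := by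
  simp [sharp]

theorem sharp_neg (r : L ⊗[ℂ] L) (φ : Module.Dual ℂ L) : sharp (-r) φ = -sharp r φ := by
  rw [← neg_one_smul ℂ, sharp_smul, neg_one_smul]

theorem sharp_sum {ι : Type*} (s : Finset ι) (r : ι → L ⊗[ℂ] L) (φ : Module.Dual ℂ L) :
    sharp (∑ i ∈ s, r i) φ = ∑ i ∈ s, sharp (r i) φ := by
  simp [sharp]

theorem sharp_wedge (a b : L) (φ : Module.Dual ℂ L) :
    sharp (wedge a b) φ = φ a • b - φ b • a := by
  rw [wedge, sub_eq_add_neg, sharp_add, sharp_neg, sharp_tmul, sharp_tmul, sub_eq_add_neg]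

/-- `y ↦ φ [y, z]`. -/
def bracketDual (φ : Module.Dual ℂ L) (z : L) : Module.Dual ℂ L where
  toFun y := φ ⁅y, z⁆
  map_add' x y := by rw [add_lie, map_add]
  map_smul' c x := by rw [smul_lie, map_smul]; rfl

theorem commutator_add_left {B : Type*} [Ring B] (x y z : B) :
    commutator (x + y) z = commutator x z + commutator y z := by
  simp only [commutator]; noncomm_ring

theorem commutator_add_right {B : Type*} [Ring B] (x y z : B) :
    commutator x (y + z) = commutator x y + commutator x z := by
  simp only [commutator]; noncomm_ring

theorem commutator_zero_left {B : Type*} [Ring B] (x : B) : commutator 0 x = 0 := by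
  simp [commutator]

theorem commutator_zero_right {B : Type*} [Ring B] (x : B) : commutator x 0 = 0 := by
  simp [commutator]

variable (ρ : UniversalEnvelopingAlgebra ℂ L →ₗ[ℂ] L) (φ ψ : Module.Dual ℂ L)

/-- `a ⊗ b ⊗ c ↦ φ (ρ b) ψ (ρ c) ρ a`. -/
def contract : UniversalEnvelopingAlgebra ℂ L ⊗[ℂ] (UniversalEnvelopingAlgebra ℂ L ⊗[ℂ]
    UniversalEnvelopingAlgebra ℂ L) →ₗ[ℂ] L :=
  (TensorProduct.rid ℂ L).toLinearMap ∘ₗ TensorProduct.map ρ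
    ((TensorProduct.lid ℂ ℂ).toLinearMap ∘ₗ TensorProduct.map (φ ∘ₗ ρ) (ψ ∘ₗ ρ))

theorem contract_tmul (a b c : UniversalEnvelopingAlgebra ℂ L) :
    contract ρ φ ψ (a ⊗ₜ (b ⊗ₜ c)) = (φ (ρ b) * ψ (ρ c)) • ρ a := by
  simp [contract]

theorem toU_tmul (a b : L) : toU (a ⊗ₜ[ℂ] b) =
    UniversalEnvelopingAlgebra.ι ℂ a ⊗ₜ[ℂ] UniversalEnvelopingAlgebra.ι ℂ b := rfl

variable {ρ}

/-- The retraction ρ is only linear, but a commutator in U of elements of L is again the image of an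
element of L, and there ρ is known. -/
theorem retraction_commutator (hρ : ∀ x, ρ (UniversalEnvelopingAlgebra.ι ℂ x) = x) (a b : L) :
    ρ (UniversalEnvelopingAlgebra.ι ℂ a * UniversalEnvelopingAlgebra.ι ℂ b) =
      ⁅a, b⁆ + ρ (UniversalEnvelopingAlgebra.ι ℂ b * UniversalEnvelopingAlgebra.ι ℂ a) := by
  have := hρ ⁅a, b⁆
  rw [LieHom.map_lie, LieRing.of_associative_ring_bracket, map_sub] at this
  rw [← this, sub_add_cancel]

/-- `contract` keeps the first leg while `sharp` keeps the second; this is the reason for the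
transpositions. For skew r they become signs. -/
theorem contract_commutator_12_13 (hρ : ∀ x, ρ (UniversalEnvelopingAlgebra.ι ℂ x) = x)
    (r s : L ⊗[ℂ] L) : contract ρ φ ψ (commutator (Twist.leg12 (toU r)) (Twist.leg13 (toU s))) =
      ⁅sharp (TensorProduct.comm ℂ L L r) φ, sharp (TensorProduct.comm ℂ L L s) ψ⁆ := by
  induction r using TensorProduct.induction_on with
  | zero => simp [commutator_zero_left, sharp]
  | add r r' h h' =>
    rw [map_add, map_add, map_add, commutator_add_left, map_add, h, h', sharp_add, add_lie]
  | tmul a b =>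
    induction s using TensorProduct.induction_on with
    | zero => simp [commutator_zero_right, sharp]
    | add s s' h h' =>
      rw [map_add, map_add, map_add, commutator_add_right, map_add, h, h', sharp_add, lie_add]
    | tmul c d =>
      rw [toU_tmul, toU_tmul, Twist.leg12_tmul, Twist.leg13_tmul, commutator, map_sub,
        Algebra.TensorProduct.tmul_mul_tmul, Algebra.TensorProduct.tmul_mul_tmul,
        Algebra.TensorProduct.tmul_mul_tmul, Algebra.TensorProduct.tmul_mul_tmul, one_mul, mul_one,
        one_mul, mul_one, contract_tmul, contract_tmul, hρ, hρ, retraction_commutator hρ a c,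
        TensorProduct.comm_tmul, TensorProduct.comm_tmul, sharp_tmul, sharp_tmul, smul_lie, lie_smul]
      module

theorem contract_commutator_12_23 (hρ : ∀ x, ρ (UniversalEnvelopingAlgebra.ι ℂ x) = x)
    (r s : L ⊗[ℂ] L) : contract ρ φ ψ (commutator (Twist.leg12 (toU r)) (Twist.leg23 (toU s))) =
      sharp (TensorProduct.comm ℂ L L r)
        (bracketDual φ (sharp (TensorProduct.comm ℂ L L s) ψ)) := by
  induction r using TensorProduct.induction_on with
  | zero => simp [commutator_zero_left, sharp]
  | add r r' h h' =>
    rw [map_add, map_add, map_add, commutator_add_left, map_add, h, h', sharp_add]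
  | tmul a b =>
    induction s using TensorProduct.induction_on with
    | zero => simp [commutator_zero_right, sharp, bracketDual]
    | add s s' h h' =>
      rw [map_add, map_add, map_add, commutator_add_right, map_add, h, h', sharp_add,
        TensorProduct.comm_tmul, sharp_tmul, sharp_tmul, sharp_tmul, ← add_smul]
      simp [bracketDual]
    | tmul c d =>
      rw [toU_tmul, toU_tmul, Twist.leg12_tmul, Twist.leg23_apply, commutator, map_sub,
        Algebra.TensorProduct.tmul_mul_tmul, Algebra.TensorProduct.tmul_mul_tmul,
        Algebra.TensorProduct.tmul_mul_tmul, Algebra.TensorProduct.tmul_mul_tmul, one_mul, mul_one,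
        one_mul, mul_one, contract_tmul, contract_tmul, hρ, hρ, retraction_commutator hρ b c,
        TensorProduct.comm_tmul, TensorProduct.comm_tmul, sharp_tmul, sharp_tmul]
      simp only [bracketDual, LinearMap.coe_mk, AddHom.coe_mk, map_add, lie_smul, map_smul,
        smul_eq_mul]
      module

theorem contract_commutator_13_23 (hρ : ∀ x, ρ (UniversalEnvelopingAlgebra.ι ℂ x) = x)
    (r s : L ⊗[ℂ] L) : contract ρ φ ψ (commutator (Twist.leg13 (toU r)) (Twist.leg23 (toU s))) =
      sharp (TensorProduct.comm ℂ L L r) (bracketDual ψ (sharp s φ)) := by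
  induction r using TensorProduct.induction_on with
  | zero => simp [commutator_zero_left, sharp]
  | add r r' h h' =>
    rw [map_add, map_add, map_add, commutator_add_left, map_add, h, h', sharp_add]
  | tmul a b =>
    induction s using TensorProduct.induction_on with
    | zero => simp [commutator_zero_right, sharp, bracketDual]
    | add s s' h h' =>
      rw [map_add, map_add, commutator_add_right, map_add, h, h', sharp_add,
        TensorProduct.comm_tmul, sharp_tmul, sharp_tmul, sharp_tmul, ← add_smul]
      simp [bracketDual]
    | tmul c d =>
      rw [toU_tmul, toU_tmul, Twist.leg13_tmul, Twist.leg23_apply, commutator, map_sub,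
        Algebra.TensorProduct.tmul_mul_tmul, Algebra.TensorProduct.tmul_mul_tmul,
        Algebra.TensorProduct.tmul_mul_tmul, Algebra.TensorProduct.tmul_mul_tmul, one_mul, mul_one,
        one_mul, mul_one, contract_tmul, contract_tmul, hρ, hρ, retraction_commutator hρ b d,
        TensorProduct.comm_tmul, sharp_tmul, sharp_tmul]
      simp only [bracketDual, LinearMap.coe_mk, AddHom.coe_mk, map_add, lie_smul, map_smul,
        smul_eq_mul]
      module

/-- The carrier of a classical `r`-matrix is a Lie subalgebra. -/
def carrier {r : L ⊗[ℂ] L} (hr : IsRMatrix r)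
    (hι : Function.Injective (UniversalEnvelopingAlgebra.ι ℂ : L →ₗ⁅ℂ⁆ _)) : LieSubalgebra ℂ L where
  toSubmodule := LinearMap.range (sharp r)
  lie_mem' := by
    rintro _ _ ⟨φ, rfl⟩ ⟨ψ, rfl⟩
    obtain ⟨ρ, hρ⟩ := LinearMap.exists_leftInverse_of_injective
      (UniversalEnvelopingAlgebra.ι ℂ : L →ₗ⁅ℂ⁆ _).toLinearMap (LinearMap.ker_eq_bot.mpr hι)
    have hρ' : ∀ x, ρ (UniversalEnvelopingAlgebra.ι ℂ x) = x := fun x => LinearMap.congr_fun hρ x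
    -- Contracting the last two legs expresses the bracket of two values of `sharp r` through two
    -- further values of `sharp r`.
    have h := congrArg (contract ρ φ ψ) hr.cybe
    rw [map_add, map_add, map_zero, contract_commutator_12_13 φ ψ hρ',
      contract_commutator_12_23 φ ψ hρ', contract_commutator_13_23 φ ψ hρ', hr.skew] at h
    simp only [sharp_neg, lie_neg, neg_lie, neg_neg] at h
    rw [add_assoc] at h
    rw [show ⁅sharp r φ, sharp r ψ⁆ = _ from eq_neg_of_add_eq_zero_left h, neg_add, neg_neg, neg_neg]
    exact Submodule.add_mem _ ⟨_, rfl⟩ ⟨_, rfl⟩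

theorem mem_carrier {r : L ⊗[ℂ] L} (hr : IsRMatrix r)
    (hι : Function.Injective (UniversalEnvelopingAlgebra.ι ℂ : L →ₗ⁅ℂ⁆ _)) (x : L) :
    x ∈ carrier hr hι ↔ ∃ φ, sharp r φ = x := Iff.rfl

end Carrier

/-! ### Inverting a bivector in Darboux form -/

section Darboux

variable {L : Type*} [LieRing L] [LieAlgebra ℂ L] {J : Type*}

/-- `p`, `q` is a Darboux basis for the form `f [x, y]` on their span (where `c` does not vanish). -/
structure IsDarboux [DecidableEq J] (f : Module.Dual ℂ L) (c : J → ℂ) (p q : J → L) : Prop where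
  p_p : ∀ i j, f ⁅p i, p j⁆ = 0
  q_q : ∀ i j, f ⁅q i, q j⁆ = 0
  p_q : ∀ i j, f ⁅p i, q j⁆ = if i = j then (c i)⁻¹ else 0

variable {f : Module.Dual ℂ L} {c : J → ℂ} {p q : J → L}

theorem sharp_sum_wedge [Fintype J] (φ : Module.Dual ℂ L) : sharp (∑ j, c j • wedge (p j) (q j)) φ =
    ∑ j, c j • (φ (p j) • q j - φ (q j) • p j) := by
  rw [sharp_sum]
  simp only [sharp_smul, sharp_wedge]

namespace IsDarboux

variable [DecidableEq J]

theorem q_p (h : IsDarboux f c p q) (i j : J) : f ⁅q i, p j⁆ = if i = j then -(c i)⁻¹ else 0 := by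
  rw [← lie_skew, map_neg, h.p_q]
  by_cases hij : i = j
  · rw [if_pos hij.symm, if_pos hij, hij]
  · rw [if_neg (Ne.symm hij), if_neg hij, neg_zero]

variable [Fintype J]

/-- The factor `c i` is kept on both sides because the unweighted identity may fail when `c i` = 0,
where the pairing of p_i with q_i is 0. Such an index does not contribute to r, so the weighted form
is all that is needed. -/
theorem p_sharp (h : IsDarboux f c p q) (i : J) (φ : Module.Dual ℂ L) :
    c i * f ⁅p i, sharp (∑ j, c j • wedge (p j) (q j)) φ⁆ = c i * φ (p i) := by
  rw [sharp_sum_wedge, lie_sum, map_sum]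
  simp only [lie_smul, lie_sub, map_smul, map_sub, h.p_p, h.p_q, smul_eq_mul, mul_zero, sub_zero]
  rw [Finset.sum_eq_single i (fun j _ hj => by rw [if_neg (Ne.symm hj)]; ring) (by simp), if_pos rfl]
  by_cases hc : c i = 0
  · simp [hc]
  · field_simp

theorem q_sharp (h : IsDarboux f c p q) (i : J) (φ : Module.Dual ℂ L) :
    c i * f ⁅q i, sharp (∑ j, c j • wedge (p j) (q j)) φ⁆ = c i * φ (q i) := by
  rw [sharp_sum_wedge, lie_sum, map_sum]
  simp only [lie_smul, lie_sub, map_smul, map_sub, h.q_q, h.q_p, smul_eq_mul, mul_zero, zero_sub]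
  rw [Finset.sum_eq_single i (fun j _ hj => by rw [if_neg (Ne.symm hj)]; ring) (by simp), if_pos rfl]
  by_cases hc : c i = 0
  · simp [hc]
  · field_simp

theorem inverse (h : IsDarboux f c p q) (φ ψ : Module.Dual ℂ L) :
    f ⁅sharp (∑ j, c j • wedge (p j) (q j)) ψ, sharp (∑ j, c j • wedge (p j) (q j)) φ⁆ =
      φ (sharp (∑ j, c j • wedge (p j) (q j)) ψ) := by
  set x := sharp (∑ j, c j • wedge (p j) (q j)) φ with hx
  rw [sharp_sum_wedge, sum_lie, map_sum, map_sum]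
  refine Finset.sum_congr rfl fun i _ => ?_
  rw [smul_lie, sub_lie, smul_lie, smul_lie]
  simp only [map_smul, map_sub, smul_eq_mul]
  linear_combination ψ (p i) * h.q_sharp i φ - ψ (q i) * h.p_sharp i φ

/-- The functional y ↦ f [y, q_i] vanishes on all q_j and on all p_j except p_i, where it equals 1 /
c_i; hence r returns q_i. -/
theorem q_mem (h : IsDarboux f c p q) {i : J} (hi : c i ≠ 0) :
    sharp (∑ j, c j • wedge (p j) (q j)) (bracketDual f (q i)) = q i := by
  rw [sharp_sum_wedge, Finset.sum_eq_single i]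
  · simp [bracketDual, h.p_q, hi]
  · intro j _ hj
    simp [bracketDual, h.p_q, h.q_q, hj]
  · simp

theorem p_mem (h : IsDarboux f c p q) {i : J} (hi : c i ≠ 0) :
    sharp (∑ j, c j • wedge (p j) (q j)) (bracketDual f (p i)) = p i := by
  rw [sharp_sum_wedge, Finset.sum_eq_single i]
  · simp [bracketDual, h.q_p, hi]
  · intro j _ hj
    simp [bracketDual, h.p_p, h.q_p, hj]
  · simp

theorem corresponds (h : IsDarboux f c p q) {r : L ⊗[ℂ] L} (hr : IsRMatrix r)
    (hrs : r = ∑ j, c j • wedge (p j) (q j))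
    (hι : Function.Injective (UniversalEnvelopingAlgebra.ι ℂ : L →ₗ⁅ℂ⁆ _)) :
    Corresponds r f (carrier hr hι) := by
  have hinv : ∀ φ : Module.Dual ℂ L, ∀ x ∈ carrier hr hι, f ⁅x, sharp r φ⁆ = φ x := by
    rintro φ _ ⟨ψ, rfl⟩
    rw [hrs]
    exact h.inverse φ ψ
  refine ⟨rfl, fun x hx hx0 => ?_, hinv⟩
  -- Nondegeneracy follows from the inversion formula: an element orthogonal to the carrier is
  -- annihilated by every functional.
  by_contra hne
  obtain ⟨φ, hφ⟩ : ∃ φ : Module.Dual ℂ L, φ x ≠ 0 := by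
    by_contra! hcon
    exact hne ((Module.forall_dual_apply_eq_zero_iff ℂ x).mp hcon)
  exact hφ (by rw [← hinv φ x hx, hx0 _ ⟨φ, rfl⟩])

end IsDarboux

end Darboux

end Classical2


/-! ### The Frobenius form of the full chain -/

namespace SOChain

open Twist Classical2

variable (M : ℕ)

/-- The defining matrix representation lifts to U and recovers each element of so(M), so the
Poincaré–Birkhoff–Witt theorem is not needed. -/
theorem ι_injective :
    Function.Injective (UniversalEnvelopingAlgebra.ι ℂ : so M →ₗ⁅ℂ⁆ _) := by
  intro x y h
  have := congrArg (UniversalEnvelopingAlgebra.lift ℂ (so M).incl) h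
  rw [UniversalEnvelopingAlgebra.lift_ι_apply, UniversalEnvelopingAlgebra.lift_ι_apply] at this
  exact Subtype.ext this

theorem trace_unit_transpose_mul {i j k l : ℕ} (hi : 1 ≤ i) (hiM : i ≤ M) (hj : 1 ≤ j)
    (hjM : j ≤ M) : ((unit M i j).transpose * unit M k l).trace =
      if i = k ∧ j = l then 1 else 0 := by
  have h : (unit M i j).transpose = unit M j i := by
    ext a b
    simp only [unit, Matrix.transpose_apply, Matrix.of_apply, and_comm]
  rw [h, unit_mul_unit M hi hiM]
  by_cases hik : i = k
  · rw [if_pos hik, Matrix.trace, Finset.sum_eq_single ⟨j - 1, by omega⟩]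
    · simp only [unit, Matrix.diag_apply, Matrix.of_apply, show j - 1 + 1 = j by omega, hik, true_and]
    · intro c _ hc
      have : ¬ c.1 + 1 = j := fun h => hc (by ext; simp; omega)
      simp [unit, this]
    · simp
  · rw [if_neg hik, Matrix.trace_zero, if_neg (fun h => hik h.1)]

theorem dualElt_neg (e x : so M) : dualElt M (-e) x = -dualElt M e x := by
  simp [dualElt]

theorem dualElt_A_A {i j k l : ℕ} (hi : 1 ≤ i) (hiM : i ≤ M) (hj : 1 ≤ j) (hjM : j ≤ M)
    (hk : 1 ≤ k) (hkM : k ≤ M) (hlM : l ≤ M) : dualElt M (A M i j) (A M k l) =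
      (if i = k ∧ j = l then 1 else 0) - if i + l = M + 1 ∧ j + k = M + 1 then 1 else 0 := by
  change (1 / 2 : ℂ) * Matrix.trace ((A M i j : Matrix (Fin M) (Fin M) ℂ).transpose *
    (A M k l : Matrix (Fin M) (Fin M) ℂ)) = _
  rw [coe_A, coe_A, Matrix.transpose_sub, sub_mul, mul_sub, mul_sub, Matrix.trace_sub,
    Matrix.trace_sub, Matrix.trace_sub, trace_unit_transpose_mul M hi hiM hj hjM,
    trace_unit_transpose_mul M hi hiM hj hjM,
    trace_unit_transpose_mul M (by omega) (by omega) (by omega) (by omega),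
    trace_unit_transpose_mul M (by omega) (by omega) (by omega) (by omega)]
  simp only [show (i = M + 1 - l ∧ j = M + 1 - k) = (i + l = M + 1 ∧ j + k = M + 1) from
      propext (by omega),
    show (M + 1 - j = k ∧ M + 1 - i = l) = (i + l = M + 1 ∧ j + k = M + 1) from propext (by omega),
    show (M + 1 - j = M + 1 - l ∧ M + 1 - i = M + 1 - k) = (i = k ∧ j = l) from propext (by omega)]
  ring

section Omega

variable {M} {p : ℕ} (γ δ : ℕ → ℂ)

theorem omegaFun_apply (x : so M) : omegaFun M γ δ p x =
    ∑ k ∈ Finset.range (p + 1), (γ k * dualElt M (Ep M k) x - δ k * dualElt M (Em M k) x) := by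
  simp [omegaFun]

theorem dualElt_Ep_A {k i j : ℕ} (hk : 4 * (k + 1) ≤ M) (hi : 1 ≤ i) (hiM : i ≤ M)
    (hjM : j ≤ M) : dualElt M (Ep M k) (A M i j) =
      (if 2 * k + 2 = i ∧ j + (2 * k + 1) = M + 1 then 1 else 0) -
        if 2 * k + 1 = i ∧ j + (2 * k + 2) = M + 1 then 1 else 0 := by
  rw [Ep, Epl, dualElt_neg, dualElt_A_A M (by omega) (by omega) (by omega) (by omega) hi hiM hjM,
    neg_sub]
  congr 2 <;> exact propext (by omega)

theorem dualElt_Em_A {k i j : ℕ} (hk : 4 * (k + 1) ≤ M) (hi : 1 ≤ i) (hiM : i ≤ M)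
    (hjM : j ≤ M) : dualElt M (Em M k) (A M i j) =
      (if 2 * k + 1 + j = M + 1 ∧ 2 * k + 2 + i = M + 1 then 1 else 0) -
        if 2 * k + 1 = i ∧ 2 * k + 2 = j then 1 else 0 := by
  rw [Em, Emi, dualElt_neg, dualElt_A_A M (by omega) (by omega) (by omega) (by omega) hi hiM hjM,
    neg_sub]

variable {k : ℕ}

theorem omegaFun_Ep (hp : 4 * (p + 1) ≤ M) (hk : k ≤ p) :
    omegaFun M γ δ p (Ep M k) = γ k := by
  rw [Ep, Epl, map_neg, omegaFun_apply, Finset.sum_eq_single k]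
  · rw [dualElt_Ep_A, dualElt_Em_A, if_neg, if_pos, if_neg, if_neg] <;> first | omega | simp
  · intro l hl hlk
    have := Finset.mem_range.mp hl
    rw [dualElt_Ep_A, dualElt_Em_A, if_neg, if_neg, if_neg, if_neg] <;> first | omega | simp
  · intro h
    exact absurd (Finset.mem_range.mpr (by omega)) h

theorem omegaFun_Em (hp : 4 * (p + 1) ≤ M) (hk : k ≤ p) :
    omegaFun M γ δ p (Em M k) = -δ k := by
  rw [Em, Emi, map_neg, omegaFun_apply, Finset.sum_eq_single k]
  · rw [dualElt_Ep_A, dualElt_Em_A, if_neg, if_neg, if_neg, if_pos] <;> first | omega | simp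
  · intro l hl hlk
    have := Finset.mem_range.mp hl
    rw [dualElt_Ep_A, dualElt_Em_A, if_neg, if_neg, if_neg, if_neg] <;> first | omega | simp
  · intro h
    exact absurd (Finset.mem_range.mpr (by omega)) h

theorem omegaFun_xv (hp : 4 * (p + 1) ≤ M) (hk : k ≤ p) (j : Idx M k) :
    omegaFun M γ δ p (xv M k j) = 0 := by
  have := j.lower
  have := j.upper
  rw [xv, omegaFun_apply]
  refine Finset.sum_eq_zero fun l hl => ?_
  have := Finset.mem_range.mp hl
  rw [dualElt_Ep_A, dualElt_Em_A, if_neg, if_neg, if_neg, if_neg] <;> first | omega | simp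

theorem omegaFun_yv (hp : 4 * (p + 1) ≤ M) (hk : k ≤ p) (j : Idx M k) :
    omegaFun M γ δ p (yv M k j) = 0 := by
  have := j.lower
  have := j.upper
  rw [yv, omegaFun_apply]
  refine Finset.sum_eq_zero fun l hl => ?_
  have := Finset.mem_range.mp hl
  rw [dualElt_Ep_A, dualElt_Em_A, if_neg, if_neg, if_neg, if_neg] <;> first | omega | simp

end Omega

/-- The elements `H_{1+2}^k`, `H_{1-2}^k`, `A_{2k+1,j}`. -/
def pGen (k : ℕ) : Option (Option (Idx M k)) → so M
  | none => Hp M k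
  | some none => Hm M k
  | some (some j) => xv M k j

/-- The elements `E_{1+2}^k`, `E_{1-2}^k`, `A_{2k+2,M+1-j}`. -/
def qGen (k : ℕ) : Option (Option (Idx M k)) → so M
  | none => Ep M k
  | some none => Em M k
  | some (some j) => yv M k j

/-- The coefficients of `pGen ∧ qGen` in the `r`-matrix of one link. -/
def wt (k : ℕ) (η ξ : ℂ) : Option (Option (Idx M k)) → ℂ
  | none => η
  | some none => η * ξ
  | some (some _) => η

/-- The span of the `A_{i,j}` in the subalgebra `so(M-4k-4)`. -/
def innerSpan (k : ℕ) : Submodule ℂ (so M) :=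
  Submodule.span ℂ (Set.range fun ij : Idx M k × Idx M k => A M ij.1 ij.2)

variable {M}

theorem rMat_eq_sum (η ξ : ℕ → ℂ) {p : ℕ} (hp : 4 * (p + 1) ≤ M) : rMat M η ξ p =
    ∑ j : (Σ k : Fin (p + 1), Option (Option (Idx M k))),
      wt M j.1 (η j.1) (ξ j.1) j.2 • wedge (pGen M j.1 j.2) (qGen M j.1 j.2) := by
  rw [rMat, Finset.sum_range, Fintype.sum_sigma]
  refine Finset.sum_congr rfl fun k _ => ?_
  rw [Fintype.sum_option, Fintype.sum_option, wedgeInv_eq M (by have := k.2; omega), smul_add,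
    smul_add, smul_smul, Finset.smul_sum, add_assoc]
  rfl

theorem A_mem_innerSpan {k i j : ℕ} (hi : 2 * k + 3 ≤ i) (hiM : i ≤ M - (2 * k + 2))
    (hj : 2 * k + 3 ≤ j) (hjM : j ≤ M - (2 * k + 2)) : A M i j ∈ innerSpan M k :=
  Submodule.subset_span
    ⟨(⟨i, Finset.mem_Icc.mpr ⟨hi, hiM⟩⟩, ⟨j, Finset.mem_Icc.mpr ⟨hj, hjM⟩⟩), rfl⟩

theorem H_mem_innerSpan {k i : ℕ} (hi : 2 * k + 3 ≤ i) (hiM : i ≤ M - (2 * k + 2)) :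
    H M i ∈ innerSpan M k :=
  Submodule.smul_mem _ _ (A_mem_innerSpan hi hiM hi hiM)

theorem pGen_mem_innerSpan {k l : ℕ} (hkl : k < l) (hl : 4 * (l + 1) ≤ M)
    (i : Option (Option (Idx M l))) : pGen M l i ∈ innerSpan M k := by
  rcases i with _ | _ | j
  · exact add_mem (H_mem_innerSpan (by omega) (by omega)) (H_mem_innerSpan (by omega) (by omega))
  · exact sub_mem (H_mem_innerSpan (by omega) (by omega)) (H_mem_innerSpan (by omega) (by omega))
  · have := j.lower
    have := j.upper
    exact A_mem_innerSpan (by omega) (by omega) (by omega) (by omega)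

theorem qGen_mem_innerSpan {k l : ℕ} (hkl : k < l) (hl : 4 * (l + 1) ≤ M)
    (i : Option (Option (Idx M l))) : qGen M l i ∈ innerSpan M k := by
  rcases i with _ | _ | j
  · exact neg_mem (A_mem_innerSpan (by omega) (by omega) (by omega) (by omega))
  · exact neg_mem (A_mem_innerSpan (by omega) (by omega) (by omega) (by omega))
  · have := j.lower
    have := j.upper
    exact A_mem_innerSpan (by omega) (by omega) (by omega) (by omega)

section Darboux

variable (γ δ : ℕ → ℂ) {p : ℕ}

/-- The bracket of the inner subalgebra with these generators is zero or a combination of the x's of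
link k, on which the functional vanishes. Generators of different links are therefore ω-orthogonal.
-/
theorem omegaFun_lie_pGen (hp : 4 * (p + 1) ≤ M) {k : ℕ} (hk : k ≤ p) {x : so M}
    (hx : x ∈ innerSpan M k) (i : Option (Option (Idx M k))) :
    omegaFun M γ δ p ⁅x, pGen M k i⁆ = 0 := by
  have hk' : 4 * (k + 1) ≤ M := by omega
  have h : innerSpan M k ≤ LinearMap.ker (bracketDual (omegaFun M γ δ p) (pGen M k i)) := by
    refine Submodule.span_le.mpr ?_
    rintro _ ⟨⟨a, b⟩, rfl⟩
    change omegaFun M γ δ p ⁅A M a b, pGen M k i⁆ = 0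
    rcases i with _ | _ | j
    · rw [pGen, lie_A_Hp hk' a.lower a.upper b.lower b.upper, map_zero]
    · rw [pGen, lie_A_Hm hk' a.lower a.upper b.lower b.upper, map_zero]
    · rw [pGen, lie_A_xv M hk', map_neg, map_sum]
      simp [omegaFun_xv γ δ hp hk]
  exact h hx

theorem omegaFun_lie_qGen (hp : 4 * (p + 1) ≤ M) {k : ℕ} (hk : k ≤ p) {x : so M}
    (hx : x ∈ innerSpan M k) (i : Option (Option (Idx M k))) :
    omegaFun M γ δ p ⁅x, qGen M k i⁆ = 0 := by
  have hk' : 4 * (k + 1) ≤ M := by omega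
  have h : innerSpan M k ≤ LinearMap.ker (bracketDual (omegaFun M γ δ p) (qGen M k i)) := by
    refine Submodule.span_le.mpr ?_
    rintro _ ⟨⟨a, b⟩, rfl⟩
    change omegaFun M γ δ p ⁅A M a b, qGen M k i⁆ = 0
    rcases i with _ | _ | j
    · rw [qGen, lie_A_Ep hk' a.lower a.upper b.lower b.upper, map_zero]
    · rw [qGen, lie_A_Em hk' a.lower a.upper b.lower b.upper, map_zero]
    · rw [qGen, lie_A_yv M hk', map_sum]
      simp [omegaFun_yv γ δ hp hk]
  exact h hx

theorem omegaFun_lie_swap {x y : so M} (h : omegaFun M γ δ p ⁅x, y⁆ = 0) :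
    omegaFun M γ δ p ⁅y, x⁆ = 0 := by
  rw [← lie_skew, map_neg, h, neg_zero]

theorem omegaFun_pGen_pGen (hp : 4 * (p + 1) ≤ M) {k : ℕ} (hk : k ≤ p)
    (i j : Option (Option (Idx M k))) : omegaFun M γ δ p ⁅pGen M k i, pGen M k j⁆ = 0 := by
  have hk' : 4 * (k + 1) ≤ M := by omega
  have hx := omegaFun_xv γ δ hp hk
  have h1 : omegaFun M γ δ p ⁅Hp M k, Hm M k⁆ = 0 := by rw [lie_Hp_Hm hk', map_zero]
  have h2 (a : Idx M k) : omegaFun M γ δ p ⁅Hp M k, xv M k a⁆ = 0 := by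
    rw [lie_Hp_xv hk', map_smul, hx, smul_zero]
  have h3 (a : Idx M k) : omegaFun M γ δ p ⁅Hm M k, xv M k a⁆ = 0 := by
    rw [lie_Hm_xv hk', map_smul, hx, smul_zero]
  rcases i with _ | _ | a <;> rcases j with _ | _ | b <;> simp only [pGen]
  · rw [lie_self, map_zero]
  · exact h1
  · exact h2 b
  · exact omegaFun_lie_swap γ δ h1
  · rw [lie_self, map_zero]
  · exact h3 b
  · exact omegaFun_lie_swap γ δ (h2 a)
  · exact omegaFun_lie_swap γ δ (h3 a)
  · rw [lie_xv_xv hk', map_zero]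

theorem omegaFun_qGen_qGen (hp : 4 * (p + 1) ≤ M) {k : ℕ} (hk : k ≤ p)
    (i j : Option (Option (Idx M k))) : omegaFun M γ δ p ⁅qGen M k i, qGen M k j⁆ = 0 := by
  have hk' : 4 * (k + 1) ≤ M := by omega
  have h1 : omegaFun M γ δ p ⁅Ep M k, Em M k⁆ = 0 := by rw [lie_Ep_Em hk', map_zero]
  have h2 (a : Idx M k) : omegaFun M γ δ p ⁅Ep M k, yv M k a⁆ = 0 := by
    rw [lie_Ep_yv hk', map_zero]
  have h3 (a : Idx M k) : omegaFun M γ δ p ⁅yv M k a, Em M k⁆ = 0 := by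
    rw [lie_yv_Em hk', omegaFun_xv γ δ hp hk]
  rcases i with _ | _ | a <;> rcases j with _ | _ | b <;> simp only [qGen]
  · rw [lie_self, map_zero]
  · exact h1
  · exact h2 b
  · exact omegaFun_lie_swap γ δ h1
  · rw [lie_self, map_zero]
  · exact omegaFun_lie_swap γ δ (h3 b)
  · exact omegaFun_lie_swap γ δ (h2 a)
  · exact h3 a
  · rw [lie_yv_yv hk', map_zero]

theorem omegaFun_pGen_qGen (η ξ : ℕ → ℂ) (hp : 4 * (p + 1) ≤ M) {k : ℕ} (hk : k ≤ p)
    (i j : Option (Option (Idx M k))) :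
    omegaFun M (fun k => (η k)⁻¹) (fun k => -(η k * ξ k)⁻¹) p ⁅pGen M k i, qGen M k j⁆ =
      if i = j then (wt M k (η k) (ξ k) i)⁻¹ else 0 := by
  have hk' : 4 * (k + 1) ≤ M := by omega
  rcases i with _ | _ | a <;> rcases j with _ | _ | b <;>
    simp only [pGen, qGen, wt, if_true, reduceCtorEq, if_false, Option.some.injEq]
  · rw [lie_Hp_Ep hk', omegaFun_Ep _ _ hp hk]
  · rw [lie_Hp_Em hk', map_zero]
  · rw [lie_Hp_yv hk', map_smul, omegaFun_yv _ _ hp hk, smul_zero]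
  · rw [lie_Hm_Ep hk', map_zero]
  · rw [lie_Hm_Em hk', omegaFun_Em _ _ hp hk, neg_neg]
  · rw [lie_Hm_yv hk', map_smul, omegaFun_yv _ _ hp hk, smul_zero]
  · rw [← lie_skew, lie_Ep_xv hk', neg_zero, map_zero]
  · rw [← lie_skew, lie_Em_xv hk', neg_zero, map_zero]
  · rw [lie_xv_yv hk', apply_ite (omegaFun M _ _ p), map_zero, omegaFun_Ep _ _ hp hk]

/-- For different links the generator with the larger link number lies in the inner subalgebra of
the other, so the pairing is zero. Within one link only the brackets [p_i, q_i] have components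
along E_{1±2}. -/
theorem isDarboux (η ξ : ℕ → ℂ) (hp : 4 * (p + 1) ≤ M) :
    IsDarboux (J := Σ k : Fin (p + 1), Option (Option (Idx M k)))
      (omegaFun M (fun k => (η k)⁻¹) (fun k => -(η k * ξ k)⁻¹) p)
      (fun j => wt M j.1 (η j.1) (ξ j.1) j.2) (fun j => pGen M j.1 j.2)
      (fun j => qGen M j.1 j.2) where
  p_p := by
    rintro ⟨⟨k, hk⟩, i⟩ ⟨⟨l, hl⟩, j⟩
    rcases lt_trichotomy k l with h | rfl | h
    · exact omegaFun_lie_swap _ _ (omegaFun_lie_pGen _ _ hp (by omega)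
        (pGen_mem_innerSpan h (by omega) j) i)
    · exact omegaFun_pGen_pGen _ _ hp (by omega) i j
    · exact omegaFun_lie_pGen _ _ hp (by omega) (pGen_mem_innerSpan h (by omega) i) j
  q_q := by
    rintro ⟨⟨k, hk⟩, i⟩ ⟨⟨l, hl⟩, j⟩
    rcases lt_trichotomy k l with h | rfl | h
    · exact omegaFun_lie_swap _ _ (omegaFun_lie_qGen _ _ hp (by omega)
        (qGen_mem_innerSpan h (by omega) j) i)
    · exact omegaFun_qGen_qGen _ _ hp (by omega) i j
    · exact omegaFun_lie_qGen _ _ hp (by omega) (qGen_mem_innerSpan h (by omega) i) j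
  p_q := by
    rintro ⟨⟨k, hk⟩, i⟩ ⟨⟨l, hl⟩, j⟩
    rcases lt_trichotomy k l with h | rfl | h
    · rw [if_neg (fun h' => h.ne (congrArg (fun x => x.1.1) h'))]
      exact omegaFun_lie_swap _ _ (omegaFun_lie_pGen _ _ hp (by omega)
        (qGen_mem_innerSpan h (by omega) j) i)
    · simpa using omegaFun_pGen_qGen η ξ hp (by omega) i j
    · rw [if_neg (fun h' => h.ne' (congrArg (fun x => x.1.1) h'))]
      exact omegaFun_lie_qGen _ _ hp (by omega) (pGen_mem_innerSpan h (by omega) i) j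

end Darboux

/-! ### Identification of the carrier -/

section Frobenius

variable {p : ℕ}

theorem H_mem_frobSub {i : ℕ} (hi : 1 ≤ i) (hip : i ≤ 2 * p) : H M i ∈ frobSub M p :=
  LieSubalgebra.subset_lieSpan (Or.inl ⟨i, hi, hip, rfl⟩)

theorem A_mem_frobSub {i j : ℕ} (hi : 1 ≤ i) (hip : i ≤ 2 * p) (hij : i < j) (hj : j ≤ M) :
    A M i j ∈ frobSub M p :=
  LieSubalgebra.subset_lieSpan (Or.inr ⟨i, j, hi, hip, hij, hj, rfl⟩)

theorem pGen_mem_frobSub {k : ℕ} (hk : k < p) (i : Option (Option (Idx M k))) :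
    pGen M k i ∈ frobSub M p := by
  rcases i with _ | _ | j
  · exact add_mem (H_mem_frobSub (by omega) (by omega)) (H_mem_frobSub (by omega) (by omega))
  · exact sub_mem (H_mem_frobSub (by omega) (by omega)) (H_mem_frobSub (by omega) (by omega))
  · have := j.lower
    have := j.upper
    exact A_mem_frobSub (by omega) (by omega) (by omega) (by omega)

theorem qGen_mem_frobSub {k : ℕ} (hM : 4 * p ≤ M) (hk : k < p) (i : Option (Option (Idx M k))) :
    qGen M k i ∈ frobSub M p := by
  rcases i with _ | _ | j
  · exact neg_mem (A_mem_frobSub (by omega) (by omega) (by omega) (by omega))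
  · exact neg_mem (A_mem_frobSub (by omega) (by omega) (by omega) (by omega))
  · have := j.lower
    have := j.upper
    exact A_mem_frobSub (by omega) (by omega) (by omega) (by omega)

theorem frobSub_le (hM : 4 * p ≤ M) {K : LieSubalgebra ℂ (so M)}
    (hP : ∀ k < p, ∀ i, pGen M k i ∈ K) (hQ : ∀ k < p, ∀ i, qGen M k i ∈ K) :
    frobSub M p ≤ K := by
  have h1 {k j : ℕ} (hk : k < p) (hj : 2 * k + 2 ≤ j) (hjM : j ≤ M - 2 * k) :
      A M (2 * k + 1) j ∈ K := by
    -- Row 2k + 1 consists of E_{1-2}, the zero antidiagonal element, E_{1+2} and the x's.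
    rcases show j = 2 * k + 2 ∨ j = M - 2 * k ∨ j = M + 1 - (2 * k + 2) ∨
      (2 * k + 3 ≤ j ∧ j ≤ M - (2 * k + 2)) by omega with h | h | h | h
    · have := neg_mem (hQ k hk (some none))
      rwa [qGen, Em, Emi, neg_neg, ← h] at this
    · rw [show j = M + 1 - (2 * k + 1) by omega, A_self_bar M (by omega)]
      exact zero_mem _
    · have := neg_mem (hQ k hk none)
      rwa [qGen, Ep, Epl, neg_neg, ← h] at this
    · exact hP k hk (some (some ⟨j, Finset.mem_Icc.mpr h⟩))
  have h2 {k j : ℕ} (hk : k < p) (hj : 2 * k + 3 ≤ j) (hjM : j ≤ M - 2 * k) :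
      A M (2 * k + 2) j ∈ K := by
    rcases show j = M - 2 * k ∨ j = M + 1 - (2 * k + 2) ∨
      (2 * k + 3 ≤ j ∧ j ≤ M - (2 * k + 2)) by omega with h | h | h
    -- The last entry of row 2k + 2 is the mirror image of A_{2k+1,M-2k-1}, so it is again E_{1+2}.
    · have := hQ k hk none
      rwa [qGen, Ep, Epl, ← A_bar M (by omega) (by omega),
        show M + 1 - (M + 1 - (2 * k + 2)) = 2 * k + 2 by omega,
        show M + 1 - (2 * k + 1) = j by omega] at this
    · rw [h, A_self_bar M (by omega)]
      exact zero_mem _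
    · have := hQ k hk (some (some ⟨M + 1 - j, Finset.mem_Icc.mpr (by omega)⟩))
      rwa [qGen, yv, show M + 1 - (M + 1 - j) = j by omega] at this
  have h3 {i j : ℕ} (hi : 1 ≤ i) (hip : i ≤ 2 * p) (hij : i < j)
      (hj : j ≤ M - 2 * ((i - 1) / 2)) : A M i j ∈ K := by
    rcases Nat.even_or_odd' (i - 1) with ⟨k, h | h⟩
    · rw [show i = 2 * k + 1 by omega]
      exact h1 (by omega) (by omega) (by omega)
    · rw [show i = 2 * k + 2 by omega]
      exact h2 (by omega) (by omega) (by omega)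
  refine LieSubalgebra.lieSpan_le.mpr ?_
  rintro _ (⟨i, hi, hip, rfl⟩ | ⟨i, j, hi, hip, hij, hj, rfl⟩)
  · rcases Nat.even_or_odd' (i - 1) with ⟨k, h | h⟩
    · have := K.smul_mem (1 / 2 : ℂ) (add_mem (hP k (by omega) none) (hP k (by omega) (some none)))
      rw [pGen, pGen, Hp, Hm, ← show i = 2 * k + 1 by omega] at this
      rwa [show (1 / 2 : ℂ) • (H M i + H M (2 * k + 2) + (H M i - H M (2 * k + 2))) = H M i by
        module] at this
    · have := K.smul_mem (1 / 2 : ℂ) (sub_mem (hP k (by omega) none) (hP k (by omega) (some none)))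
      rw [pGen, pGen, Hp, Hm, ← show i = 2 * k + 2 by omega] at this
      rwa [show (1 / 2 : ℂ) • (H M (2 * k + 1) + H M i - (H M (2 * k + 1) - H M i)) = H M i by
        module] at this
  · by_cases h : j ≤ M - 2 * ((i - 1) / 2)
    · exact h3 hi hip hij h
    -- A column too far to the right is reflected: the mirror row M + 1 - j is smaller than i and
    -- belongs to an earlier link, whose range contains the column M + 1 - i.
    · rw [← neg_neg (A M i j), ← A_bar M (by omega) hj]
      exact neg_mem (h3 (by omega) (by omega) (by omega) (by omega))

/-- Values of r are combinations of the p's and q's, giving one inclusion. With all weights non-zero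
each p and q is itself a value of r, and the carrier, being a subalgebra, contains what they
generate. -/
theorem carrier_eq_frobSub (η ξ : ℕ → ℂ) (hp : 4 * (p + 1) ≤ M)
    (h : ∀ k ≤ p, η k ≠ 0 ∧ ξ k ≠ 0) :
    carrier (isRMatrix_rMat η ξ p hp) (ι_injective M) = frobSub M (p + 1) := by
  have hw (k : Fin (p + 1)) (i) : wt M k (η k) (ξ k) i ≠ 0 := by
    obtain ⟨h1, h2⟩ := h k (by omega)
    rcases i with _ | _ | j
    exacts [h1, mul_ne_zero h1 h2, h1]
  refine le_antisymm ?_ (frobSub_le hp ?_ ?_)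
  · rintro _ ⟨φ, rfl⟩
    rw [rMat_eq_sum η ξ hp, sharp_sum_wedge]
    exact sum_mem fun j _ => LieSubalgebra.smul_mem _ _ (sub_mem
      (LieSubalgebra.smul_mem _ _ (qGen_mem_frobSub hp j.1.2 j.2))
      (LieSubalgebra.smul_mem _ _ (pGen_mem_frobSub j.1.2 j.2)))
  · intro k hk i
    rw [mem_carrier, rMat_eq_sum η ξ hp]
    exact ⟨_, (isDarboux η ξ hp).p_mem (i := ⟨⟨k, hk⟩, i⟩) (hw _ _)⟩
  · intro k hk i
    rw [mem_carrier, rMat_eq_sum η ξ hp]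
    exact ⟨_, (isDarboux η ξ hp).q_mem (i := ⟨⟨k, hk⟩, i⟩) (hw _ _)⟩

end Frobenius

end SOChain

theorem mainTheorem1 (M p : ℕ) (hM : 4 * (p + 1) ≤ M) (η ξ : ℕ → ℂ) :
    -- the full chain satisfies the twist equations
    Twist.IsTwist (SOChain.chain M η ξ p) ∧
    -- `R = F₂₁ F⁻¹` is a triangular universal `R`-matrix of the twisted algebra
    Twist.IsTriangular (SOChain.chain M η ξ p) (Twist.univR (SOChain.chain M η ξ p)) ∧
    -- the classical `r`-matrix, and its quantization
    Classical2.IsRMatrix (SOChain.rMat M η ξ p) ∧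
    Classical2.Quantizes (SOChain.chain M η ξ p) (SOChain.rMat M η ξ p) ∧
    -- the corresponding coboundary Frobenius form, with `γ_k = 1 / η_k`,
    -- `δ_k = -1 / (η_k ξ_k)` (and `1 / 0 = 0`)
    (∃ K : LieSubalgebra ℂ (SOChain.so M),
      Classical2.Corresponds (SOChain.rMat M η ξ p)
        (SOChain.omegaFun M (fun k => (η k)⁻¹) (fun k => -(η k * ξ k)⁻¹) p) K ∧
      ((∀ k ≤ p, η k ≠ 0 ∧ ξ k ≠ 0) → K = SOChain.frobSub M (p + 1))) :=
  have h := SOChain.isTwist_chain η ξ p hM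
  have hr := SOChain.isRMatrix_rMat η ξ p hM
  ⟨h, h.isTriangular Classical2.comul_cocomm, hr, SOChain.quantizes_chain η ξ p hM,
    Classical2.carrier hr (SOChain.ι_injective M),
    (SOChain.isDarboux η ξ hM).corresponds hr (SOChain.rMat_eq_sum η ξ hM) (SOChain.ι_injective M),
    SOChain.carrier_eq_frobSub η ξ hM⟩
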